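/- **Notation.** Let $\widetilde{\mathfrak{gl}}_\infty$ be the Lie algebra of complex matrices $(a_{ij})_{i,j\in\mathbb Z}$ with finitely many nonzero diagonals, and let $\widehat{\mathfrak{gl}}_\infty=\widetilde{\mathfrak{gl}}_\infty\oplus\mathbb C C$ be its central extension with bracket $[A,B]^{\wedge}=[A,B]+\operatorname{tr}([J,A]B)\,C$, where $J=\sum_{i\le 0}E_{ii}$ and $C$ is central. Let $\mathfrak{gl}^{(1)}$ and $\mathfrak{gl}^{(2)}$ be the subalgebras of matrices supported on $\{i\le0\}\times\{j\le 0\}$ and $\{i>0\}\times\{j>0\}$, let $\mathfrak a_+$ and $\mathfrak a_-$ be the subalgebras of matrices supported on $\{i\le0<j\}$ and $\{j\le 0<i\}$, and let $\mathfrak n_+$ be the subalgebra of strictly upper triangular matrices. A weight is a finitely supported family $\chi=(\chi_i)_{i\in\mathbb Z}$ of complex numbers, acting on diagonal matrices by $\operatorname{diag}(a_i)\mapsto\sum_i\chi_ia_i$. It is *semidominant* if all $\chi_i$ are integers, $\dots\ge\chi_{-1}\ge\chi_0$ and $\chi_1\ge\chi_2\ge\cdots$. Let $L_{\chi^{(i)}}$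 be the irreducible highest weight $\mathfrak{gl}^{(i)}$-module whose highest weight is the restriction of $\chi$. For $c\in\mathbb C$ let $\gamma=\mathfrak{gl}^{(1)}\oplus\mathfrak{gl}^{(2)}\oplus\mathfrak a_+\oplus\mathbb CC$ act on $L_{\chi^{(1)}}\otimes L_{\chi^{(2)}}$ with $\mathfrak a_+$ acting by $0$ and $C$ by $c$, and put $\mathrm{Ind}_{\chi,c}=U(\widehat{\mathfrak{gl}}_\infty)\otimes_{U(\gamma)}(L_{\chi^{(1)}}\otimes L_{\chi^{(2)}})$. For $l\ge0$ the *level* $l$ of $\mathrm{Ind}_{\chi,c}$ is the span of the vectors $y_1\cdots y_l\,(1\otimes v)$ with $y_1,\dots,y_l\in\mathfrak a_-$ and $v\in L_{\chi^{(1)}}\otimes L_{\chi^{(2)}}$. A *singular vector* is a nonzero vector annihilated by $\mathfrak n_+$. **Theorem.** Let $\chi$ be a semidominant weight. Then there is a function $\delta\colon\mathbb Z_{\ge0}\to\mathbb Z_{\ge0}$ with $\delta(N)\to\infty$ as $N\to\infty$ such that, for every $N\in\mathbb Z_{\ge0}$: 1. $\mathrm{Ind}_{\chi,-N}$ has no singular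 vectors on the levels $l$ with $0<l<\delta(N)$; 2. the maximal submodule of $\mathrm{Ind}_{\chi,-N}$ (the sum of all its proper submodules) has zero intersection with every level $l$ with $0\le l<\delta(N)$. -/

import Mathlib

open Filter
open scoped TensorProduct

attribute [local instance 100] LieRing.ofAssociativeRing

noncomputable section

namespace GlInfty

/-! ### Matrices indexed by `ℤ` with finitely many nonzero diagonals -/

/-- The `(i, j)` entry of an endomorphism of `⨁_{j ∈ ℤ} ℂ e_j`, that is, of a column-finite
`ℤ × ℤ` matrix; composition of endomorphisms is multiplication of matrices. -/
def entry (A : Module.End ℂ (ℤ →₀ ℂ)) (i j : ℤ) : ℂ := A (Finsupp.single j 1) i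

theorem entry_add (A B : Module.End ℂ (ℤ →₀ ℂ)) (i j : ℤ) :
    entry (A + B) i j = entry A i j + entry B i j := rfl

theorem entry_sub (A B : Module.End ℂ (ℤ →₀ ℂ)) (i j : ℤ) :
    entry (A - B) i j = entry A i j - entry B i j := rfl

theorem entry_smul (c : ℂ) (A : Module.End ℂ (ℤ →₀ ℂ)) (i j : ℤ) :
    entry (c • A) i j = c * entry A i j := rfl

theorem entry_zero (i j : ℤ) : entry 0 i j = 0 := rfl

theorem apply_eq_sum (A : Module.End ℂ (ℤ →₀ ℂ)) (v : ℤ →₀ ℂ) (i : ℤ) :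
    A v i = v.sum fun k b => entry A i k * b := by
  conv_lhs => rw [← Finsupp.sum_single v]
  rw [map_finsuppSum, Finsupp.sum_apply]
  refine Finsupp.sum_congr fun k _ => ?_
  rw [← mul_one (v k), ← smul_eq_mul, ← Finsupp.smul_single, map_smul, Finsupp.smul_apply,
    smul_eq_mul, smul_eq_mul, mul_one, mul_comm]
  rfl

theorem entry_mul (A B : Module.End ℂ (ℤ →₀ ℂ)) (i j : ℤ) (S : Finset ℤ)
    (hS : ∀ k, entry A i k * entry B k j ≠ 0 → k ∈ S) :
    entry (A * B) i j = ∑ k ∈ S, entry A i k * entry B k j := by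
  have h : entry (A * B) i j =
      ∑ k ∈ (B (Finsupp.single j 1)).support, entry A i k * entry B k j :=
    apply_eq_sum A (B (Finsupp.single j 1)) i
  classical
  rw [h, Finset.sum_subset (Finset.subset_union_left (s₂ := S)),
    ← Finset.sum_subset (Finset.subset_union_right (s₁ := (B (Finsupp.single j 1)).support))]
  · intro k _ hk
    by_contra h0
    exact hk (hS k h0)
  · intro k _ hk
    have : entry B k j = 0 := by simpa [entry] using hk
    rw [this, mul_zero]

theorem entry_mul_eq_zero (A B : Module.End ℂ (ℤ →₀ ℂ)) (i j : ℤ)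
    (h : ∀ k, entry A i k ≠ 0 → entry B k j ≠ 0 → False) : entry (A * B) i j = 0 := by
  rw [entry_mul A B i j ∅ fun k hk => (h k (left_ne_zero_of_mul hk) (right_ne_zero_of_mul hk)).elim]
  simp

theorem end_ext {A B : Module.End ℂ (ℤ →₀ ℂ)} (h : ∀ i j, entry A i j = entry B i j) :
    A = B := by
  refine Finsupp.lhom_ext' fun j => LinearMap.ext_ring ?_
  exact Finsupp.ext fun i => h i j

/-- The associative algebra of `ℤ × ℤ` matrices with finitely many nonzero diagonals. As a Lie
algebra under the commutator it is the algebra of which `GlHat` is the central extension. -/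
def Mat : Subalgebra ℂ (Module.End ℂ (ℤ →₀ ℂ)) where
  carrier := {A | ∃ K : ℤ, ∀ i j, K < |i - j| → entry A i j = 0}
  mul_mem' := by
    rintro A B ⟨K, hK⟩ ⟨L, hL⟩
    refine ⟨K + L, fun i j hij => entry_mul_eq_zero A B i j fun k h1 h2 => ?_⟩
    have h3 : |i - k| ≤ K := not_lt.1 fun h => h1 (hK i k h)
    have h4 : |k - j| ≤ L := not_lt.1 fun h => h2 (hL k j h)
    have h5 := abs_sub_le i k j
    omega
  add_mem' := by
    rintro A B ⟨K, hK⟩ ⟨L, hL⟩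
    refine ⟨max K L, fun i j hij => ?_⟩
    rw [entry_add, hK i j (lt_of_le_of_lt (le_max_left _ _) hij),
      hL i j (lt_of_le_of_lt (le_max_right _ _) hij), add_zero]
  algebraMap_mem' := by
    intro r
    refine ⟨0, fun i j hij => ?_⟩
    have : j ≠ i := by rintro rfl; simp at hij
    simp [entry, Module.algebraMap_end_apply, this]

instance : Ring Mat := Subalgebra.toRing (R := ℂ) (A := Module.End ℂ (ℤ →₀ ℂ)) Mat

/-- The diagonal idempotent with entries `1` at the places `i` with `p i`. -/
def idem (p : ℤ → Prop) [DecidablePred p] : Mat :=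
  ⟨{ toFun := fun v => v.filter p
     map_add' := fun _ _ => Finsupp.filter_add
     map_smul' := fun _ _ => Finsupp.filter_smul }, by
    refine ⟨0, fun i j hij => ?_⟩
    have : j ≠ i := by rintro rfl; simp at hij
    simp [entry, Finsupp.filter_apply, this]⟩

theorem entry_idem (p : ℤ → Prop) [DecidablePred p] (i j : ℤ) :
    entry (idem p).1 i j = if i = j ∧ p i then 1 else 0 := by
  change Finsupp.filter p (Finsupp.single j (1 : ℂ)) i = _
  rw [Finsupp.filter_apply, Finsupp.single_apply]
  by_cases h : i = j
  · simp [h]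
  · simp [h, Ne.symm h]

theorem entry_idem_mul (p : ℤ → Prop) [DecidablePred p] (A : Mat) (i j : ℤ) :
    entry (idem p * A : Mat).1 i j = if p i then entry A.1 i j else 0 := by
  change entry ((idem p).1 * A.1) i j = _
  rw [entry_mul _ _ i j {i}]
  · simp [entry_idem]
  · intro k hk
    rw [entry_idem] at hk
    by_contra h
    have : i ≠ k := fun h' => h (by simp [h'])
    simp [this] at hk

theorem entry_mul_idem (p : ℤ → Prop) [DecidablePred p] (A : Mat) (i j : ℤ) :
    entry (A * idem p : Mat).1 i j = if p j then entry A.1 i j else 0 := by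
  change entry (A.1 * (idem p).1) i j = _
  rw [entry_mul _ _ i j {j}]
  · simp [entry_idem]
  · intro k hk
    rw [entry_idem] at hk
    by_contra h
    have : k ≠ j := fun h' => h (by simp [h'])
    simp [this] at hk

/-! ### The cocycle `ω(A, B) = tr([J, A] B)`, `J = ∑_{i ≤ 0} E_{ii}` -/

/-- The sum of the diagonal entries. -/
def tr (A : Mat) : ℂ := ∑ᶠ i : ℤ, entry A.1 i i

/-- `A` has only finitely many nonzero entries. -/
def IsFin (A : Mat) : Prop :=
  ∃ R : ℤ, ∀ i j, entry A.1 i j ≠ 0 → |i| ≤ R ∧ |j| ≤ R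

theorem tr_eq_sum (A : Mat) (S : Finset ℤ) (hS : ∀ i, entry A.1 i i ≠ 0 → i ∈ S) :
    tr A = ∑ i ∈ S, entry A.1 i i :=
  finsum_eq_sum_of_support_subset _ fun i hi => hS i hi

theorem IsFin.add {A B : Mat} (hA : IsFin A) (hB : IsFin B) : IsFin (A + B) := by
  obtain ⟨R, hR⟩ := hA
  obtain ⟨T, hT⟩ := hB
  refine ⟨max R T, fun i j h => ?_⟩
  by_cases h0 : entry A.1 i j = 0
  · have h1 : entry B.1 i j ≠ 0 := fun h1 => h (by
      change entry A.1 i j + entry B.1 i j = 0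
      rw [h0, h1, add_zero])
    exact ⟨(hT i j h1).1.trans (le_max_right _ _), (hT i j h1).2.trans (le_max_right _ _)⟩
  · exact ⟨(hR i j h0).1.trans (le_max_left _ _), (hR i j h0).2.trans (le_max_left _ _)⟩

theorem IsFin.mul_right {F : Mat} (hF : IsFin F) (X : Mat) : IsFin (F * X) := by
  obtain ⟨R, hR⟩ := hF
  obtain ⟨K, hK⟩ := X.2
  refine ⟨max R (R + K), fun i j h => ?_⟩
  by_contra hn
  refine h (entry_mul_eq_zero F.1 X.1 i j fun k h1 h2 => hn ?_)
  have h3 : |k - j| ≤ K := not_lt.1 fun h => h2 (hK k j h)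
  have h4 := hR i k h1
  have h5 : |j| ≤ |k| + |k - j| := by
    have := abs_sub k (k - j)
    rwa [sub_sub_cancel] at this
  exact ⟨h4.1.trans (le_max_left _ _), le_trans (by omega) (le_max_right _ _)⟩

theorem IsFin.mul_left {F : Mat} (hF : IsFin F) (X : Mat) : IsFin (X * F) := by
  obtain ⟨R, hR⟩ := hF
  obtain ⟨K, hK⟩ := X.2
  refine ⟨max R (R + K), fun i j h => ?_⟩
  by_contra hn
  refine h (entry_mul_eq_zero X.1 F.1 i j fun k h1 h2 => hn ?_)
  have h3 : |i - k| ≤ K := not_lt.1 fun h => h1 (hK i k h)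
  have h4 := hR k j h2
  have h5 : |i| ≤ |i - k| + |k| := by
    have := abs_add_le (i - k) k
    rwa [sub_add_cancel] at this
  exact ⟨le_trans (by omega) (le_max_right _ _), h4.2.trans (le_max_left _ _)⟩

theorem tr_add {A B : Mat} (hA : IsFin A) (hB : IsFin B) : tr (A + B) = tr A + tr B := by
  obtain ⟨R, hR⟩ := hA
  obtain ⟨T, hT⟩ := hB
  refine finsum_add_distrib ((Set.finite_Icc (-R) R).subset ?_)
    ((Set.finite_Icc (-T) T).subset ?_)
  · intro i hi
    exact abs_le.1 (hR i i hi).1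
  · intro i hi
    exact abs_le.1 (hT i i hi).1

theorem tr_smul (c : ℂ) (A : Mat) : tr (c • A) = c * tr A :=
  (smul_finsum c _).symm

theorem tr_mul_comm {F : Mat} (hF : IsFin F) (X : Mat) : tr (F * X) = tr (X * F) := by
  obtain ⟨R, hR⟩ := hF
  have hm : ∀ {i : ℤ}, |i| ≤ R → i ∈ Finset.Icc (-R) R := fun h => Finset.mem_Icc.2 (abs_le.1 h)
  have h1 : ∀ i, entry (F * X : Mat).1 i i =
      ∑ k ∈ Finset.Icc (-R) R, entry F.1 i k * entry X.1 k i := fun i =>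
    entry_mul F.1 X.1 i i _ fun k hk => hm (hR i k (left_ne_zero_of_mul hk)).2
  have h2 : ∀ i, entry (X * F : Mat).1 i i =
      ∑ k ∈ Finset.Icc (-R) R, entry X.1 i k * entry F.1 k i := fun i =>
    entry_mul X.1 F.1 i i _ fun k hk => hm (hR k i (right_ne_zero_of_mul hk)).1
  rw [tr_eq_sum (F * X) (Finset.Icc (-R) R), tr_eq_sum (X * F) (Finset.Icc (-R) R),
    Finset.sum_congr rfl fun i _ => h1 i, Finset.sum_congr rfl fun i _ => h2 i, Finset.sum_comm]
  · exact Finset.sum_congr rfl fun i _ => Finset.sum_congr rfl fun k _ => mul_comm _ _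
  · intro i hi
    rw [h2] at hi
    obtain ⟨k, _, hk⟩ := Finset.exists_ne_zero_of_sum_ne_zero hi
    exact hm (hR k i (right_ne_zero_of_mul hk)).2
  · intro i hi
    rw [h1] at hi
    obtain ⟨k, _, hk⟩ := Finset.exists_ne_zero_of_sum_ne_zero hi
    exact hm (hR i k (left_ne_zero_of_mul hk)).1

/-- The diagonal idempotent `J = ∑_{i ≤ 0} E_{ii}`. -/
def J : Mat := idem (· ≤ 0)

/-- `[J, A]`. -/
def dJ (A : Mat) : Mat := J * A - A * J

theorem entry_dJ (A : Mat) (i j : ℤ) :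
    entry (dJ A).1 i j =
      (if i ≤ 0 then entry A.1 i j else 0) - (if j ≤ 0 then entry A.1 i j else 0) := by
  rw [← entry_idem_mul (· ≤ 0), ← entry_mul_idem (· ≤ 0)]
  rfl

theorem isFin_dJ (A : Mat) : IsFin (dJ A) := by
  obtain ⟨K, hK⟩ := A.2
  refine ⟨K, fun i j hij => ?_⟩
  rw [entry_dJ] at hij
  have h1 : |i - j| ≤ K := by
    by_contra h
    rw [hK i j (not_le.1 h)] at hij
    simp at hij
  rw [abs_le] at h1
  rw [abs_le, abs_le]
  by_cases hi : i ≤ 0 <;> by_cases hj : j ≤ 0 <;> simp [hi, hj] at hij <;> omega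

theorem dJ_add (A B : Mat) : dJ (A + B) = dJ A + dJ B := by
  unfold dJ; noncomm_ring

theorem dJ_smul (c : ℂ) (A : Mat) : dJ (c • A) = c • dJ A := by
  simp only [dJ, mul_smul_comm, smul_mul_assoc, smul_sub]

theorem dJ_mul (A B : Mat) : dJ (A * B) = dJ A * B + A * dJ B := by
  unfold dJ; noncomm_ring

theorem tr_dJ (A : Mat) : tr (dJ A) = 0 := by
  rw [tr_eq_sum _ ∅]
  · simp
  · intro i hi
    rw [entry_dJ, sub_self] at hi
    exact (hi rfl).elim

/-- `ω(A, B) = tr([J, A] B)`. -/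
def omega (A B : Mat) : ℂ := tr (dJ A * B)

theorem omega_add_right (A B C : Mat) : omega A (B + C) = omega A B + omega A C := by
  unfold omega
  rw [mul_add, tr_add ((isFin_dJ A).mul_right B) ((isFin_dJ A).mul_right C)]

theorem omega_add_left (A B C : Mat) : omega (A + B) C = omega A C + omega B C := by
  unfold omega
  rw [dJ_add, add_mul, tr_add ((isFin_dJ A).mul_right C) ((isFin_dJ B).mul_right C)]

theorem omega_smul_right (c : ℂ) (A B : Mat) : omega A (c • B) = c * omega A B := by
  unfold omega
  rw [mul_smul_comm, tr_smul]

theorem omega_smul_left (c : ℂ) (A B : Mat) : omega (c • A) B = c * omega A B := by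
  unfold omega
  rw [dJ_smul, smul_mul_assoc, tr_smul]

theorem omega_skew (A B : Mat) : omega A B = -omega B A := by
  have h : tr (dJ A * B + A * dJ B) = 0 := by rw [← dJ_mul, tr_dJ]
  rw [tr_add ((isFin_dJ A).mul_right B) ((isFin_dJ B).mul_left A),
    ← tr_mul_comm (isFin_dJ B) A] at h
  exact eq_neg_of_add_eq_zero_left h

theorem omega_self (A : Mat) : omega A A = 0 := self_eq_neg.1 (omega_skew A A)

theorem omega_mul (A B C : Mat) :
    omega (A * B) C = omega A (B * C) + omega B (C * A) := by
  have h : tr (A * dJ B * C) = tr (dJ B * (C * A)) := by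
    rw [mul_assoc, ← tr_mul_comm ((isFin_dJ B).mul_right C) A, mul_assoc]
  unfold omega
  rw [dJ_mul, add_mul, tr_add (((isFin_dJ A).mul_right B).mul_right C)
    (((isFin_dJ B).mul_left A).mul_right C), h, mul_assoc]

theorem omega_sub_right (A B C : Mat) : omega A (B - C) = omega A B - omega A C := by
  rw [eq_sub_iff_add_eq, ← omega_add_right, sub_add_cancel]

theorem omega_sub_left (A B C : Mat) : omega (A - B) C = omega A C - omega B C := by
  rw [eq_sub_iff_add_eq, ← omega_add_left, sub_add_cancel]

/-- `ω` as a bilinear map. -/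
def omegaBilin : Mat →ₗ[ℂ] Mat →ₗ[ℂ] ℂ :=
  LinearMap.mk₂ ℂ omega omega_add_left omega_smul_left omega_add_right omega_smul_right

/-- `ω` as a 2-cocycle of the Lie algebra `Mat` with values in the trivial module `ℂ`. -/
def cocycle : LieModule.Cohomology.twoCocycle ℂ Mat (TrivialLieModule ℂ Mat ℂ) :=
  ⟨⟨omegaBilin.compr₂ (TrivialLieModule.equiv ℂ Mat ℂ).symm.toLinearMap, omega_self⟩, by
    rw [LieModule.Cohomology.mem_twoCocycle_iff_of_trivial]
    intro x y z
    change omega x (y * z - z * y) = omega (x * y - y * x) z + omega y (x * z - z * x)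
    simp only [omega_sub_left, omega_sub_right, omega_mul]
    ring⟩

/-- The central extension of `Mat` by `ℂ` defined by the cocycle `ω`. -/
abbrev GlHat : Type := LieAlgebra.ofTwoCocycle cocycle

/-- The underlying matrix of an element of `GlHat`. -/
def mat (X : GlHat) : Mat := X.carrier.1

/-- The central coordinate of an element of `GlHat`. -/
def cen (X : GlHat) : ℂ := TrivialLieModule.equiv ℂ Mat ℂ X.carrier.2

theorem mat_add (X Y : GlHat) : mat (X + Y) = mat X + mat Y := rfl
theorem mat_smul (c : ℂ) (X : GlHat) : mat (c • X) = c • mat X := rfl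
theorem mat_zero : mat 0 = 0 := rfl
theorem mat_lie (X Y : GlHat) : mat ⁅X, Y⁆ = mat X * mat Y - mat Y * mat X := rfl
theorem cen_add (X Y : GlHat) : cen (X + Y) = cen X + cen Y := rfl
theorem cen_smul (c : ℂ) (X : GlHat) : cen (c • X) = c * cen X := rfl
theorem cen_zero : cen 0 = 0 := rfl
theorem cen_lie (X Y : GlHat) : cen ⁅X, Y⁆ = omega (mat X) (mat Y) := by
  change omega (mat X) (mat Y) + 0 - 0 = _
  rw [add_zero, sub_zero]

/-! ### Irreducible highest weight modules of the two diagonal blocks -/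

/-- The Lie algebra of the matrices all of whose nonzero entries are at places `(i, j)` with
`p i` and `p j`. -/
def block (p : ℤ → Prop) : LieSubalgebra ℂ Mat where
  carrier := {A | ∀ i j, entry A.1 i j ≠ 0 → p i ∧ p j}
  add_mem' := by
    intro A B hA hB i j h
    by_cases h0 : entry A.1 i j = 0
    · refine hB i j fun h1 => h ?_
      change entry A.1 i j + entry B.1 i j = 0
      rw [h0, h1, add_zero]
    · exact hA i j h0
  zero_mem' := fun i j h => (h rfl).elim
  smul_mem' := by
    intro c A hA i j h
    exact hA i j (right_ne_zero_of_mul (a := c) h)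
  lie_mem' := by
    intro A B hA hB i j h
    by_contra hn
    have h1 : entry (A.1 * B.1) i j = 0 := entry_mul_eq_zero _ _ i j fun k h1 h2 =>
      hn ⟨(hA i k h1).1, (hB k j h2).2⟩
    have h2 : entry (B.1 * A.1) i j = 0 := entry_mul_eq_zero _ _ i j fun k h1 h2 =>
      hn ⟨(hB i k h1).1, (hA k j h2).2⟩
    refine h ?_
    change entry (A.1 * B.1) i j - entry (B.1 * A.1) i j = 0
    rw [h1, h2, sub_zero]

/-- The functional `diag(a_i) ↦ ∑ χ_i a_i` on diagonal matrices. -/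
def weight (χ : ℤ →₀ ℂ) (A : Mat) : ℂ := χ.sum fun i c => c * entry A.1 i i

/-- The defining left ideal of the Verma module of highest weight `χ` of `block p`: it is generated
by the strictly upper triangular matrices and by all `h - χ(h)` with `h` diagonal. -/
def vermaIdeal (p : ℤ → Prop) (χ : ℤ →₀ ℂ) :
    Submodule (UniversalEnvelopingAlgebra ℂ (block p)) (UniversalEnvelopingAlgebra ℂ (block p)) :=
  Submodule.span _
    ({u | ∃ A : block p, (∀ i j, j ≤ i → entry A.1.1 i j = 0) ∧
        u = UniversalEnvelopingAlgebra.ι ℂ A} ∪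
     {u | ∃ A : block p, (∀ i j, i ≠ j → entry A.1.1 i j = 0) ∧
        u = UniversalEnvelopingAlgebra.ι ℂ A -
          algebraMap ℂ (UniversalEnvelopingAlgebra ℂ (block p)) (weight χ A.1)})

/-- The Verma module of highest weight `χ` of `block p`. -/
abbrev Verma (p : ℤ → Prop) (χ : ℤ →₀ ℂ) : Type :=
  UniversalEnvelopingAlgebra ℂ (block p) ⧸ vermaIdeal p χ

/-- The sum of all proper submodules of a module. -/
def maxSub (R M : Type*) [Ring R] [AddCommGroup M] [Module R M] : Submodule R M :=
  sSup {P : Submodule R M | P ≠ ⊤}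

/-- The irreducible module of highest weight `χ` of `block p`: the quotient of the Verma module by
its maximal proper submodule. -/
def Irr (p : ℤ → Prop) (χ : ℤ →₀ ℂ) : Type :=
  Verma p χ ⧸ maxSub (UniversalEnvelopingAlgebra ℂ (block p)) (Verma p χ)

section IrrInstances

variable (p : ℤ → Prop) (χ : ℤ →₀ ℂ)

instance : AddCommGroup (Irr p χ) :=
  inferInstanceAs (AddCommGroup
    (Verma p χ ⧸ maxSub (UniversalEnvelopingAlgebra ℂ (block p)) (Verma p χ)))

instance : Module (UniversalEnvelopingAlgebra ℂ (block p)) (Irr p χ) :=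
  inferInstanceAs (Module (UniversalEnvelopingAlgebra ℂ (block p))
    (Verma p χ ⧸ maxSub (UniversalEnvelopingAlgebra ℂ (block p)) (Verma p χ)))

instance : Module ℂ (Irr p χ) :=
  inferInstanceAs (Module ℂ
    (Verma p χ ⧸ maxSub (UniversalEnvelopingAlgebra ℂ (block p)) (Verma p χ)))

instance : IsScalarTower ℂ (UniversalEnvelopingAlgebra ℂ (block p)) (Irr p χ) :=
  inferInstanceAs (IsScalarTower ℂ (UniversalEnvelopingAlgebra ℂ (block p))
    (Verma p χ ⧸ maxSub (UniversalEnvelopingAlgebra ℂ (block p)) (Verma p χ)))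

end IrrInstances

/-- The action of a Lie algebra on a module over its universal enveloping algebra. -/
def act (g M : Type*) [LieRing g] [LieAlgebra ℂ g] [AddCommGroup M] [Module ℂ M]
    [Module (UniversalEnvelopingAlgebra ℂ g) M]
    [IsScalarTower ℂ (UniversalEnvelopingAlgebra ℂ g) M] : g →ₗ⁅ℂ⁆ Module.End ℂ M :=
  ((Algebra.lsmul ℂ ℂ M : UniversalEnvelopingAlgebra ℂ g →ₐ[ℂ] Module.End ℂ M) :
    UniversalEnvelopingAlgebra ℂ g →ₗ⁅ℂ⁆ Module.End ℂ M).comp (UniversalEnvelopingAlgebra.ι ℂ)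

/-! ### The parabolic subalgebra and its module `L_{χ⁽¹⁾} ⊗ L_{χ⁽²⁾}` -/

/-- The indices of the first block. -/
abbrev left (i : ℤ) : Prop := i ≤ 0

/-- The indices of the second block. -/
abbrev right (i : ℤ) : Prop := 0 < i

/-- The subalgebra `gl⁽¹⁾ ⊕ gl⁽²⁾ ⊕ a₊ ⊕ ℂC` of `GlHat`: the lower left block vanishes. -/
def parabolic : LieSubalgebra ℂ GlHat where
  carrier := {X | ∀ i j, right i → left j → entry (mat X).1 i j = 0}
  add_mem' := by
    intro X Y hX hY i j hi hj
    change entry (mat X).1 i j + entry (mat Y).1 i j = 0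
    rw [hX i j hi hj, hY i j hi hj, add_zero]
  zero_mem' := fun _ _ _ _ => rfl
  smul_mem' := by
    intro c X hX i j hi hj
    change c * entry (mat X).1 i j = 0
    rw [hX i j hi hj, mul_zero]
  lie_mem' := by
    intro X Y hX hY i j hi hj
    have key : ∀ A B : Mat, (∀ i j, right i → left j → entry A.1 i j = 0) →
        (∀ i j, right i → left j → entry B.1 i j = 0) → entry (A.1 * B.1) i j = 0 := by
      intro A B hA hB
      refine entry_mul_eq_zero _ _ i j fun k h1 h2 => ?_
      rcases le_or_gt k 0 with hk | hk
      · exact h1 (hA i k hi hk)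
      · exact h2 (hB k j hk hj)
    change entry ((mat X).1 * (mat Y).1) i j - entry ((mat Y).1 * (mat X).1) i j = 0
    rw [key _ _ hX hY, key _ _ hY hX, sub_zero]

/-- The diagonal block of a matrix on the indices satisfying `p`. -/
def compress (p : ℤ → Prop) [DecidablePred p] (A : Mat) : block p :=
  ⟨idem p * A * idem p, by
    intro i j h
    rw [entry_mul_idem, entry_idem_mul] at h
    by_cases hj : p j <;> by_cases hi : p i <;> simp_all⟩

theorem entry_compress (p : ℤ → Prop) [DecidablePred p] (A : Mat) (i j : ℤ) :
    entry (compress p A).1.1 i j = if p i ∧ p j then entry A.1 i j else 0 := by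
  change entry (idem p * A * idem p : Mat).1 i j = _
  rw [entry_mul_idem, entry_idem_mul]
  by_cases hj : p j <;> by_cases hi : p i <;> simp [hi, hj]

theorem compress_lie (p : ℤ → Prop) [DecidablePred p] (A B : Mat)
    (h : ∀ i k j, p i → ¬ p k → p j →
      entry A.1 i k * entry B.1 k j = 0 ∧ entry B.1 i k * entry A.1 k j = 0) :
    compress p (A * B - B * A) = ⁅compress p A, compress p B⁆ := by
  have key : ∀ X Y : Mat, (∀ i k j, p i → ¬ p k → p j → entry X.1 i k * entry Y.1 k j = 0) →
      ∀ i j, p i ∧ p j → entry ((compress p X).1.1 * (compress p Y).1.1) i j =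
        entry (X.1 * Y.1) i j := by
    intro X Y hXY i j hij
    obtain ⟨K, hK⟩ := X.2
    have hS : ∀ k, entry X.1 i k ≠ 0 → k ∈ Finset.Icc (i - K) (i + K) := by
      intro k hk
      have h1 : |i - k| ≤ K := not_lt.1 fun h => hk (hK i k h)
      rw [abs_le] at h1
      rw [Finset.mem_Icc]
      omega
    rw [entry_mul X.1 Y.1 i j _ fun k hk => hS k (left_ne_zero_of_mul hk),
      entry_mul _ _ i j (Finset.Icc (i - K) (i + K))]
    · refine Finset.sum_congr rfl fun k _ => ?_
      rw [entry_compress, entry_compress]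
      by_cases hk : p k
      · simp [hij.1, hij.2, hk]
      · simp [hk, hXY i k j hij.1 hk hij.2]
    · intro k hk
      refine hS k fun h0 => left_ne_zero_of_mul hk ?_
      rw [entry_compress, h0, ite_self]
  refine Subtype.ext (Subtype.ext (end_ext fun i j => ?_))
  change _ = entry ((compress p A).1.1 * (compress p B).1.1) i j -
    entry ((compress p B).1.1 * (compress p A).1.1) i j
  by_cases hij : p i ∧ p j
  · rw [key A B (fun i k j hi hk hj => (h i k j hi hk hj).1) i j hij,
      key B A (fun i k j hi hk hj => (h i k j hi hk hj).2) i j hij, entry_compress, if_pos hij]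
    rfl
  · have hz : ∀ X Y : Mat, entry ((compress p X).1.1 * (compress p Y).1.1) i j = 0 := by
      intro X Y
      refine entry_mul_eq_zero _ _ i j fun k h1 h2 => hij ?_
      exact ⟨((compress p X).2 i k h1).1, ((compress p Y).2 k j h2).2⟩
    rw [hz, hz, entry_compress, if_neg hij, sub_zero]

theorem compress_add (p : ℤ → Prop) [DecidablePred p] (A B : Mat) :
    compress p (A + B) = compress p A + compress p B :=
  Subtype.ext (by
    change idem p * (A + B) * idem p = idem p * A * idem p + idem p * B * idem p
    rw [mul_add, add_mul])

theorem compress_smul (p : ℤ → Prop) [DecidablePred p] (c : ℂ) (A : Mat) :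
    compress p (c • A) = c • compress p A :=
  Subtype.ext (by
    change idem p * (c • A) * idem p = c • (idem p * A * idem p)
    rw [mul_smul_comm, smul_mul_assoc])

theorem omega_eq_zero (X Y : parabolic) : omega (mat X.1) (mat Y.1) = 0 := by
  refine finsum_eq_zero_of_forall_eq_zero fun i => ?_
  refine entry_mul_eq_zero _ _ i i fun k h1 h2 => ?_
  rw [entry_dJ] at h1
  rcases le_or_gt i 0 with hi | hi <;> rcases le_or_gt k 0 with hk | hk
  · simp [hi, hk] at h1
  · exact h2 (Y.2 k i hk hi)
  · simp [X.2 i k hi hk] at h1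
  · simp [not_le.2 hi, not_le.2 hk] at h1

theorem compress_lie_left (X Y : parabolic) :
    compress left (mat ⁅X.1, Y.1⁆) = ⁅compress left (mat X.1), compress left (mat Y.1)⁆ :=
  compress_lie left (mat X.1) (mat Y.1) fun i k j _ hk hj => by
    have hk' : right k := not_le.1 hk
    rw [X.2 k j hk' hj, Y.2 k j hk' hj, mul_zero, mul_zero]
    exact ⟨rfl, rfl⟩

theorem compress_lie_right (X Y : parabolic) :
    compress right (mat ⁅X.1, Y.1⁆) = ⁅compress right (mat X.1), compress right (mat Y.1)⁆ :=
  compress_lie right (mat X.1) (mat Y.1) fun i k j hi hk _ => by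
    have hk' : left k := not_lt.1 hk
    rw [X.2 i k hi hk', Y.2 i k hi hk', zero_mul, zero_mul]
    exact ⟨rfl, rfl⟩

/-- The action of `parabolic` on `L_{χ⁽¹⁾} ⊗ L_{χ⁽²⁾}`: the two diagonal blocks act on the two
factors, `a₊` acts by zero and the central element by the scalar `c`. -/
def leviRep (χ : ℤ →₀ ℂ) (c : ℂ) :
    parabolic →ₗ⁅ℂ⁆ Module.End ℂ (Irr left χ ⊗[ℂ] Irr right χ) where
  toFun X :=
    LinearMap.rTensor (Irr right χ) (act (block left) (Irr left χ) (compress left (mat X.1))) +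
    LinearMap.lTensor (Irr left χ) (act (block right) (Irr right χ) (compress right (mat X.1))) +
    (c * cen X.1) • 1
  map_add' X Y := by
    change LinearMap.rTensor _ (act _ _ (compress left (mat X.1 + mat Y.1))) +
      LinearMap.lTensor _ (act _ _ (compress right (mat X.1 + mat Y.1))) +
      (c * (cen X.1 + cen Y.1)) • 1 = _
    rw [compress_add, compress_add, map_add, map_add, LinearMap.rTensor_add,
      LinearMap.lTensor_add, mul_add, add_smul]
    abel
  map_smul' r X := by
    change LinearMap.rTensor _ (act _ _ (compress left (r • mat X.1))) +
      LinearMap.lTensor _ (act _ _ (compress right (r • mat X.1))) +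
      (c * (r * cen X.1)) • 1 = r • _
    rw [compress_smul, compress_smul, map_smul, map_smul, LinearMap.rTensor_smul,
      LinearMap.lTensor_smul, mul_left_comm, mul_smul, smul_add, smul_add]
  map_lie' := by
    intro X Y
    change LinearMap.rTensor _ (act _ _ (compress left (mat ⁅X.1, Y.1⁆))) +
      LinearMap.lTensor _ (act _ _ (compress right (mat ⁅X.1, Y.1⁆))) +
      (c * cen ⁅X.1, Y.1⁆) • 1 = _
    rw [compress_lie_left, compress_lie_right, cen_lie, omega_eq_zero, LieHom.map_lie,
      LieHom.map_lie, mul_zero, zero_smul, add_zero]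
    refine TensorProduct.ext' fun v w => ?_
    simp only [LieRing.of_associative_ring_bracket, LinearMap.add_apply, LinearMap.sub_apply,
      LinearMap.rTensor_tmul, LinearMap.lTensor_tmul, Module.End.mul_apply, LinearMap.smul_apply,
      Module.End.one_apply, map_add, map_smul, TensorProduct.sub_tmul, TensorProduct.tmul_sub,
      smul_add, smul_smul]
    rw [mul_comm (c * cen X.1)]
    abel

/-! ### Induced modules -/

/-- The relations `u x ⊗ v = u ⊗ x v`, `x ∈ H`. -/
def inducedRel {g V : Type*} [LieRing g] [LieAlgebra ℂ g] (H : LieSubalgebra ℂ g)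
    [AddCommGroup V] [Module ℂ V] (ρ : H →ₗ⁅ℂ⁆ Module.End ℂ V) :
    Submodule (UniversalEnvelopingAlgebra ℂ g) (UniversalEnvelopingAlgebra ℂ g ⊗[ℂ] V) :=
  Submodule.span _ {t | ∃ (u : UniversalEnvelopingAlgebra ℂ g) (x : H) (v : V),
    t = (u * UniversalEnvelopingAlgebra.ι ℂ (x : g)) ⊗ₜ[ℂ] v - u ⊗ₜ[ℂ] ρ x v}

/-- The induced module `U(g) ⊗_{U(H)} V`. -/
abbrev Induced {g V : Type*} [LieRing g] [LieAlgebra ℂ g] (H : LieSubalgebra ℂ g)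
    [AddCommGroup V] [Module ℂ V] (ρ : H →ₗ⁅ℂ⁆ Module.End ℂ V) :=
  (UniversalEnvelopingAlgebra ℂ g ⊗[ℂ] V) ⧸ inducedRel H ρ

/-- The induced `GlHat`-module `Ind_{χ,c}`. -/
def Ind (χ : ℤ →₀ ℂ) (c : ℂ) : Type := Induced parabolic (leviRep χ c)

section IndInstances

variable (χ : ℤ →₀ ℂ) (c : ℂ)

instance : AddCommGroup (Ind χ c) :=
  inferInstanceAs (AddCommGroup (Induced parabolic (leviRep χ c)))

instance : Module (UniversalEnvelopingAlgebra ℂ GlHat) (Ind χ c) :=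
  inferInstanceAs (Module (UniversalEnvelopingAlgebra ℂ GlHat) (Induced parabolic (leviRep χ c)))

instance : Module ℂ (Ind χ c) :=
  inferInstanceAs (Module ℂ (Induced parabolic (leviRep χ c)))

instance : IsScalarTower ℂ (UniversalEnvelopingAlgebra ℂ GlHat) (Ind χ c) :=
  inferInstanceAs (IsScalarTower ℂ (UniversalEnvelopingAlgebra ℂ GlHat)
    (Induced parabolic (leviRep χ c)))

end IndInstances

/-- The image `1 ⊗ v` in `Ind_{χ,c}` of `v ∈ L_{χ⁽¹⁾} ⊗ L_{χ⁽²⁾}`. -/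
def Ind.base (χ : ℤ →₀ ℂ) (c : ℂ) (v : Irr left χ ⊗[ℂ] Irr right χ) : Ind χ c :=
  Submodule.Quotient.mk (p := inducedRel parabolic (leviRep χ c)) (1 ⊗ₜ[ℂ] v)

/-- The elements of `a₋ ⊂ GlHat`. -/
def aMinus : Set GlHat :=
  {X | cen X = 0 ∧ ∀ i j, entry (mat X).1 i j ≠ 0 → right i ∧ left j}

/-- The elements of `n₊ ⊂ GlHat`: strictly upper triangular matrices. -/
def nPlus : Set GlHat :=
  {X | cen X = 0 ∧ ∀ i j, j ≤ i → entry (mat X).1 i j = 0}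

/-- The level `l` of `Ind_{χ,c}`, that is `S^l(a₋) ⊗ L_{χ⁽¹⁾} ⊗ L_{χ⁽²⁾}`: the span of all
`y₁ ⋯ y_l (1 ⊗ v)` with `y₁, …, y_l ∈ a₋`. -/
def level (χ : ℤ →₀ ℂ) (c : ℂ) : ℕ → Submodule ℂ (Ind χ c)
  | 0 => Submodule.span ℂ (Set.range (Ind.base χ c))
  | l + 1 => Submodule.span ℂ {w | ∃ y ∈ aMinus, ∃ w' ∈ level χ c l,
      w = UniversalEnvelopingAlgebra.ι ℂ y • w'}

/-- A singular vector: a nonzero vector annihilated by `n₊`. -/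
def IsSingular {χ : ℤ →₀ ℂ} {c : ℂ} (w : Ind χ c) : Prop :=
  w ≠ 0 ∧ ∀ X ∈ nPlus, UniversalEnvelopingAlgebra.ι ℂ X • w = 0

/-- The maximal proper submodule of `Ind_{χ,c}`, as a space. -/
def maxSubmodule (χ : ℤ →₀ ℂ) (c : ℂ) : Submodule ℂ (Ind χ c) :=
  (maxSub (UniversalEnvelopingAlgebra ℂ GlHat) (Ind χ c)).restrictScalars ℂ

/-- The weight `χ` is integral and its restriction to each of the two blocks is dominant. -/
def IsSemidominant (χ : ℤ →₀ ℂ) : Prop :=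
  ∃ m : ℤ → ℤ, (∀ i, χ i = m i) ∧
    AntitoneOn m {i | left i} ∧ AntitoneOn m {i | right i}

end GlInfty

end

/-! Let Ω be the formal sum of all `E_{ij} E_{ji}` with `i > 0 ≥ j`; finite truncations (`casimir`)
suffice on any given vector. Ω kills every vector annihilated by `a₊`. On the other hand, moving
`E_{ji}` to the right through `y₁ ⋯ y_l (1 ⊗ v)` shows that Ω acts on level `l` as `l c - T`: the
scalar comes from the cocycle, and `T`, which comes from the commutators inside the two diagonal
blocks, does not involve `c` (`casimir_lower`). So a nonzero `a₊`-invariant on level `l` forces `l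
c` to be an eigenvalue of `T`.

The point is that `T` is algebraic. Since `χ` is semidominant with finite support, `L_{χ⁽²⁾}` is a
subquotient of a tensor power of the natural representation of the second block, and `L_{χ⁽¹⁾}` of a
tensor power of the dual natural representation of the first (`nonempty_model`). As `a₋` is itself
spanned by pairs (natural index, dual index), level `l` is covered by a space of tensors with `l`
additional factors of each kind (`level_le_map_realize`), and there `T` lifts to a sum of
transpositions of tensor factors (`casimir_realize`). This sum comes from a finite-dimensional group
algebra, so it is annihilated by a monic polynomial independent of `c`
(`exists_monic_aeval_transpositions₂`). For `l > 0` the number `-l N` is a root of it for finitely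
many `N` only, so for large `N` level `l` has no nonzero `a₊`-invariants
(`eventually_noInvariants`). The value `δ(N)` is the largest `d ≤ N` such that no level `0 < l < d`
has any.

Singular vectors are `a₊`-invariant because `a₊ ⊂ n₊`. For the maximal submodule, `a₊` lowers the
level by one, so by induction its intersection with a level `0 < l < δ(N)` consists of
`a₊`-invariants and vanishes. The induction starts at level 0, the image of `L_{χ⁽¹⁾} ⊗ L_{χ⁽²⁾}`,
which is irreducible under the two blocks by Schur's lemma (`schur_right`,
`tensor_eq_top_of_ne_bot`). The operator `J` has distinct eigenvalues on distinct levels, so each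
proper submodule is graded and, missing level 0, lies in the sum of the positive levels; hence so
does the sum of all of them. Independence of the levels also comes from `J`, without the
Poincaré–Birkhoff–Witt theorem. -/

noncomputable section

namespace GlInfty

/-! ### Tensor powers of the natural representation -/

/-- The tensor power of `⨁_{j ∈ ℤ} ℂ e_j` with factors indexed by `κ`, in the basis of the pure
tensors of basis vectors. -/
abbrev Tens (κ : Type*) : Type _ := (κ → ℤ) →₀ ℂ

section Tens

variable {κ : Type*}

theorem tens_ext {M : Type*} [AddCommGroup M] [Module ℂ M] {f f' : Tens κ →ₗ[ℂ] M}
    (h : ∀ g, f (Finsupp.single g 1) = f' (Finsupp.single g 1)) : f = f' :=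
  Finsupp.lhom_ext' fun g => LinearMap.ext_ring (h g)

/-- The action of a permutation of the factors of a tensor power. -/
def permute (σ : Equiv.Perm κ) : Module.End ℂ (Tens κ) :=
  Finsupp.lmapDomain ℂ ℂ fun g => g ∘ σ

theorem permute_single (σ : Equiv.Perm κ) (g : κ → ℤ) :
    permute σ (Finsupp.single g 1) = Finsupp.single (g ∘ σ) 1 := by
  rw [permute, Finsupp.lmapDomain_apply, Finsupp.mapDomain_single]

/-- Multiplication on the left by the pure tensor of the basis vectors with indices `a`. -/
def prepend {l : ℕ} (a : Fin l → ℤ) : Tens κ →ₗ[ℂ] Tens (Fin l ⊕ κ) :=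
  Finsupp.lmapDomain ℂ ℂ (Sum.elim a)

theorem prepend_single {l : ℕ} (a : Fin l → ℤ) (g : κ → ℤ) :
    prepend a (Finsupp.single g 1) = Finsupp.single (Sum.elim a g) 1 := by
  rw [prepend, Finsupp.lmapDomain_apply, Finsupp.mapDomain_single]

variable [DecidableEq κ]

/-- The transposition of two of the first `l` factors. -/
theorem permute_swap_inl_inl {l : ℕ} (a : Fin l → ℤ) (k k' : Fin l) (x : Tens κ) :
    permute (Equiv.swap (Sum.inl k) (Sum.inl k')) (prepend a x) =
      prepend (a ∘ Equiv.swap k k') x := by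
  have : permute (Equiv.swap (Sum.inl k) (Sum.inl k')) ∘ₗ prepend a =
      prepend (κ := κ) (a ∘ Equiv.swap k k') := by
    refine tens_ext fun g => ?_
    rw [LinearMap.comp_apply, prepend_single, permute_single, prepend_single]
    congr 1
    funext s
    rcases s with s | s
    · simp only [Function.comp_apply, Sum.elim_inl, Equiv.swap_apply_def, Sum.inl.injEq]
      split_ifs <;> simp
    · simp [Equiv.swap_apply_def]
  exact LinearMap.congr_fun this x

/-- The operator acting by `φ` on the factor `m` of a tensor power. -/
def slot (m : κ) (φ : Module.End ℂ (ℤ →₀ ℂ)) : Module.End ℂ (Tens κ) :=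
  Finsupp.linearCombination ℂ fun g =>
    Finsupp.lmapDomain ℂ ℂ (Function.update g m) (φ (Finsupp.single (g m) 1))

theorem slot_single (m : κ) (φ : Module.End ℂ (ℤ →₀ ℂ)) (g : κ → ℤ) :
    slot m φ (Finsupp.single g 1) =
      Finsupp.lmapDomain ℂ ℂ (Function.update g m) (φ (Finsupp.single (g m) 1)) := by
  simp [slot]

theorem slot_lmapDomain (m : κ) (φ : Module.End ℂ (ℤ →₀ ℂ)) (g : κ → ℤ) (u : ℤ →₀ ℂ) :
    slot m φ (Finsupp.lmapDomain ℂ ℂ (Function.update g m) u) =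
      Finsupp.lmapDomain ℂ ℂ (Function.update g m) (φ u) := by
  have h : slot m φ ∘ₗ Finsupp.lmapDomain ℂ ℂ (Function.update g m) =
      Finsupp.lmapDomain ℂ ℂ (Function.update g m) ∘ₗ φ := by
    refine Finsupp.lhom_ext' fun i => LinearMap.ext_ring ?_
    simp only [LinearMap.comp_apply, Finsupp.lsingle_apply]
    rw [Finsupp.lmapDomain_apply, Finsupp.mapDomain_single, slot_single, Finsupp.lmapDomain_apply,
      Finsupp.lmapDomain_apply, Function.update_self]
    congr 1
    funext j
    rw [Function.update_idem]
  exact LinearMap.congr_fun h u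

theorem slot_mul (m : κ) (φ ψ : Module.End ℂ (ℤ →₀ ℂ)) :
    slot m (φ * ψ) = slot m φ * slot m ψ := by
  refine tens_ext fun g => ?_
  rw [Module.End.mul_apply, slot_single, slot_single, slot_lmapDomain, Module.End.mul_apply]

theorem slot_add (m : κ) (φ ψ : Module.End ℂ (ℤ →₀ ℂ)) :
    slot m (φ + ψ) = slot m φ + slot m ψ := by
  refine tens_ext fun g => ?_
  simp only [slot_single, LinearMap.add_apply, map_add]

theorem slot_sub (m : κ) (φ ψ : Module.End ℂ (ℤ →₀ ℂ)) :
    slot m (φ - ψ) = slot m φ - slot m ψ := by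
  refine tens_ext fun g => ?_
  rw [LinearMap.sub_apply, slot_single, slot_single, slot_single, LinearMap.sub_apply, map_sub]

theorem slot_smul (m : κ) (c : ℂ) (φ : Module.End ℂ (ℤ →₀ ℂ)) :
    slot m (c • φ) = c • slot m φ := by
  refine tens_ext fun g => ?_
  simp only [slot_single, LinearMap.smul_apply, map_smul]

theorem slot_lmapDomain_of_ne {m m' : κ} (h : m ≠ m') (φ : Module.End ℂ (ℤ →₀ ℂ)) (g : κ → ℤ)
    (u : ℤ →₀ ℂ) :
    slot m φ (Finsupp.lmapDomain ℂ ℂ (Function.update g m') u) =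
      u.sum fun i c => (φ (Finsupp.single (g m) 1)).sum fun j d =>
        Finsupp.single (Function.update (Function.update g m' i) m j) (c * d) := by
  rw [Finsupp.lmapDomain_apply, Finsupp.mapDomain, map_finsuppSum]
  refine Finsupp.sum_congr fun i _ => ?_
  rw [← mul_one (u i), ← smul_eq_mul, ← Finsupp.smul_single, map_smul, slot_single,
    Finsupp.lmapDomain_apply, Finsupp.mapDomain, Finsupp.smul_sum, Function.update_of_ne h]
  simp

theorem slot_commute {m m' : κ} (h : m ≠ m') (φ ψ : Module.End ℂ (ℤ →₀ ℂ)) :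
    slot m φ * slot m' ψ = slot m' ψ * slot m φ := by
  refine tens_ext fun g => ?_
  rw [Module.End.mul_apply, Module.End.mul_apply, slot_single, slot_single,
    slot_lmapDomain_of_ne h, slot_lmapDomain_of_ne h.symm, Finsupp.sum_comm]
  refine Finsupp.sum_congr fun i _ => Finsupp.sum_congr fun j _ => ?_
  rw [Function.update_comm h, mul_comm]

/-- `permute σ` sends `g` to `g ∘ σ`, so the factor at the place `m` after permuting is the one that
stood at `σ m` before. -/
theorem slot_permute (m : κ) (φ : Module.End ℂ (ℤ →₀ ℂ)) (σ : Equiv.Perm κ) :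
    slot m φ * permute σ = permute σ * slot (σ m) φ := by
  refine tens_ext fun g => ?_
  rw [Module.End.mul_apply, Module.End.mul_apply, permute_single, slot_single, slot_single,
    permute, Finsupp.lmapDomain_apply, Finsupp.lmapDomain_apply, Finsupp.lmapDomain_apply,
    ← Finsupp.mapDomain_comp]
  congr 1
  funext i
  simp [Function.update_comp_equiv]

/-! ### Derivations, antisymmetrizers and transpositions on a finite tensor power. -/

variable [Fintype κ]

theorem sum_mul_sub_mul {ι A : Type*} [Fintype ι] [Ring A] (X Y : ι → A)
    (h : ∀ i j, i ≠ j → X i * Y j = Y j * X i) :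
    ∑ i, (X i * Y i - Y i * X i) = (∑ i, X i) * (∑ i, Y i) - (∑ i, Y i) * (∑ i, X i) := by
  rw [Finset.sum_mul_sum, Finset.sum_mul_sum, Finset.sum_comm (f := fun i j => Y i * X j),
    ← Finset.sum_sub_distrib]
  refine Finset.sum_congr rfl fun i _ => ?_
  rw [← Finset.sum_sub_distrib, Finset.sum_eq_single i]
  · intro j _ hj
    rw [h i j hj.symm, sub_self]
  · simp

/-- The action of matrices on a tensor power by derivations. -/
def derivation (κ : Type*) [DecidableEq κ] [Fintype κ] :
    Module.End ℂ (ℤ →₀ ℂ) →ₗ⁅ℂ⁆ Module.End ℂ (Tens κ) where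
  toFun φ := ∑ m, slot m φ
  map_add' φ ψ := by simp only [slot_add, Finset.sum_add_distrib]
  map_smul' c φ := by simp only [slot_smul, Finset.smul_sum, RingHom.id_apply]
  map_lie' := by
    intro φ ψ
    refine Eq.trans ?_ (sum_mul_sub_mul (fun m => slot m φ) (fun m => slot m ψ)
      fun m m' h => slot_commute h φ ψ)
    refine Finset.sum_congr rfl fun m _ => ?_
    change slot m (φ * ψ - ψ * φ) = _
    rw [← slot_mul, ← slot_mul]
    exact slot_sub m _ _

theorem derivation_apply (φ : Module.End ℂ (ℤ →₀ ℂ)) : derivation κ φ = ∑ m, slot m φ := rfl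

theorem derivation_permute (φ : Module.End ℂ (ℤ →₀ ℂ)) (σ : Equiv.Perm κ) :
    derivation κ φ * permute σ = permute σ * derivation κ φ := by
  rw [derivation_apply, Finset.sum_mul, Finset.mul_sum,
    ← Equiv.sum_comp σ fun m => permute σ * slot m φ]
  exact Finset.sum_congr rfl fun m _ => slot_permute m φ σ

/-- A derivation coming from a matrix preserves the tensors with all indices in `s` if the matrix
preserves the vectors supported in `s`. -/
theorem derivation_mem_supported {φ : Module.End ℂ (ℤ →₀ ℂ)} {s : Set ℤ}
    (h : ∀ i j, entry φ i j ≠ 0 → i ∈ s) {x : Tens κ}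
    (hx : x ∈ Finsupp.supported ℂ ℂ {g : κ → ℤ | ∀ m, g m ∈ s}) :
    derivation κ φ x ∈ Finsupp.supported ℂ ℂ {g : κ → ℤ | ∀ m, g m ∈ s} := by
  rw [Finsupp.supported_eq_span_single] at hx
  induction hx using Submodule.span_induction with
  | mem x hx =>
    obtain ⟨g, hg, rfl⟩ := hx
    rw [derivation_apply, LinearMap.sum_apply]
    refine Submodule.sum_mem _ fun m _ => ?_
    rw [slot_single, Finsupp.lmapDomain_apply, Finsupp.mapDomain]
    refine Submodule.sum_mem _ fun i hi => Finsupp.single_mem_supported ℂ _ fun m' => ?_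
    by_cases hm : m' = m
    · subst hm
      rw [Function.update_self]
      exact h i (g m') (Finsupp.mem_support_iff.1 hi)
    · rw [Function.update_of_ne hm]
      exact hg m'
  | zero => rw [map_zero]; exact zero_mem _
  | add x y _ _ hx hy => rw [map_add]; exact add_mem hx hy
  | smul c x _ hx => rw [map_smul]; exact Submodule.smul_mem _ c hx

/-- A derivation coming from a diagonal matrix is diagonal. -/
theorem derivation_diagonal {φ : Module.End ℂ (ℤ →₀ ℂ)} (h : ∀ i j, i ≠ j → entry φ i j = 0)
    (g : κ → ℤ) : derivation κ φ (Finsupp.single g 1) =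
      (∑ m, entry φ (g m) (g m)) • Finsupp.single g 1 := by
  rw [derivation_apply, LinearMap.sum_apply, Finset.sum_smul]
  refine Finset.sum_congr rfl fun m _ => ?_
  have : φ (Finsupp.single (g m) 1) = Finsupp.single (g m) (entry φ (g m) (g m)) := by
    ext i
    by_cases hi : i = g m
    · subst hi; simp [entry]
    · rw [Finsupp.single_eq_of_ne hi]; exact h i _ hi
  rw [slot_single, this, Finsupp.lmapDomain_apply, Finsupp.mapDomain_single,
    Function.update_eq_self]
  simp

/-- The column antisymmetrizer. -/
def antisymmetrizer (col : κ → ℕ) : Module.End ℂ (Tens κ) :=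
  ∑ σ : Equiv.Perm κ with ∀ k, col (σ k) = col k, ((Equiv.Perm.sign σ : ℤ) : ℂ) • permute σ

/-- The terms of `σ` and `swap m m' * σ` cancel: the tensor is unchanged by the swap, the swap
respects columns, and the signs are opposite. -/
theorem antisymmetrizer_single_eq_zero {col : κ → ℕ} {g : κ → ℤ} {m m' : κ} (hm : m ≠ m')
    (hc : col m = col m') (hg : g m = g m') :
    antisymmetrizer col (Finsupp.single g 1) = 0 := by
  have hgs : g ∘ Equiv.swap m m' = g := by
    funext k
    simp only [Function.comp_apply, Equiv.swap_apply_def]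
    split_ifs <;> simp_all
  have hcs : ∀ k, col (Equiv.swap m m' k) = col k := by
    intro k
    simp only [Equiv.swap_apply_def]
    split_ifs <;> simp_all
  rw [antisymmetrizer, LinearMap.sum_apply]
  simp only [LinearMap.smul_apply, permute_single]
  refine Finset.sum_involution (fun σ _ => Equiv.swap m m' * σ) ?_ ?_ ?_ ?_
  · intro σ _
    rw [Equiv.Perm.sign_mul, Equiv.Perm.sign_swap hm, Equiv.Perm.coe_mul, ← Function.comp_assoc,
      hgs]
    simp
  · intro σ _ _ h
    exact hm (Equiv.swap_eq_one_iff.1 (mul_eq_right.1 h))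
  · intro σ hσ
    simp only [Finset.mem_filter, Finset.mem_univ, true_and] at hσ ⊢
    intro k
    rw [Equiv.Perm.mul_apply, hcs, hσ]
  · intro σ _
    rw [← mul_assoc, Equiv.swap_mul_self, one_mul]

/-- The coefficient at `row` itself is `1`: a permutation preserving both the row and the column of
every box is the identity, so nothing else contributes. -/
theorem antisymmetrizer_single_ne_zero {col : κ → ℕ} {row : κ → ℤ}
    (h : ∀ k k', row k = row k' → col k = col k' → k = k') :
    antisymmetrizer col (Finsupp.single row 1) ≠ 0 := by
  intro h0
  have h1 := DFunLike.congr_fun h0 row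
  rw [antisymmetrizer, LinearMap.sum_apply, Finsupp.finsetSum_apply,
    Finset.sum_eq_single 1] at h1
  · simp [permute_single] at h1
  · intro σ hσ hne
    simp only [Finset.mem_filter, Finset.mem_univ, true_and] at hσ
    rw [LinearMap.smul_apply, permute_single, Finsupp.smul_apply, Finsupp.single_apply, if_neg,
      smul_zero]
    intro hr
    exact hne (Equiv.ext fun k => h _ _ (congrFun hr k) (hσ k))
  · simp

theorem derivation_antisymmetrizer (col : κ → ℕ) (φ : Module.End ℂ (ℤ →₀ ℂ)) (x : Tens κ) :
    derivation κ φ (antisymmetrizer col x) = antisymmetrizer col (derivation κ φ x) := by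
  have : derivation κ φ * antisymmetrizer col = antisymmetrizer col * derivation κ φ := by
    simp only [antisymmetrizer, Finset.mul_sum, Finset.sum_mul, mul_smul_comm, smul_mul_assoc,
      derivation_permute]
  exact LinearMap.congr_fun this x

/-- The derivation commutes with the antisymmetrizer. By hypothesis each term of the derivation of
the pure tensor repeats an index within a column, so antisymmetrizing kills it. This is how raising
operators annihilate the highest weight vector. -/
theorem derivation_antisymmetrizer_eq_zero {col : κ → ℕ} {row : κ → ℤ}
    {φ : Module.End ℂ (ℤ →₀ ℂ)}
    (h : ∀ i k, entry φ i (row k) ≠ 0 → ∃ k', k' ≠ k ∧ row k' = i ∧ col k' = col k) :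
    derivation κ φ (antisymmetrizer col (Finsupp.single row 1)) = 0 := by
  rw [derivation_antisymmetrizer, derivation_apply, LinearMap.sum_apply, map_sum]
  refine Finset.sum_eq_zero fun m _ => ?_
  rw [slot_single, Finsupp.lmapDomain_apply, Finsupp.mapDomain, map_finsuppSum]
  refine Finset.sum_eq_zero fun i hi => ?_
  obtain ⟨k', hk, hr, hc⟩ := h i m (Finsupp.mem_support_iff.1 hi)
  beta_reduce
  rw [← mul_one (φ _ i), ← smul_eq_mul, ← Finsupp.smul_single, map_smul,
    antisymmetrizer_single_eq_zero hk hc, smul_zero]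
  rw [Function.update_of_ne hk, Function.update_self, hr]

theorem derivation_antisymmetrizer_diagonal (col : κ → ℕ) (row : κ → ℤ)
    {φ : Module.End ℂ (ℤ →₀ ℂ)} (h : ∀ i j, i ≠ j → entry φ i j = 0) :
    derivation κ φ (antisymmetrizer col (Finsupp.single row 1)) =
      (∑ m, entry φ (row m) (row m)) • antisymmetrizer col (Finsupp.single row 1) := by
  rw [derivation_antisymmetrizer, derivation_diagonal h, map_smul]

theorem antisymmetrizer_mem_supported (col : κ → ℕ) {row : κ → ℤ} {s : Set ℤ}
    (h : ∀ m, row m ∈ s) : antisymmetrizer col (Finsupp.single row 1) ∈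
      Finsupp.supported ℂ ℂ {g : κ → ℤ | ∀ m, g m ∈ s} := by
  rw [antisymmetrizer, LinearMap.sum_apply]
  refine Submodule.sum_mem _ fun σ _ => Submodule.smul_mem _ _ ?_
  rw [permute_single]
  exact Finsupp.single_mem_supported ℂ _ fun m => h (σ m)

/-- The matrix unit with entry `1` at the place `(i, j)`. -/
def unitEnd (i j : ℤ) : Module.End ℂ (ℤ →₀ ℂ) :=
  Finsupp.lsingle i ∘ₗ Finsupp.lapply j

theorem unitEnd_single (i j k : ℤ) :
    unitEnd i j (Finsupp.single k 1) = if k = j then Finsupp.single i 1 else 0 := by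
  simp only [unitEnd, LinearMap.comp_apply, Finsupp.lapply_apply, Finsupp.lsingle_apply,
    Finsupp.single_apply]
  split_ifs <;> simp

theorem entry_unitEnd (i j k l : ℤ) :
    entry (unitEnd i j) k l = if k = i ∧ l = j then 1 else 0 := by
  rw [entry, unitEnd_single]
  split_ifs with h1 h2 h2 <;> simp_all [eq_comm]

theorem derivation_unitEnd (i j : ℤ) (g : κ → ℤ) :
    derivation κ (unitEnd i j) (Finsupp.single g 1) =
      ∑ m, if g m = j then Finsupp.single (Function.update g m i) 1 else 0 := by
  rw [derivation_apply, LinearMap.sum_apply]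
  refine Finset.sum_congr rfl fun m _ => ?_
  rw [slot_single, unitEnd_single]
  split_ifs <;> simp

/-- The sum of the transpositions of one of the first `l` factors with all the last ones. -/
theorem sum_permute_swap_inl_inr {l : ℕ} (a : Fin l → ℤ) (k : Fin l) (R : Finset ℤ) {x : Tens κ}
    (hx : x ∈ Finsupp.supported ℂ ℂ {g : κ → ℤ | ∀ m, g m ∈ R}) :
    ∑ m, permute (Equiv.swap (Sum.inl k) (Sum.inr m)) (prepend a x) =
      ∑ i ∈ R, prepend (Function.update a k i) (derivation κ (unitEnd (a k) i) x) := by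
  rw [Finsupp.supported_eq_span_single] at hx
  induction hx using Submodule.span_induction with
  | mem x hx =>
    obtain ⟨g, hg, rfl⟩ := hx
    simp only [derivation_unitEnd, map_sum]
    rw [Finset.sum_comm]
    refine Finset.sum_congr rfl fun m _ => ?_
    -- On the factor `m` only the unit with `i = g m` acts; it puts `a k` there, while `g m` moves
    -- to the place `k`, which is the transposition.
    rw [Finset.sum_eq_single (g m), if_pos rfl, prepend_single, prepend_single, permute_single]
    · congr 1
      funext s
      rcases s with s | s
      · simp only [Function.comp_apply, Equiv.swap_apply_def, Sum.inl.injEq, Sum.elim_inl,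
          Function.update_apply, reduceCtorEq, if_false]
        split_ifs <;> simp
      · simp only [Function.comp_apply, Equiv.swap_apply_def, Sum.inr.injEq, Sum.elim_inr,
          Function.update_apply, reduceCtorEq, if_false]
        split_ifs <;> simp
    · intro i _ hi
      rw [if_neg hi.symm, map_zero]
    · intro h
      exact (h (hg m)).elim
  | zero => simp
  | add x y _ _ hx hy => simp only [map_add, Finset.sum_add_distrib, hx, hy]
  | smul c x _ hx => simp only [map_smul, ← Finset.smul_sum, hx]

end Tens

/-! ### Generalities on enveloping algebras -/

section Enveloping

variable {g : Type*} [LieRing g] [LieAlgebra ℂ g]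

/-- The map `ι` factors through `S`, and the lift of that factorization followed by the inclusion is
the identity by the universal property. It serves as an induction principle on generators. -/
theorem enveloping_eq_top (S : Subalgebra ℂ (UniversalEnvelopingAlgebra ℂ g))
    (h : ∀ x, UniversalEnvelopingAlgebra.ι ℂ x ∈ S) : S = ⊤ := by
  let f : g →ₗ⁅ℂ⁆ S :=
    { toFun := fun x => ⟨UniversalEnvelopingAlgebra.ι ℂ x, h x⟩
      map_add' := fun x y => Subtype.ext (map_add _ x y)
      map_smul' := fun c x => Subtype.ext (map_smul _ c x)
      map_lie' := fun {x y} => Subtype.ext (LieHom.map_lie (UniversalEnvelopingAlgebra.ι ℂ) x y) }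
  have hf : S.val.comp (UniversalEnvelopingAlgebra.lift ℂ f) = AlgHom.id ℂ _ := by
    refine UniversalEnvelopingAlgebra.hom_ext ℂ (LieHom.ext fun x => ?_)
    change ((UniversalEnvelopingAlgebra.lift ℂ f (UniversalEnvelopingAlgebra.ι ℂ x) : S) :
      UniversalEnvelopingAlgebra ℂ g) = UniversalEnvelopingAlgebra.ι ℂ x
    rw [UniversalEnvelopingAlgebra.lift_ι_apply]
    rfl
  refine eq_top_iff.2 fun u _ => ?_
  have := AlgHom.congr_fun hf u
  rw [AlgHom.id_apply] at this
  rw [← this]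
  exact (UniversalEnvelopingAlgebra.lift ℂ f u).2

/-- The endomorphisms preserving a subspace. -/
def stabilizer {X : Type*} [AddCommGroup X] [Module ℂ X] (P : Submodule ℂ X) :
    Subalgebra ℂ (Module.End ℂ X) where
  carrier := {φ | ∀ x ∈ P, φ x ∈ P}
  mul_mem' := fun ha hb x hx => ha _ (hb x hx)
  add_mem' := fun ha hb x hx => P.add_mem (ha x hx) (hb x hx)
  algebraMap_mem' := fun r _ hx => P.smul_mem r hx

theorem algHom_enveloping_apply_mem {X : Type*} [AddCommGroup X] [Module ℂ X]
    (F : UniversalEnvelopingAlgebra ℂ g →ₐ[ℂ] Module.End ℂ X) (P : Submodule ℂ X)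
    (h : ∀ x, ∀ w ∈ P, F (UniversalEnvelopingAlgebra.ι ℂ x) w ∈ P)
    (u : UniversalEnvelopingAlgebra ℂ g) {w : X} (hw : w ∈ P) : F u w ∈ P := by
  have : (stabilizer P).comap F = ⊤ := enveloping_eq_top _ fun x => h x
  have hu : u ∈ (stabilizer P).comap F := this ▸ Algebra.mem_top
  exact hu w hw

theorem enveloping_smul_mem {X : Type*} [AddCommGroup X] [Module ℂ X]
    [Module (UniversalEnvelopingAlgebra ℂ g) X]
    [IsScalarTower ℂ (UniversalEnvelopingAlgebra ℂ g) X] (P : Submodule ℂ X)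
    (h : ∀ x : g, ∀ w ∈ P, UniversalEnvelopingAlgebra.ι ℂ x • w ∈ P)
    (u : UniversalEnvelopingAlgebra ℂ g) {w : X} (hw : w ∈ P) : u • w ∈ P :=
  algHom_enveloping_apply_mem (Algebra.lsmul ℂ ℂ X) P h u hw

end Enveloping

/-- The map `π` intertwines `H` and `h` only on the stable subspace `S`, as for subquotients, so
membership in `S` has to be carried along through the powers of `H`. -/
theorem aeval_intertwine {A B : Type*} [AddCommGroup A] [Module ℂ A] [AddCommGroup B] [Module ℂ B]
    {S : Submodule ℂ A} {π : A →ₗ[ℂ] B} {H : Module.End ℂ A} {h : Module.End ℂ B}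
    (hS : ∀ x ∈ S, H x ∈ S) (hπ : ∀ x ∈ S, π (H x) = h (π x)) (Q : Polynomial ℂ) {x : A}
    (hx : x ∈ S) :
    Polynomial.aeval H Q x ∈ S ∧ π (Polynomial.aeval H Q x) = Polynomial.aeval h Q (π x) := by
  induction Q using Polynomial.induction_on' generalizing x with
  | add q r hq hr =>
    simp only [map_add, LinearMap.add_apply, (hq hx).2, (hr hx).2, and_true]
    exact add_mem (hq hx).1 (hr hx).1
  | monomial n c =>
    simp only [Polynomial.aeval_monomial, Module.End.mul_apply, Module.algebraMap_end_apply,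
      map_smul]
    have : (H ^ n) x ∈ S ∧ π ((H ^ n) x) = (h ^ n) (π x) := by
      induction n with
      | zero => exact ⟨hx, rfl⟩
      | succ n ih =>
        rw [pow_succ', pow_succ', Module.End.mul_apply, Module.End.mul_apply, hπ _ ih.1, ih.2]
        exact ⟨hS _ ih.1, rfl⟩
    rw [this.2]
    exact ⟨S.smul_mem c this.1, rfl⟩

theorem aeval_apply_of_eigen {A : Type*} [AddCommGroup A] [Module ℂ A] {H : Module.End ℂ A}
    {c : ℂ} {x : A} (hx : H x = c • x) (Q : Polynomial ℂ) :
    Polynomial.aeval H Q x = Q.eval c • x := by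
  rcases eq_or_ne x 0 with rfl | h0
  · simp
  · exact Module.End.aeval_apply_of_hasEigenvector ⟨Module.End.mem_eigenspace_iff.2 hx, h0⟩

/-! ### Irreducible highest weight modules as subquotients -/

section Irr

variable (p : ℤ → Prop) (χ : ℤ →₀ ℂ)

/-- The projection of the enveloping algebra onto the irreducible module. -/
def Irr.proj : UniversalEnvelopingAlgebra ℂ (block p) →ₗ[UniversalEnvelopingAlgebra ℂ (block p)]
    Irr p χ :=
  (maxSub (UniversalEnvelopingAlgebra ℂ (block p)) (Verma p χ)).mkQ ∘ₗ (vermaIdeal p χ).mkQ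

theorem Irr.proj_surjective : Function.Surjective (Irr.proj p χ) :=
  (Submodule.mkQ_surjective _).comp (Submodule.mkQ_surjective _)

/-- The preimage of a proper submodule in the Verma module is proper, hence inside `maxSub`, hence
zero in the quotient. Whether `maxSub` is itself proper plays no role. -/
theorem Irr.eq_top_of_ne_bot {p : ℤ → Prop} {χ : ℤ →₀ ℂ}
    {P : Submodule (UniversalEnvelopingAlgebra ℂ (block p)) (Irr p χ)} (hP : P ≠ ⊥) : P = ⊤ := by
  let f : Verma p χ →ₗ[UniversalEnvelopingAlgebra ℂ (block p)] Irr p χ :=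
    (maxSub (UniversalEnvelopingAlgebra ℂ (block p)) (Verma p χ)).mkQ
  have hf : Function.Surjective f := Submodule.mkQ_surjective _
  by_contra h
  have h1 : P.comap f ≤ maxSub (UniversalEnvelopingAlgebra ℂ (block p)) (Verma p χ) := by
    refine le_sSup fun h2 => h (eq_top_iff.2 fun w _ => ?_)
    obtain ⟨u, rfl⟩ := hf w
    have : u ∈ P.comap f := h2 ▸ Submodule.mem_top
    exact this
  refine hP (eq_bot_iff.2 fun w hw => ?_)
  obtain ⟨u, rfl⟩ := hf w
  exact (Submodule.Quotient.mk_eq_zero _).2 (h1 hw)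

/-- A nonzero vector of highest weight `χ` in a representation makes the irreducible module
of highest weight `χ` a subquotient of that representation. -/
theorem Irr.exists_subquotient {p : ℤ → Prop} {χ : ℤ →₀ ℂ} {X : Type*} [AddCommGroup X]
    [Module ℂ X] (ρ : block p →ₗ⁅ℂ⁆ Module.End ℂ X) {v : X} (hv : v ≠ 0)
    (hup : ∀ A : block p, (∀ i j, j ≤ i → entry A.1.1 i j = 0) → ρ A v = 0)
    (hdiag : ∀ A : block p, (∀ i j, i ≠ j → entry A.1.1 i j = 0) → ρ A v = weight χ A.1 • v) :
    ∃ (S : Submodule ℂ X) (π : X →ₗ[ℂ] Irr p χ), (∀ A, ∀ x ∈ S, ρ A x ∈ S) ∧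
      (∀ A, ∀ x ∈ S, π (ρ A x) = UniversalEnvelopingAlgebra.ι ℂ A • π x) ∧
      (∀ u, ∃ x ∈ S, π x = u) ∧
      ∀ P : Submodule ℂ X, v ∈ P → (∀ A, ∀ x ∈ P, ρ A x ∈ P) → S ≤ P := by
  let F := UniversalEnvelopingAlgebra.lift ℂ ρ
  have hF : ∀ A, F (UniversalEnvelopingAlgebra.ι ℂ A) = ρ A :=
    UniversalEnvelopingAlgebra.lift_ι_apply ℂ ρ
  let f : UniversalEnvelopingAlgebra ℂ (block p) →ₗ[ℂ] X :=
    (LinearMap.applyₗ v) ∘ₗ F.toLinearMap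
  have hfm : ∀ u w, f (u * w) = F u (f w) := fun u w => by
    change F (u * w) v = F u (F w v)
    rw [map_mul]; rfl
  -- `K` is the annihilator of `v`; it contains the defining relations of the Verma module.
  let K : Submodule (UniversalEnvelopingAlgebra ℂ (block p))
      (UniversalEnvelopingAlgebra ℂ (block p)) :=
    { carrier := {u | f u = 0}
      add_mem' := fun {a b} ha hb => by
        change f (a + b) = 0
        rw [map_add, show f a = 0 from ha, show f b = 0 from hb, add_zero]
      zero_mem' := map_zero f
      smul_mem' := fun u w hw => by
        change f (u * w) = 0
        rw [hfm, show f w = 0 from hw, map_zero] }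
  have hK : vermaIdeal p χ ≤ K := by
    refine Submodule.span_le.2 ?_
    rintro u (⟨A, hA, rfl⟩ | ⟨A, hA, rfl⟩)
    · change F (UniversalEnvelopingAlgebra.ι ℂ A) v = 0
      rw [hF, hup A hA]
    · change F (UniversalEnvelopingAlgebra.ι ℂ A - algebraMap ℂ _ _) v = 0
      rw [map_sub, hF, AlgHom.commutes, LinearMap.sub_apply, hdiag A hA,
        Module.algebraMap_end_apply, sub_self]
  -- The image of `K` in the Verma module is proper because `1 ∉ K`, so it dies in the irreducible
  -- quotient. Thus `u ↦ Irr.proj u` factors through `u ↦ u v`.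
  have hK1 : K.map (vermaIdeal p χ).mkQ ≤
      maxSub (UniversalEnvelopingAlgebra ℂ (block p)) (Verma p χ) := by
    refine le_sSup fun h => ?_
    have h1 : (vermaIdeal p χ).mkQ 1 ∈ K.map (vermaIdeal p χ).mkQ := h ▸ Submodule.mem_top
    obtain ⟨k, hk, hk1⟩ := h1
    have h2 : k - 1 ∈ vermaIdeal p χ := (Submodule.Quotient.eq _).1 hk1
    have h3 : (1 : UniversalEnvelopingAlgebra ℂ (block p)) ∈ K := by
      have := K.sub_mem hk (hK h2)
      rwa [sub_sub_cancel] at this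
    refine hv ?_
    have h4 : F 1 v = 0 := h3
    rwa [map_one] at h4
  have hker : LinearMap.ker f ≤ LinearMap.ker ((Irr.proj p χ).restrictScalars ℂ) := by
    intro u hu
    exact (Submodule.Quotient.mk_eq_zero _).2 (hK1 ⟨u, hu, rfl⟩)
  -- The quotient map is defined on `U v` only; it is extended linearly to all of `X` in an
  -- arbitrary way, and only its values on `U v` matter.
  obtain ⟨π, hπ⟩ := LinearMap.exists_extend
    ((LinearMap.ker f).liftQ _ hker ∘ₗ f.quotKerEquivRange.symm.toLinearMap)
  have hπf : ∀ u, π (f u) = Irr.proj p χ u := by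
    intro u
    have := LinearMap.congr_fun hπ ⟨f u, u, rfl⟩
    simp only [LinearMap.comp_apply, LinearEquiv.coe_coe, Submodule.subtype_apply] at this
    rw [this]
    have h5 : f.quotKerEquivRange.symm ⟨f u, u, rfl⟩ = (LinearMap.ker f).mkQ u := by
      rw [LinearEquiv.symm_apply_eq]; rfl
    rw [h5]
    rfl
  refine ⟨LinearMap.range f, π, ?_, ?_, ?_, ?_⟩
  · rintro A _ ⟨u, rfl⟩
    refine ⟨UniversalEnvelopingAlgebra.ι ℂ A * u, ?_⟩
    rw [hfm, hF]
  · rintro A _ ⟨u, rfl⟩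
    rw [← hF, ← hfm, hπf, hπf, ← smul_eq_mul, map_smul]
  · intro w
    obtain ⟨u, rfl⟩ := Irr.proj_surjective p χ w
    exact ⟨f u, ⟨u, rfl⟩, hπf u⟩
  · rintro P hvP hP _ ⟨u, rfl⟩
    exact algHom_enveloping_apply_mem F P (fun A x hx => by rw [hF]; exact hP A x hx) u hvP

/-- A realization of an irreducible highest weight module as a subquotient of a tensor power
of the representation `τ`. -/
structure Model (τ : block p →ₗ⁅ℂ⁆ Module.End ℂ (ℤ →₀ ℂ)) where
  /-- The set of the tensor factors. -/
  κ : Type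
  fintype : Fintype κ
  decEq : DecidableEq κ
  /-- The subrepresentation of the tensor power. -/
  S : Submodule ℂ (Tens κ)
  /-- The quotient map, extended from `S` to the whole tensor power. -/
  π : Tens κ →ₗ[ℂ] Irr p χ
  supported : S ≤ Finsupp.supported ℂ ℂ {g : κ → ℤ | ∀ m, g m ∈ {i | p i}}
  stable : ∀ A, ∀ x ∈ S, derivation κ (τ A) x ∈ S
  equivariant : ∀ A, ∀ x ∈ S,
    π (derivation κ (τ A) x) = UniversalEnvelopingAlgebra.ι ℂ A • π x
  surjective : ∀ u, ∃ x ∈ S, π x = u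

attribute [instance] Model.fintype Model.decEq

/-- The tensor factors are the boxes of a Young-type diagram with `n i` boxes in row `i`, and the
highest weight vector is the column-antisymmetrized tensor whose factor at each box is the basis
vector of its row. A raising matrix replaces `j` by some `i ≠ j` whose row is at least as long, so
`i` already occurs in the same column and the result vanishes; a diagonal matrix counts each `i`
exactly `n i` times, which gives the weight. -/
theorem nonempty_model {p : ℤ → Prop} [DecidablePred p] {χ : ℤ →₀ ℂ}
    (τ : block p →ₗ⁅ℂ⁆ Module.End ℂ (ℤ →₀ ℂ)) (n : ℤ → ℕ) (hn : ∀ i, χ i = 0 → n i = 0)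
    (hτ : ∀ A i j, entry (τ A) i j ≠ 0 → p i)
    (hup : ∀ A : block p, (∀ i j, j ≤ i → entry A.1.1 i j = 0) → ∀ i j, p j →
      entry (τ A) i j ≠ 0 → i ≠ j ∧ n j ≤ n i)
    (hdiag : ∀ A : block p, (∀ i j, i ≠ j → entry A.1.1 i j = 0) →
      (∀ i j, i ≠ j → entry (τ A) i j = 0) ∧
      ∀ i, p i → (n i : ℂ) * entry (τ A) i i = χ i * entry A.1.1 i i) :
    Nonempty (Model p χ τ) := by
  let s := χ.support.filter p
  let κ := Σ r : s, Fin (n r)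
  let row : κ → ℤ := fun k => k.1
  let col : κ → ℕ := fun k => k.2
  have hrow : ∀ k, p (row k) := fun k => (Finset.mem_filter.1 k.1.2).2
  have hinj : ∀ k k', row k = row k' → col k = col k' → k = k' := by
    rintro ⟨⟨r, hr⟩, c⟩ ⟨⟨r', hr'⟩, c'⟩ h1 h2
    obtain rfl : r = r' := h1
    obtain rfl : c = c' := Fin.ext h2
    rfl
  let v : Tens κ := antisymmetrizer col (Finsupp.single row 1)
  obtain ⟨S, π, h1, h2, h3, h4⟩ := Irr.exists_subquotient (p := p) (χ := χ)
    ((derivation κ).comp τ) (antisymmetrizer_single_ne_zero hinj) (fun A hA => by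
      refine derivation_antisymmetrizer_eq_zero fun i k hik => ?_
      obtain ⟨h5, h6⟩ := hup A hA i (row k) (hrow k) hik
      have h7 : col k < n i := lt_of_lt_of_le k.2.2 h6
      have h8 : i ∈ s := Finset.mem_filter.2 ⟨Finsupp.mem_support_iff.2 fun h =>
        by rw [hn i h] at h7; exact absurd h7 (Nat.not_lt_zero _), hτ A i _ hik⟩
      exact ⟨⟨⟨i, h8⟩, ⟨col k, h7⟩⟩, fun h => h5 (congrArg row h), rfl, rfl⟩) (fun A hA => by
      obtain ⟨h5, h6⟩ := hdiag A hA
      have := derivation_antisymmetrizer_diagonal col row h5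
      rw [LieHom.comp_apply, this]
      congr 1
      rw [Fintype.sum_sigma]
      simp only [row, Finset.sum_const, Finset.card_univ, Fintype.card_fin, nsmul_eq_mul]
      rw [Finset.sum_coe_sort s fun r => (n r : ℂ) * entry (τ A) r r, weight, Finsupp.sum,
        Finset.sum_filter]
      refine Finset.sum_congr rfl fun i _ => ?_
      split_ifs with hi
      · exact h6 i hi
      · by_cases h7 : entry A.1.1 i i = 0
        · rw [h7, mul_zero]
        · exact (hi (A.2 i i h7).1).elim)
  refine ⟨⟨κ, inferInstance, inferInstance, S, π, ?_, h1, h2, h3⟩⟩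
  refine h4 _ (antisymmetrizer_mem_supported col hrow) fun A x hx => ?_
  exact derivation_mem_supported (hτ A) hx

end Irr

/-! ### The natural representations of the two diagonal blocks -/

/-- The transposed matrix. -/
def transpose (A : Mat) : Module.End ℂ (ℤ →₀ ℂ) :=
  Finsupp.linearCombination ℂ fun j =>
    Finsupp.onFinset (Finset.Icc (j - A.2.choose) (j + A.2.choose)) (fun i => entry A.1 j i)
      fun i hi => by
        have h : |j - i| ≤ A.2.choose := not_lt.1 fun h => hi (A.2.choose_spec j i h)
        rw [abs_le] at h
        rw [Finset.mem_Icc]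
        omega

theorem entry_transpose (A : Mat) (i j : ℤ) : entry (transpose A) i j = entry A.1 j i := by
  simp [transpose, entry]

theorem transpose_mul (A B : Mat) :
    transpose (A * B) = transpose B * transpose A := by
  refine end_ext fun i j => ?_
  obtain ⟨K, hK⟩ := A.2
  have hS : ∀ k, entry A.1 j k ≠ 0 → k ∈ Finset.Icc (j - K) (j + K) := by
    intro k hk
    have h1 : |j - k| ≤ K := not_lt.1 fun h => hk (hK j k h)
    rw [abs_le] at h1
    rw [Finset.mem_Icc]
    omega
  rw [entry_transpose, entry_mul _ _ i j (Finset.Icc (j - K) (j + K))]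
  · change entry (A.1 * B.1) j i = _
    rw [entry_mul A.1 B.1 j i _ fun k hk => hS k (left_ne_zero_of_mul hk)]
    exact Finset.sum_congr rfl fun k _ => by rw [entry_transpose, entry_transpose, mul_comm]
  · intro k hk
    rw [entry_transpose, entry_transpose] at hk
    exact hS k (right_ne_zero_of_mul hk)

/-- The natural representation of a block. -/
def natural (p : ℤ → Prop) : block p →ₗ⁅ℂ⁆ Module.End ℂ (ℤ →₀ ℂ) where
  toFun A := A.1.1
  map_add' _ _ := rfl
  map_smul' _ _ := rfl
  map_lie' := rfl

/-- The dual of the natural representation of a block. -/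
def conatural (p : ℤ → Prop) : block p →ₗ⁅ℂ⁆ Module.End ℂ (ℤ →₀ ℂ) where
  toFun A := -transpose A.1
  map_add' A B := end_ext fun i j => by
    change -entry (transpose (A.1 + B.1)) i j =
      -entry (transpose A.1) i j + -entry (transpose B.1) i j
    rw [entry_transpose, entry_transpose, entry_transpose, ← neg_add]
    rfl
  map_smul' c A := end_ext fun i j => by
    change -entry (transpose (c • A.1)) i j = c * -entry (transpose A.1) i j
    rw [entry_transpose, entry_transpose, mul_neg]
    rfl
  map_lie' := by
    intro A B
    refine end_ext fun i j => ?_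
    change -entry (transpose (A.1 * B.1 - B.1 * A.1)) i j =
      entry ((-transpose A.1) * (-transpose B.1)) i j -
        entry ((-transpose B.1) * (-transpose A.1)) i j
    have h : ∀ X Y : Mat, entry ((-transpose X) * (-transpose Y)) i j = entry (Y * X : Mat).1 j i :=
      fun X Y => by
        rw [← entry_transpose, transpose_mul]
        change (-(transpose X (-(transpose Y (Finsupp.single j 1))))) i = _
        rw [map_neg, neg_neg]
        rfl
    rw [h, h, entry_transpose]
    change -(entry (A.1.1 * B.1.1) j i - entry (B.1.1 * A.1.1) j i) = _
    rw [neg_sub]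
    rfl

theorem entry_conatural (p : ℤ → Prop) (A : block p) (i j : ℤ) :
    entry (conatural p A) i j = -entry A.1.1 j i := by
  rw [← entry_transpose]
  rfl

/-! ### Models of the two irreducible modules -/

section Models

variable {χ : ℤ →₀ ℂ}

/-- A nonincreasing sequence that is eventually zero is nonnegative, so `χ_i` itself can serve as
the length of row `i`, and rows get longer towards smaller `i`. -/
theorem nonempty_model_right (hχ : IsSemidominant χ) :
    Nonempty (Model right χ (natural right)) := by
  obtain ⟨m, hm, -, hanti⟩ := hχ
  have hpos : ∀ i, right i → 0 ≤ m i := by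
    intro i hi
    obtain ⟨B, hB⟩ := χ.support.bddAbove
    have h0 : χ (max i (B + 1)) = 0 := by
      by_contra h
      have h1 : max i (B + 1) ≤ B := hB (Finsupp.mem_support_iff.2 h)
      have h2 := le_max_right i (B + 1)
      omega
    rw [hm, Int.cast_eq_zero] at h0
    rw [← h0]
    exact hanti hi (lt_of_lt_of_le hi (le_max_left _ _)) (le_max_left _ _)
  refine nonempty_model (natural right) (fun i => (m i).natAbs) ?_ ?_ ?_ ?_
  · intro i hi
    rw [hm, Int.cast_eq_zero] at hi
    rw [hi, Int.natAbs_zero]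
  · exact fun A i j h => (A.2 i j h).1
  · intro A hA i j hj h
    have hij : i < j := not_le.1 fun h' => h (hA i j h')
    have hi := (A.2 i j h).1
    have h1 := hanti hi hj hij.le
    have h2 := hpos j hj
    exact ⟨hij.ne, by omega⟩
  · intro A hA
    refine ⟨hA, fun i hi => ?_⟩
    rw [hm, Nat.cast_natAbs, abs_of_nonneg (hpos i hi)]
    rfl

/-- Here `χ_i ≤ 0`, as the sequence vanishes far to the left, so the row lengths are `-χ_i`. Passing
to the dual representation compensates the sign and reverses the order: an upper triangular matrix
now increases indices, towards longer rows. -/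
theorem nonempty_model_left (hχ : IsSemidominant χ) :
    Nonempty (Model left χ (conatural left)) := by
  obtain ⟨m, hm, hanti, -⟩ := hχ
  have hneg : ∀ i, left i → m i ≤ 0 := by
    intro i hi
    obtain ⟨B, hB⟩ := χ.support.bddBelow
    have h0 : χ (min i (B - 1)) = 0 := by
      by_contra h
      have h1 : B ≤ min i (B - 1) := hB (Finsupp.mem_support_iff.2 h)
      have h2 := min_le_right i (B - 1)
      omega
    rw [hm, Int.cast_eq_zero] at h0
    rw [← h0]
    exact hanti (le_trans (min_le_left _ _) hi) hi (min_le_left _ _)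
  refine nonempty_model (conatural left) (fun i => (m i).natAbs) ?_ ?_ ?_ ?_
  · intro i hi
    rw [hm, Int.cast_eq_zero] at hi
    rw [hi, Int.natAbs_zero]
  · intro A i j h
    rw [entry_conatural, neg_ne_zero] at h
    exact (A.2 j i h).2
  · intro A hA i j hj h
    rw [entry_conatural, neg_ne_zero] at h
    have hij : j < i := not_le.1 fun h' => h (hA j i h')
    have hi := (A.2 j i h).2
    have h1 := hanti hj hi hij.le
    have h2 := hneg j hj
    exact ⟨hij.ne', by omega⟩
  · intro A hA
    refine ⟨fun i j hij => ?_, fun i hi => ?_⟩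
    · rw [entry_conatural, hA j i hij.symm, neg_zero]
    · rw [hm, Nat.cast_natAbs, abs_of_nonpos (hneg i hi), entry_conatural]
      push_cast
      ring

end Models

/-! ### Schur's lemma and the irreducibility of the tensor product -/

theorem finite_supported_Icc {κ : Type*} [Finite κ] (a b : ℤ) :
    Module.Finite ℂ (Finsupp.supported ℂ ℂ {g : κ → ℤ | ∀ m, g m ∈ Set.Icc a b}) := by
  rw [Finsupp.supported_eq_span_single]
  refine FiniteDimensional.span_of_finite ℂ (Set.Finite.image _ ?_)
  have := Set.Finite.pi (t := fun _ : κ => Set.Icc a b) fun _ => Set.finite_Icc a b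
  refine this.subset fun g hg => ?_
  rw [Set.mem_univ_pi]
  exact hg

/-- The vectors of the irreducible module that are annihilated by the truncated identity matrix
form a finite-dimensional space. -/
theorem finite_ker_truncation {χ : ℤ →₀ ℂ} (D : Model right χ (natural right)) (R : ℤ)
    (hR : 0 ≤ R) : ∃ h : block right,
      Module.Finite ℂ (LinearMap.ker (act (block right) (Irr right χ) h)) ∧
      ∀ x ∈ D.S, x ∈ Finsupp.supported ℂ ℂ {g : D.κ → ℤ | ∀ m, g m ∈ Set.Icc 1 R} →
        D.π x ∈ LinearMap.ker (act (block right) (Irr right χ) h) := by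
  -- The identity matrix truncated to the places beyond `R`: as a derivation it multiplies a pure
  -- tensor by the number of its factors with index beyond `R`.
  let h : block right := compress right (idem (R < ·))
  have hent : ∀ i j, entry (natural right h) i j = if i = j ∧ R < i then 1 else 0 := by
    intro i j
    change entry (compress right (idem (R < ·))).1.1 i j = _
    rw [entry_compress, entry_idem]
    by_cases h1 : i = j ∧ R < i
    · rw [if_pos h1, if_pos ⟨lt_of_le_of_lt hR h1.2, h1.1 ▸ lt_of_le_of_lt hR h1.2⟩]
    · rw [if_neg h1, ite_self]
  let H := derivation D.κ (natural right h)
  let c : (D.κ → ℤ) → ℕ := fun g => (Finset.univ.filter fun m => R < g m).card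
  have hH : ∀ g, H (Finsupp.single g 1) = (c g : ℂ) • Finsupp.single g 1 := by
    intro g
    refine (derivation_diagonal (fun i j hij => ?_) g).trans ?_
    · rw [hent, if_neg fun h => hij h.1]
    · simp only [hent, true_and, Finset.sum_boole, c]
  -- `Q` vanishes at every possible nonzero count and not at `0`, so up to the scalar `Q(0)` the
  -- operator `Q(H)` projects onto the tensors with all indices in `[1, R]`.
  let Q : Polynomial ℂ := ∏ j ∈ Finset.Icc 1 (Fintype.card D.κ), (Polynomial.X - Polynomial.C (j : ℂ))
  have hQ0 : Q.eval 0 ≠ 0 := by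
    simp only [Q, Polynomial.eval_prod, Polynomial.eval_sub, Polynomial.eval_X, Polynomial.eval_C,
      zero_sub]
    refine Finset.prod_ne_zero_iff.2 fun j hj => neg_ne_zero.2 (Nat.cast_ne_zero.2 ?_)
    have := (Finset.mem_Icc.1 hj).1
    omega
  have hmem : ∀ x ∈ D.S, Polynomial.aeval H Q x ∈
      Finsupp.supported ℂ ℂ {g : D.κ → ℤ | ∀ m, g m ∈ Set.Icc 1 R} := by
    intro x hx
    replace hx := D.supported hx
    rw [Finsupp.supported_eq_span_single] at hx
    induction hx using Submodule.span_induction with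
    | mem x hx =>
      obtain ⟨g, hg, rfl⟩ := hx
      rw [aeval_apply_of_eigen (hH g)]
      by_cases hc : c g = 0
      · refine Submodule.smul_mem _ _ (Finsupp.single_mem_supported ℂ _ fun m => ?_)
        have h1 : ¬ R < g m := Finset.filter_eq_empty_iff.1 (Finset.card_eq_zero.1 hc)
          (Finset.mem_univ m)
        have h2 : 0 < g m := hg m
        exact ⟨h2, not_lt.1 h1⟩
      · have : Q.eval (c g : ℂ) = 0 := by
          simp only [Q, Polynomial.eval_prod]
          refine Finset.prod_eq_zero (i := c g) (Finset.mem_Icc.2 ⟨Nat.one_le_iff_ne_zero.2 hc,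
            Finset.card_le_univ _⟩) ?_
          simp
        rw [this, zero_smul]
        exact zero_mem _
    | zero => rw [map_zero]; exact zero_mem _
    | add x y _ _ hx hy => rw [map_add]; exact add_mem hx hy
    | smul c x _ hx => rw [map_smul]; exact Submodule.smul_mem _ c hx
  refine ⟨h, ?_, ?_⟩
  · have := finite_supported_Icc (κ := D.κ) 1 R
    refine Submodule.finiteDimensional_of_le (S₂ := (Finsupp.supported ℂ ℂ
      {g : D.κ → ℤ | ∀ m, g m ∈ Set.Icc 1 R}).map D.π) fun u hu => ?_
    obtain ⟨x, hx, rfl⟩ := D.surjective u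
    -- On the kernel of `h` the operator `Q(h)` is the nonzero scalar `Q(0)`, so a kernel vector `π
    -- x` is a multiple of `π (Q(H) x)`, which comes from a finite-dimensional space.
    have h1 := (aeval_intertwine (π := D.π) (H := H) (h := act (block right) (Irr right χ) h)
      (D.stable h) (D.equivariant h) Q hx).2
    have h0 : act (block right) (Irr right χ) h (D.π x) = (0 : ℂ) • D.π x := by
      rw [zero_smul]; exact hu
    rw [aeval_apply_of_eigen h0] at h1
    have h2 : D.π x = (Q.eval 0)⁻¹ • D.π (Polynomial.aeval H Q x) := by
      rw [h1, inv_smul_smul₀ hQ0]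
    rw [h2]
    exact Submodule.smul_mem _ _ ⟨_, hmem x hx, rfl⟩
  · intro x hx hxs
    refine (D.equivariant h x hx).symm.trans ?_
    have : H x = 0 := by
      clear hx
      rw [Finsupp.supported_eq_span_single] at hxs
      induction hxs using Submodule.span_induction with
      | mem x hx =>
        obtain ⟨g, hg, rfl⟩ := hx
        have : c g = 0 := Finset.card_eq_zero.2 (Finset.filter_eq_empty_iff.2 fun m _ =>
          not_lt.2 (hg m).2)
        rw [hH, this, Nat.cast_zero, zero_smul]
      | zero => rw [map_zero]
      | add x y _ _ hx hy => rw [map_add, hx, hy, add_zero]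
      | smul c x _ hx => rw [map_smul, hx, smul_zero]
    change D.π (H x) = 0
    rw [this, map_zero]

/-- The module may be infinite-dimensional, so an eigenvector of `f` is sought in the kernel of a
truncated identity matrix. That kernel is finite-dimensional, stable under `f`, and nonzero once the
truncation lies beyond all indices of a tensor representing some nonzero vector. The corresponding
eigenspace of `f` is then a nonzero submodule. -/
theorem schur_right {χ : ℤ →₀ ℂ} (D : Model right χ (natural right))
    (f : Irr right χ →ₗ[UniversalEnvelopingAlgebra ℂ (block right)] Irr right χ) :
    ∃ c : ℂ, ∀ u, f u = c • u := by
  by_cases htriv : ∀ u : Irr right χ, u = 0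
  · exact ⟨0, fun u => by rw [htriv (f u), zero_smul]⟩
  push Not at htriv
  obtain ⟨u, hu⟩ := htriv
  obtain ⟨x, hx, rfl⟩ := D.surjective u
  obtain ⟨R, hR⟩ : ∃ R : ℤ, ∀ g ∈ x.support, ∀ m, g m ≤ R := by
    obtain ⟨R, hR⟩ := (x.support.biUnion fun g => Finset.univ.image g).bddAbove
    exact ⟨R, fun g hg m => hR (Finset.mem_biUnion.2
      ⟨g, hg, Finset.mem_image_of_mem g (Finset.mem_univ m)⟩)⟩
  obtain ⟨h, hfin, hker⟩ := finite_ker_truncation D (max R 0) (le_max_right _ _)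
  let E := LinearMap.ker (act (block right) (Irr right χ) h)
  have hxE : D.π x ∈ E := by
    refine hker x hx fun g hg m => ⟨?_, (hR g hg m).trans (le_max_left _ _)⟩
    have : 0 < g m := D.supported hx hg m
    exact this
  have hfE : ∀ w ∈ E, f.restrictScalars ℂ w ∈ E := by
    intro w hw
    have hw' : UniversalEnvelopingAlgebra.ι ℂ h • w = 0 := hw
    change UniversalEnvelopingAlgebra.ι ℂ h • f w = 0
    rw [← map_smul, hw', map_zero]
  have : Nontrivial E := ⟨⟨D.π x, hxE⟩, 0, fun h0 => hu (congrArg Subtype.val h0)⟩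
  obtain ⟨c, hc⟩ := Module.End.exists_eigenvalue ((f.restrictScalars ℂ).restrict hfE)
  obtain ⟨w, hw⟩ := hc.exists_hasEigenvector
  have hw1 : f w.1 = c • w.1 := congrArg Subtype.val hw.apply_eq_smul
  let P : Submodule (UniversalEnvelopingAlgebra ℂ (block right)) (Irr right χ) :=
    { carrier := {u | f u = c • u}
      add_mem' := fun {a b} ha hb => by
        change f (a + b) = c • (a + b)
        rw [map_add, smul_add, show f a = _ from ha, show f b = _ from hb]
      zero_mem' := by
        change f 0 = c • 0
        rw [map_zero, smul_zero]
      smul_mem' := fun u a ha => by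
        change f (u • a) = c • u • a
        rw [map_smul, show f a = _ from ha, smul_comm] }
  have hP : P = ⊤ := Irr.eq_top_of_ne_bot fun h0 => hw.2 (Subtype.ext (by
    have : w.1 ∈ P := hw1
    rwa [h0] at this))
  refine ⟨c, fun u => ?_⟩
  have : u ∈ P := hP ▸ Submodule.mem_top
  exact this

/-! ### Tensor products of two simple modules. -/

section TensorIrreducible

variable {U₁ U₂ L₁ L₂ : Type*} [Ring U₁] [Ring U₂] [AddCommGroup L₁] [Module ℂ L₁] [Module U₁ L₁]
  [AddCommGroup L₂] [Module ℂ L₂] [Module U₂ L₂]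

/-- If `L` has no nontrivial submodules and only scalar endomorphisms, a vector whose annihilator
contains that of `b ≠ 0` is a multiple of `b`. -/
theorem exists_eq_smul_of_annihilator_le (h : ∀ P : Submodule U₂ L₂, P ≠ ⊥ → P = ⊤)
    (schur : ∀ f : L₂ →ₗ[U₂] L₂, ∃ c : ℂ, ∀ u, f u = c • u) {b b' : L₂} (hb : b ≠ 0)
    (hann : ∀ u : U₂, u • b = 0 → u • b' = 0) : ∃ c : ℂ, b' = c • b := by
  let f := LinearMap.toSpanSingleton U₂ L₂ b
  have hf : Function.Surjective f := by
    refine LinearMap.range_eq_top.1 (h _ fun h0 => hb ?_)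
    have : f 1 ∈ LinearMap.range f := ⟨1, rfl⟩
    rw [h0, Submodule.mem_bot] at this
    simpa [f] using this
  have hker : LinearMap.ker f ≤ LinearMap.ker (LinearMap.toSpanSingleton U₂ L₂ b') :=
    fun u hu => hann u hu
  obtain ⟨c, hc⟩ := schur ((LinearMap.ker f).liftQ _ hker ∘ₗ
    (f.quotKerEquivOfSurjective hf).symm.toLinearMap)
  refine ⟨c, ?_⟩
  rw [← hc b]
  have h1 : (f.quotKerEquivOfSurjective hf).symm b = (LinearMap.ker f).mkQ 1 := by
    rw [LinearEquiv.symm_apply_eq]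
    exact (one_smul U₂ b).symm
  rw [LinearMap.comp_apply, LinearEquiv.coe_coe, h1]
  exact (one_smul U₂ b').symm

variable [Algebra ℂ U₁] [IsScalarTower ℂ U₁ L₁] [Algebra ℂ U₂] [IsScalarTower ℂ U₂ L₂]

/-- The tensor product of two modules without nontrivial submodules has no nontrivial subspaces
stable under both actions, if the second module has only scalar endomorphisms. -/
theorem tensor_eq_top_of_ne_bot (h₁ : ∀ P : Submodule U₁ L₁, P ≠ ⊥ → P = ⊤)
    (h₂ : ∀ P : Submodule U₂ L₂, P ≠ ⊥ → P = ⊤)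
    (schur : ∀ f : L₂ →ₗ[U₂] L₂, ∃ c : ℂ, ∀ u, f u = c • u)
    (Q : Submodule ℂ (L₁ ⊗[ℂ] L₂))
    (hQ₁ : ∀ u : U₁, ∀ w ∈ Q, LinearMap.rTensor L₂ (Algebra.lsmul ℂ ℂ L₁ u) w ∈ Q)
    (hQ₂ : ∀ u : U₂, ∀ w ∈ Q, LinearMap.lTensor L₁ (Algebra.lsmul ℂ ℂ L₂ u) w ∈ Q)
    (hQ : Q ≠ ⊥) : Q = ⊤ := by
  classical
  let B := Module.Basis.ofVectorSpace ℂ L₁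
  let e := TensorProduct.equivFinsuppOfBasisLeft (N := L₂) B
  have he : ∀ (u : U₂) w i, e (LinearMap.lTensor L₁ (Algebra.lsmul ℂ ℂ L₂ u) w) i = u • e w i := by
    intro u w i
    induction w using TensorProduct.induction_on with
    | zero => simp
    | tmul a b =>
      rw [LinearMap.lTensor_tmul]
      simp only [e, TensorProduct.equivFinsuppOfBasisLeft_apply_tmul_apply, Algebra.lsmul_coe]
      rw [smul_comm]
    | add x y hx hy => simp only [map_add, Finsupp.add_apply, hx, hy, smul_add]
  -- Choose a nonzero `w ∈ Q` with the fewest nonzero coordinates along a basis of `L₁`.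
  have hne : ∃ n, ∃ w ∈ Q, w ≠ 0 ∧ (e w).support.card = n := by
    obtain ⟨w, hw, hw0⟩ := (Submodule.ne_bot_iff Q).1 hQ
    exact ⟨_, w, hw, hw0, rfl⟩
  obtain ⟨w, hw, hw0, hcard⟩ := Nat.find_spec hne
  have hmin : ∀ w' ∈ Q, (e w').support.card < (e w).support.card → w' = 0 := by
    intro w' hw' hlt
    by_contra h0
    rw [hcard] at hlt
    exact Nat.find_min hne hlt ⟨w', hw', h0, rfl⟩
  obtain ⟨i₀, hi₀⟩ : ∃ i, e w i ≠ 0 := by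
    by_contra! hall
    exact hw0 (e.map_eq_zero_iff.1 (Finsupp.ext hall))
  -- If `u` kills the coordinate at `i₀`, then `u w` has fewer nonzero coordinates, so it is zero by
  -- minimality and `u` kills every coordinate. Hence all coordinates are proportional and `w` is a
  -- pure tensor.
  have hc : ∀ i, ∃ c : ℂ, e w i = c • e w i₀ := by
    intro i
    refine exists_eq_smul_of_annihilator_le h₂ schur hi₀ fun u hu => ?_
    have hlt : (e (LinearMap.lTensor L₁ (Algebra.lsmul ℂ ℂ L₂ u) w)).support.card <
        (e w).support.card := by
      refine Finset.card_lt_card (Finset.ssubset_iff_subset_ne.2 ⟨fun j hj => ?_, fun heq => ?_⟩)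
      · rw [Finsupp.mem_support_iff, he] at hj
        rw [Finsupp.mem_support_iff]
        intro h0
        rw [h0, smul_zero] at hj
        exact hj rfl
      · have : i₀ ∈ (e w).support := Finsupp.mem_support_iff.2 hi₀
        rw [← heq, Finsupp.mem_support_iff, he] at this
        exact this hu
    rw [← he, hmin _ (hQ₂ u w hw) hlt, map_zero]
    rfl
  choose c hc using hc
  obtain ⟨a, ha⟩ : ∃ a : L₁, w = a ⊗ₜ e w i₀ := by
    refine ⟨∑ i ∈ (e w).support, c i • B i, e.injective (Finsupp.ext fun i => ?_)⟩
    simp only [e, TensorProduct.equivFinsuppOfBasisLeft_apply_tmul_apply]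
    change e w i = _
    rw [map_sum, Finsupp.finsetSum_apply]
    simp only [map_smul, Module.Basis.repr_self, Finsupp.smul_apply, Finsupp.single_apply,
      smul_eq_mul, mul_ite, mul_one, mul_zero, Finset.sum_ite_eq']
    split_ifs with hi
    · exact hc i
    · rw [zero_smul]
      exact Finsupp.notMem_support_iff.1 hi
  have ha0 : a ≠ 0 := by
    rintro rfl
    rw [TensorProduct.zero_tmul] at ha
    exact hw0 ha
  have step₂ : ∀ b, a ⊗ₜ b ∈ Q := by
    let P : Submodule U₂ L₂ :=
      { carrier := {b | a ⊗ₜ b ∈ Q}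
        add_mem' := fun {b b'} hb hb' => by
          change a ⊗ₜ (b + b') ∈ Q
          rw [TensorProduct.tmul_add]
          exact Q.add_mem hb hb'
        zero_mem' := by
          change a ⊗ₜ (0 : L₂) ∈ Q
          rw [TensorProduct.tmul_zero]
          exact Q.zero_mem
        smul_mem' := fun u b hb => hQ₂ u _ hb }
    have hP : P = ⊤ := h₂ P fun h0 => hi₀ (by
      have : e w i₀ ∈ P := by
        change a ⊗ₜ e w i₀ ∈ Q
        rwa [← ha]
      rwa [h0] at this)
    intro b
    have : b ∈ P := hP ▸ Submodule.mem_top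
    exact this
  have step₁ : ∀ b a', a' ⊗ₜ b ∈ Q := by
    intro b
    let P : Submodule U₁ L₁ :=
      { carrier := {a' | a' ⊗ₜ b ∈ Q}
        add_mem' := fun {a₁ a₂} h1 h2 => by
          change (a₁ + a₂) ⊗ₜ b ∈ Q
          rw [TensorProduct.add_tmul]
          exact Q.add_mem h1 h2
        zero_mem' := by
          change (0 : L₁) ⊗ₜ b ∈ Q
          rw [TensorProduct.zero_tmul]
          exact Q.zero_mem
        smul_mem' := fun u a' ha' => hQ₁ u _ ha' }
    have hP : P = ⊤ := h₁ P fun h0 => ha0 (by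
      have : a ∈ P := step₂ b
      rwa [h0] at this)
    intro a'
    have : a' ∈ P := hP ▸ Submodule.mem_top
    exact this
  rw [eq_top_iff, ← TensorProduct.span_tmul_eq_top, Submodule.span_le]
  rintro _ ⟨a', b, rfl⟩
  exact step₁ b a'

end TensorIrreducible

theorem irr_tensor_eq_top_of_ne_bot {χ : ℤ →₀ ℂ} (hχ : IsSemidominant χ)
    (Q : Submodule ℂ (Irr left χ ⊗[ℂ] Irr right χ))
    (hQ₁ : ∀ A, ∀ w ∈ Q, LinearMap.rTensor (Irr right χ) (act (block left) (Irr left χ) A) w ∈ Q)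
    (hQ₂ : ∀ A, ∀ w ∈ Q, LinearMap.lTensor (Irr left χ) (act (block right) (Irr right χ) A) w ∈ Q)
    (hQ : Q ≠ ⊥) : Q = ⊤ := by
  obtain ⟨D⟩ := nonempty_model_right hχ
  refine tensor_eq_top_of_ne_bot (U₁ := UniversalEnvelopingAlgebra ℂ (block left))
    (U₂ := UniversalEnvelopingAlgebra ℂ (block right))
    (fun P hP => Irr.eq_top_of_ne_bot hP) (fun P hP => Irr.eq_top_of_ne_bot hP)
    (schur_right D) Q ?_ ?_ hQ
  · intro u w hw
    exact algHom_enveloping_apply_mem ((Module.End.rTensorAlgHom ℂ (Irr left χ) (Irr right χ)).comp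
      (Algebra.lsmul ℂ ℂ (Irr left χ))) Q hQ₁ u hw
  · intro u w hw
    exact algHom_enveloping_apply_mem ((Module.End.lTensorAlgHom ℂ (Irr right χ) (Irr left χ)).comp
      (Algebra.lsmul ℂ ℂ (Irr right χ))) Q hQ₂ u hw

/-! ### Matrix units in the central extension -/

/-- The matrix unit as an element of `Mat`. -/
def unitMat (i j : ℤ) : Mat :=
  ⟨unitEnd i j, |i - j|, fun k l h => by
    rw [entry_unitEnd, if_neg]
    rintro ⟨rfl, rfl⟩
    exact lt_irrefl _ h⟩

theorem entry_unitMat (i j k l : ℤ) :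
    entry (unitMat i j).1 k l = if k = i ∧ l = j then 1 else 0 := entry_unitEnd i j k l

theorem mat_ext {A B : Mat} (h : ∀ i j, entry A.1 i j = entry B.1 i j) : A = B :=
  Subtype.ext (end_ext h)

theorem unitMat_mul (i j k l : ℤ) :
    unitMat i j * unitMat k l = if j = k then unitMat i l else 0 := by
  refine Subtype.ext (LinearMap.ext fun v => ?_)
  change Finsupp.single i ((Finsupp.single k (v l) : ℤ →₀ ℂ) j) = _
  rw [Finsupp.single_apply]
  by_cases h : k = j
  · rw [if_pos h, if_pos h.symm]
    rfl
  · rw [if_neg h, if_neg (Ne.symm h), Finsupp.single_zero]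
    rfl

theorem tr_unitMat (i j : ℤ) : tr (unitMat i j) = if i = j then 1 else 0 := by
  rw [tr_eq_sum _ {i}]
  · rw [Finset.sum_singleton, entry_unitMat]
    simp
  · intro k hk
    rw [entry_unitMat] at hk
    by_contra h
    exact hk (if_neg fun h' => h (Finset.mem_singleton.2 h'.1))

theorem dJ_unitMat (i j : ℤ) : dJ (unitMat i j) =
    (((if i ≤ 0 then 1 else 0) - (if j ≤ 0 then 1 else 0) : ℂ)) • unitMat i j := by
  refine mat_ext fun k l => ?_
  rw [entry_dJ]
  change _ = (_ : ℂ) * entry (unitMat i j).1 k l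
  rw [entry_unitMat]
  by_cases h : k = i ∧ l = j
  · obtain ⟨rfl, rfl⟩ := h
    simp
  · simp [h]

theorem omega_unitMat (i j k l : ℤ) : omega (unitMat i j) (unitMat k l) =
    if j = k ∧ i = l then (if i ≤ 0 then 1 else 0) - (if j ≤ 0 then 1 else 0) else 0 := by
  rw [omega, dJ_unitMat, smul_mul_assoc, tr_smul, unitMat_mul]
  by_cases h : j = k
  · rw [if_pos h, tr_unitMat]
    by_cases h' : i = l <;> simp [h, h']
  · have : tr 0 = 0 := finsum_eq_zero_of_forall_eq_zero fun i => entry_zero i i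
    rw [if_neg h, this, mul_zero, if_neg fun h' => h h'.1]

/-- The element of `GlHat` with given matrix and zero central coordinate. -/
def ofMat (A : Mat) : GlHat := ⟨(A, 0)⟩

/-- The central element of `GlHat`. -/
def central : GlHat := ⟨(0, (TrivialLieModule.equiv ℂ Mat ℂ).symm 1)⟩

theorem cen_ofMat (A : Mat) : cen (ofMat A) = 0 := rfl
theorem mat_central : mat central = 0 := rfl
theorem cen_central : cen central = 1 := rfl

theorem glHat_ext {X Y : GlHat} (h₁ : mat X = mat Y) (h₂ : cen X = cen Y) : X = Y := by
  rcases X with ⟨A, a⟩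
  rcases Y with ⟨B, b⟩
  have h₃ : a = b := (TrivialLieModule.equiv ℂ Mat ℂ).injective h₂
  have h₄ : A = B := h₁
  rw [h₃, h₄]

/-- The matrix unit in `GlHat`. -/
def unitHat (i j : ℤ) : GlHat := ofMat (unitMat i j)

theorem unitHat_lie (i j k l : ℤ) : ⁅unitHat i j, unitHat k l⁆ =
    (if j = k then unitHat i l else 0) - (if l = i then unitHat k j else 0) +
      (if j = k ∧ i = l then (if i ≤ 0 then 1 else 0) - (if j ≤ 0 then 1 else 0) else 0 : ℂ) •
        central := by
  have hm : ∀ (P : Prop) [Decidable P] (X : GlHat), mat (if P then X else 0) =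
      if P then mat X else 0 := fun P _ X => by split_ifs <;> rfl
  have hc : ∀ (P : Prop) [Decidable P] (X : GlHat), cen (if P then X else 0) =
      if P then cen X else 0 := fun P _ X => by split_ifs <;> rfl
  have hms : ∀ X Y : GlHat, mat (X - Y) = mat X - mat Y := fun _ _ => rfl
  have hcs : ∀ X Y : GlHat, cen (X - Y) = cen X - cen Y := fun X Y =>
    map_sub (TrivialLieModule.equiv ℂ Mat ℂ) X.carrier.2 Y.carrier.2
  refine glHat_ext ?_ ?_
  · rw [mat_lie, mat_add, hms, hm, hm, mat_smul, mat_central, smul_zero, add_zero]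
    change unitMat i j * unitMat k l - unitMat k l * unitMat i j =
      (if j = k then unitMat i l else 0) - (if l = i then unitMat k j else 0)
    rw [unitMat_mul, unitMat_mul]
  · rw [cen_lie, cen_add, hcs, hc, hc, cen_smul, cen_central, mul_one]
    change omega (unitMat i j) (unitMat k l) = _
    rw [omega_unitMat]
    have h0 : ∀ i j, cen (unitHat i j) = 0 := fun _ _ => rfl
    simp [h0]

/-! ### The induced module -/

section Induced

variable (χ : ℤ →₀ ℂ) (c : ℂ)

/-- The map `v ↦ 1 ⊗ v` as a linear map. -/
def Ind.baseLin : Irr left χ ⊗[ℂ] Irr right χ →ₗ[ℂ] Ind χ c :=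
  ((inducedRel parabolic (leviRep χ c)).mkQ.restrictScalars ℂ) ∘ₗ
    (TensorProduct.mk ℂ (UniversalEnvelopingAlgebra ℂ GlHat) (Irr left χ ⊗[ℂ] Irr right χ) 1)

variable {χ c}

theorem Ind.parabolic_smul_base (x : parabolic) (v : Irr left χ ⊗[ℂ] Irr right χ) :
    UniversalEnvelopingAlgebra.ι ℂ x.1 • Ind.baseLin χ c v =
      Ind.baseLin χ c (leviRep χ c x v) := by
  refine (Submodule.Quotient.eq (inducedRel parabolic (leviRep χ c))).2
    (Submodule.subset_span ⟨1, x, v, ?_⟩)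
  rw [one_mul]
  change (UniversalEnvelopingAlgebra.ι ℂ x.1 * 1) ⊗ₜ[ℂ] v - _ = _
  rw [mul_one]
  rfl

theorem Ind.eq_top_of_base_mem {P : Submodule (UniversalEnvelopingAlgebra ℂ GlHat) (Ind χ c)}
    (h : ∀ v, Ind.baseLin χ c v ∈ P) : P = ⊤ := by
  refine Submodule.eq_top_iff'.2 fun w => ?_
  obtain ⟨t, rfl⟩ := Submodule.mkQ_surjective (inducedRel parabolic (leviRep χ c)) w
  induction t using TensorProduct.induction_on with
  | zero => rw [map_zero]; exact P.zero_mem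
  | tmul u v =>
    have h1 : u ⊗ₜ[ℂ] v = u • ((1 : UniversalEnvelopingAlgebra ℂ GlHat) ⊗ₜ[ℂ] v) := by
      rw [TensorProduct.smul_tmul', smul_eq_mul, mul_one]
    rw [h1, map_smul]
    exact P.smul_mem u (h v)
  | add x y hx hy => rw [map_add]; exact P.add_mem hx hy

/-- The central element commutes with the enveloping algebra, so the vectors on which it acts by `c`
form a submodule, and this submodule contains the generators `1 ⊗ v`. -/
theorem Ind.central_smul (w : Ind χ c) :
    UniversalEnvelopingAlgebra.ι ℂ central • w = c • w := by
  have hcomm : ∀ u : UniversalEnvelopingAlgebra ℂ GlHat,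
      u * UniversalEnvelopingAlgebra.ι ℂ central = UniversalEnvelopingAlgebra.ι ℂ central * u := by
    have : Subalgebra.centralizer ℂ {UniversalEnvelopingAlgebra.ι ℂ central} = ⊤ := by
      refine enveloping_eq_top _ fun x => ?_
      rw [Subalgebra.mem_centralizer_iff]
      rintro _ rfl
      have h0 : ⁅central, x⁆ = 0 := by
        refine glHat_ext ?_ ?_
        · rw [mat_lie, mat_central, zero_mul, mul_zero, sub_zero]
          rfl
        · have : omega 0 (mat x) = 0 := by
            have := omega_smul_left 0 0 (mat x)
            rwa [zero_smul, zero_mul] at this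
          rw [cen_lie, mat_central, this]
          rfl
      have h1 := LieHom.map_lie (UniversalEnvelopingAlgebra.ι ℂ) central x
      rw [h0, map_zero, LieRing.of_associative_ring_bracket] at h1
      exact sub_eq_zero.1 h1.symm
    intro u
    have hu : u ∈ Subalgebra.centralizer ℂ {UniversalEnvelopingAlgebra.ι ℂ central} :=
      this ▸ Algebra.mem_top
    exact ((Subalgebra.mem_centralizer_iff ℂ).1 hu _ rfl).symm
  let P : Submodule (UniversalEnvelopingAlgebra ℂ GlHat) (Ind χ c) :=
    { carrier := {w | UniversalEnvelopingAlgebra.ι ℂ central • w = c • w}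
      add_mem' := fun {a b} ha hb => by
        change _ • (a + b) = c • (a + b)
        rw [smul_add, smul_add, show _ • a = _ from ha, show _ • b = _ from hb]
      zero_mem' := by
        change _ • (0 : Ind χ c) = c • (0 : Ind χ c)
        rw [smul_zero, smul_zero]
      smul_mem' := fun u a ha => by
        change UniversalEnvelopingAlgebra.ι ℂ central • u • a = c • u • a
        rw [smul_smul, ← hcomm, mul_smul, show _ • a = _ from ha, smul_comm] }
  have hP : P = ⊤ := Ind.eq_top_of_base_mem fun v => by
    have hx : central ∈ parabolic := fun i j _ _ => rfl
    refine (Ind.parabolic_smul_base ⟨central, hx⟩ v).trans ?_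
    rw [← map_smul]
    congr 1
    have h0 : ∀ (p : ℤ → Prop) [DecidablePred p], compress p (mat central) = 0 := fun p _ => by
      rw [mat_central]
      have := compress_smul p 0 0
      rwa [zero_smul, zero_smul] at this
    change LinearMap.rTensor _ (act _ _ (compress left (mat central))) v +
      LinearMap.lTensor _ (act _ _ (compress right (mat central))) v + (c * cen central) • v = _
    rw [h0, h0, cen_central, map_zero, map_zero, mul_one, LinearMap.rTensor_zero,
      LinearMap.lTensor_zero]
    simp
  have hw : w ∈ P := hP ▸ Submodule.mem_top
  exact hw

theorem Ind.smul_sub_smul (X Y : GlHat) (w : Ind χ c) :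
    UniversalEnvelopingAlgebra.ι ℂ X • UniversalEnvelopingAlgebra.ι ℂ Y • w =
      UniversalEnvelopingAlgebra.ι ℂ Y • UniversalEnvelopingAlgebra.ι ℂ X • w +
        UniversalEnvelopingAlgebra.ι ℂ ⁅X, Y⁆ • w := by
  rw [LieHom.map_lie, LieRing.of_associative_ring_bracket, sub_smul, mul_smul, mul_smul]
  abel

end Induced

/-! ### Commutation of matrix units on the induced module and the Casimir-type operator. -/

section Operators

variable {χ : ℤ →₀ ℂ} {c : ℂ}

variable (χ c) in
/-- The action of a matrix unit on the induced module. -/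
def unitOp (i j : ℤ) : Module.End ℂ (Ind χ c) := act GlHat (Ind χ c) (unitHat i j)

theorem unitOp_apply_unitOp (i j k l : ℤ) (w : Ind χ c) :
    unitOp χ c i j (unitOp χ c k l w) = unitOp χ c k l (unitOp χ c i j w) +
      ((if j = k then unitOp χ c i l w else 0) - (if l = i then unitOp χ c k j w else 0) +
        (if j = k ∧ i = l then (if i ≤ 0 then 1 else 0) - (if j ≤ 0 then 1 else 0) else 0 : ℂ) •
          c • w) := by
  have hite : ∀ (P : Prop) [Decidable P] (X : GlHat),
      act GlHat (Ind χ c) (if P then X else 0) w = if P then act GlHat (Ind χ c) X w else 0 :=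
    fun P _ X => by
      split_ifs
      · rfl
      · rw [map_zero]; rfl
  refine (Ind.smul_sub_smul (unitHat i j) (unitHat k l) w).trans ?_
  congr 1
  change act GlHat (Ind χ c) ⁅unitHat i j, unitHat k l⁆ w = _
  rw [unitHat_lie, map_add, map_sub, map_smul, LinearMap.add_apply, LinearMap.sub_apply, hite,
    hite, LinearMap.smul_apply]
  change _ + _ • UniversalEnvelopingAlgebra.ι ℂ central • w = _
  rw [Ind.central_smul]
  rfl

theorem unitOp_lower_comm {i j a b : ℤ} (hi : right i) (hj : left j) (ha : right a) (hb : left b)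
    (w : Ind χ c) :
    unitOp χ c i j (unitOp χ c a b w) = unitOp χ c a b (unitOp χ c i j w) := by
  rw [unitOp_apply_unitOp, if_neg (by omega), if_neg (by omega), if_neg (by omega)]
  simp

theorem unitOp_right_lower {i i' a b : ℤ} (hi : right i) (hb : left b)
    (w : Ind χ c) :
    unitOp χ c i i' (unitOp χ c a b w) = unitOp χ c a b (unitOp χ c i i' w) +
      if i' = a then unitOp χ c i b w else 0 := by
  rw [unitOp_apply_unitOp, if_neg (show ¬ b = i by omega),
    if_neg (show ¬ (i' = a ∧ i = b) by omega)]
  simp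

theorem unitOp_left_lower {j j' a b : ℤ} (hj' : left j') (ha : right a)
    (w : Ind χ c) :
    unitOp χ c j j' (unitOp χ c a b w) = unitOp χ c a b (unitOp χ c j j' w) -
      if b = j then unitOp χ c a j' w else 0 := by
  rw [unitOp_apply_unitOp, if_neg (show ¬ j' = a by omega),
    if_neg (show ¬ (j' = a ∧ j = b) by omega), zero_sub, zero_smul, add_zero, sub_eq_add_neg]

theorem unitOp_upper_lower {i j a b : ℤ} (hi : right i) (hj : left j) (w : Ind χ c) :
    unitOp χ c j i (unitOp χ c a b w) = unitOp χ c a b (unitOp χ c j i w) +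
      ((if i = a then unitOp χ c j b w else 0) - (if b = j then unitOp χ c a i w else 0) +
        if i = a then if b = j then c • w else 0 else 0) := by
  rw [unitOp_apply_unitOp, if_pos hj, if_neg (not_le.2 hi), sub_zero]
  congr 2
  by_cases h1 : i = a <;> by_cases h2 : b = j <;> simp [h1, h2, eq_comm]
  exact fun h => (h2 h.symm).elim

/-- The Casimir-type operator `∑ E_{ij} E_{ji}` over `i > 0 ≥ j` in the finite set `R`. -/
def casimir (χ : ℤ →₀ ℂ) (c : ℂ) (R : Finset ℤ) : Module.End ℂ (Ind χ c) :=
  ∑ i ∈ R with right i, ∑ j ∈ R with left j, unitOp χ c i j * unitOp χ c j i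

theorem casimir_apply (R : Finset ℤ) (w : Ind χ c) : casimir χ c R w =
    ∑ i ∈ R with right i, ∑ j ∈ R with left j, unitOp χ c i j (unitOp χ c j i w) := by
  simp only [casimir, LinearMap.sum_apply, Module.End.mul_apply]

/-- Moving `E_{ji}` past `E_{ab}` yields a unit of the first block if `i = a`, a unit of the second
if `j = b`, and the cocycle term `c` if both hold; `E_{ij}` commutes with `E_{ab}`. As `a, b ∈ R`,
each condition selects exactly one index. -/
theorem casimir_unitOp {R : Finset ℤ} {a b : ℤ} (ha : right a) (hb : left b) (haR : a ∈ R)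
    (hbR : b ∈ R) (w : Ind χ c) :
    casimir χ c R (unitOp χ c a b w) = unitOp χ c a b (casimir χ c R w) + c • unitOp χ c a b w +
      ∑ j ∈ R with left j, unitOp χ c a j (unitOp χ c j b w) -
      ∑ i ∈ R with right i, unitOp χ c i b (unitOp χ c a i w) := by
  have ha' : a ∈ R.filter right := Finset.mem_filter.2 ⟨haR, ha⟩
  have hb' : b ∈ R.filter left := Finset.mem_filter.2 ⟨hbR, hb⟩
  have key : ∀ i ∈ R.filter right, ∀ j ∈ R.filter left,
      unitOp χ c i j (unitOp χ c j i (unitOp χ c a b w)) =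
        unitOp χ c a b (unitOp χ c i j (unitOp χ c j i w)) +
        (if i = a then unitOp χ c i j (unitOp χ c j b w) else 0) -
        (if b = j then unitOp χ c i j (unitOp χ c a i w) else 0) +
        (if i = a then if b = j then c • unitOp χ c i j w else 0 else 0) := by
    intro i hi j hj
    have hi := (Finset.mem_filter.1 hi).2
    have hj := (Finset.mem_filter.1 hj).2
    rw [unitOp_upper_lower hi hj, map_add, unitOp_lower_comm hi hj ha hb, map_add, map_sub]
    have hite : ∀ (P : Prop) [Decidable P] (v : Ind χ c),
        unitOp χ c i j (if P then v else 0) = if P then unitOp χ c i j v else 0 :=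
      fun P _ v => by split_ifs <;> simp
    rw [hite, hite, hite, hite, map_smul]
    abel
  rw [casimir_apply, casimir_apply, Finset.sum_congr rfl fun i hi => Finset.sum_congr rfl (key i hi)]
  simp only [Finset.sum_add_distrib, Finset.sum_sub_distrib, map_sum]
  have s1 : ∑ i ∈ R with right i, ∑ j ∈ R with left j,
      (if i = a then unitOp χ c i j (unitOp χ c j b w) else 0) =
      ∑ j ∈ R with left j, unitOp χ c a j (unitOp χ c j b w) := by
    rw [Finset.sum_comm]
    exact Finset.sum_congr rfl fun j _ => by rw [Finset.sum_ite_eq', if_pos ha']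
  have s2 : ∑ i ∈ R with right i, ∑ j ∈ R with left j,
      (if b = j then unitOp χ c i j (unitOp χ c a i w) else 0) =
      ∑ i ∈ R with right i, unitOp χ c i b (unitOp χ c a i w) :=
    Finset.sum_congr rfl fun i _ => by rw [Finset.sum_ite_eq, if_pos hb']
  have s3 : ∑ i ∈ R with right i, ∑ j ∈ R with left j,
      (if i = a then if b = j then c • unitOp χ c i j w else 0 else 0) = c • unitOp χ c a b w := by
    rw [Finset.sum_comm]
    rw [Finset.sum_congr rfl fun j _ => by rw [Finset.sum_ite_eq', if_pos ha']]
    rw [Finset.sum_ite_eq, if_pos hb']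
  rw [s1, s2, s3]
  abel

variable (χ c) in
/-- The operator `E_{a_1 b_1} ⋯ E_{a_l b_l}`. -/
def lower : (l : ℕ) → (Fin l → ℤ) → (Fin l → ℤ) → Module.End ℂ (Ind χ c)
  | 0, _, _ => 1
  | l + 1, a, b => unitOp χ c (a 0) (b 0) * lower l (Fin.tail a) (Fin.tail b)

theorem lower_succ {l : ℕ} (a b : Fin (l + 1) → ℤ) (w : Ind χ c) :
    lower χ c (l + 1) a b w =
      unitOp χ c (a 0) (b 0) (lower χ c l (Fin.tail a) (Fin.tail b) w) := rfl

theorem tail_update_zero {l : ℕ} (a : Fin (l + 1) → ℤ) (i : ℤ) :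
    Fin.tail (Function.update a 0 i) = Fin.tail a := Fin.tail_update_zero a i

theorem tail_update_succ {l : ℕ} (a : Fin (l + 1) → ℤ) (m : Fin l) (i : ℤ) :
    Fin.tail (Function.update a m.succ i) = Function.update (Fin.tail a) m i :=
  Fin.tail_update_succ a m i

theorem unitOp_right_lowerProd {i i' : ℤ} (hi : right i) {l : ℕ}
    (a : Fin l → ℤ) {b : Fin l → ℤ} (hb : ∀ k, left (b k)) (w : Ind χ c) :
    unitOp χ c i i' (lower χ c l a b w) = lower χ c l a b (unitOp χ c i i' w) +
      ∑ m, if i' = a m then lower χ c l (Function.update a m i) b w else 0 := by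
  induction l with
  | zero => simp [lower]
  | succ l ih =>
    rw [lower_succ, unitOp_right_lower hi (hb 0), ih (b := Fin.tail b) _ fun k => hb k.succ, Fin.sum_univ_succ,
      map_add, map_sum, lower_succ, lower_succ, tail_update_zero, Function.update_self]
    have : ∀ m : Fin l, unitOp χ c (a 0) (b 0) (if i' = Fin.tail a m then
        lower χ c l (Function.update (Fin.tail a) m i) (Fin.tail b) w else 0) =
        if i' = a m.succ then lower χ c (l + 1) (Function.update a m.succ i) b w else 0 := by
      intro m
      rw [lower_succ, tail_update_succ, Function.update_of_ne (Fin.succ_ne_zero m).symm]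
      change _ = if i' = Fin.tail a m then _ else _
      split_ifs <;> simp
    rw [Finset.sum_congr rfl fun m _ => this m]
    abel

theorem unitOp_left_lowerProd {j j' : ℤ} (hj' : left j') {l : ℕ}
    {a : Fin l → ℤ} (b : Fin l → ℤ) (ha : ∀ k, right (a k)) (w : Ind χ c) :
    unitOp χ c j j' (lower χ c l a b w) = lower χ c l a b (unitOp χ c j j' w) -
      ∑ m, if b m = j then lower χ c l a (Function.update b m j') w else 0 := by
  induction l with
  | zero => simp [lower]
  | succ l ih =>
    rw [lower_succ, unitOp_left_lower hj' (ha 0), ih (a := Fin.tail a) _ fun k => ha k.succ, Fin.sum_univ_succ,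
      map_sub, map_sum, lower_succ, lower_succ, tail_update_zero, Function.update_self]
    have : ∀ m : Fin l, unitOp χ c (a 0) (b 0) (if Fin.tail b m = j then
        lower χ c l (Fin.tail a) (Function.update (Fin.tail b) m j') w else 0) =
        if b m.succ = j then lower χ c (l + 1) a (Function.update b m.succ j') w else 0 := by
      intro m
      rw [lower_succ, tail_update_succ, Function.update_of_ne (Fin.succ_ne_zero m).symm]
      change _ = if Fin.tail b m = j then _ else _
      split_ifs <;> simp
    rw [Finset.sum_congr rfl fun m _ => this m]
    abel

theorem comp_swap_zero_succ {l : ℕ} (a : Fin (l + 1) → ℤ) (m : Fin l) :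
    (a ∘ Equiv.swap 0 m.succ) 0 = a m.succ ∧
      Fin.tail (a ∘ Equiv.swap 0 m.succ) = Function.update (Fin.tail a) m (a 0) := by
  refine ⟨by simp, funext fun k => ?_⟩
  simp only [Fin.tail, Function.comp_apply, Equiv.swap_apply_def, Fin.succ_ne_zero, if_false,
    Fin.succ_inj, Function.update_apply]
  split_ifs <;> rfl

theorem comp_swap_succ_succ {l : ℕ} (a : Fin (l + 1) → ℤ) (k m : Fin l) :
    (a ∘ Equiv.swap k.succ m.succ) 0 = a 0 ∧
      Fin.tail (a ∘ Equiv.swap k.succ m.succ) = Fin.tail a ∘ Equiv.swap k m := by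
  refine ⟨by simp [Equiv.swap_apply_def, (Fin.succ_ne_zero _).symm], funext fun s => ?_⟩
  simp only [Fin.tail, Function.comp_apply, Equiv.swap_apply_def, Fin.succ_inj]
  split_ifs <;> rfl

theorem sum_sum_ite_lt_succ {M : Type*} [AddCommMonoid M] {l : ℕ}
    (f : Fin (l + 1) → Fin (l + 1) → M) :
    (∑ k, ∑ m, if k < m then f k m else 0) =
      ∑ m : Fin l, f 0 m.succ + ∑ k : Fin l, ∑ m : Fin l, if k < m then f k.succ m.succ else 0 := by
  rw [Fin.sum_univ_succ]
  congr 1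
  · rw [Fin.sum_univ_succ, if_neg (lt_irrefl _), zero_add]
    exact Finset.sum_congr rfl fun m _ => if_pos m.succ_pos
  · refine Finset.sum_congr rfl fun k _ => ?_
    rw [Fin.sum_univ_succ, if_neg (Fin.not_lt_zero _), zero_add]
    simp only [Fin.succ_lt_succ_iff]

/-- Induction on `l` through `casimir_unitOp`. Each block unit it produces is moved on to the right:
meeting a later factor it exchanges two of the indices, and reaching the end it acts on `w`. Each of
the `l` factors contributes `c` once. The two actions on `w` have opposite signs, which passing to
the dual representation on the first block evens out. -/
theorem casimir_lower {l : ℕ} {a b : Fin l → ℤ} (ha : ∀ k, right (a k)) (hb : ∀ k, left (b k))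
    {R : Finset ℤ} (haR : ∀ k, a k ∈ R) (hbR : ∀ k, b k ∈ R) {w : Ind χ c}
    (hw : ∀ i j, right i → left j → unitOp χ c j i w = 0) :
    casimir χ c R (lower χ c l a b w) = ((l : ℂ) * c) • lower χ c l a b w -
      ((∑ k, ∑ m, if k < m then lower χ c l (a ∘ Equiv.swap k m) b w else 0) +
        ∑ k, ∑ i ∈ R with right i, lower χ c l (Function.update a k i) b (unitOp χ c (a k) i w)) -
      ((∑ k, ∑ m, if k < m then lower χ c l a (b ∘ Equiv.swap k m) w else 0) -
        ∑ k, ∑ j ∈ R with left j, lower χ c l a (Function.update b k j) (unitOp χ c j (b k) w)) := by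
  induction l with
  | zero =>
    rw [casimir_apply]
    have : ∀ i ∈ R.filter right, ∀ j ∈ R.filter left,
        unitOp χ c i j (unitOp χ c j i (lower χ c 0 a b w)) = 0 := fun i hi j hj => by
      change unitOp χ c i j (unitOp χ c j i w) = 0
      rw [hw i j (Finset.mem_filter.1 hi).2 (Finset.mem_filter.1 hj).2, map_zero]
    rw [Finset.sum_eq_zero fun i hi => Finset.sum_eq_zero (this i hi)]
    simp
  | succ l ih =>
    have ha0 := ha 0
    have hb0 := hb 0
    rw [lower_succ, casimir_unitOp ha0 hb0 (haR 0) (hbR 0),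
      ih (a := Fin.tail a) (b := Fin.tail b) (fun k => ha k.succ) (fun k => hb k.succ) (fun k => haR k.succ) (fun k => hbR k.succ)]
    -- Moving `E_{j b₀}` through the remaining factors replaces an index `b_m = j` by `b₀`, while
    -- `j` becomes the leading index; only `j = b_m` survives in the sum, which is the exchange of
    -- `b₀` and `b_m`.
    have e1 : ∑ j ∈ R with left j, unitOp χ c (a 0) j
        (unitOp χ c j (b 0) (lower χ c l (Fin.tail a) (Fin.tail b) w)) =
        ∑ j ∈ R with left j, lower χ c (l + 1) a (Function.update b 0 j) (unitOp χ c j (b 0) w) -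
          ∑ m : Fin l, lower χ c (l + 1) a (b ∘ Equiv.swap 0 m.succ) w := by
      rw [Finset.sum_congr rfl fun j _ => by
        rw [unitOp_left_lowerProd hb0 (a := Fin.tail a) _ fun k => ha k.succ, map_sub,
          map_sum]]
      rw [Finset.sum_sub_distrib, Finset.sum_comm]
      congr 1
      · refine Finset.sum_congr rfl fun m _ => ?_
        rw [lower_succ, (comp_swap_zero_succ b m).1, (comp_swap_zero_succ b m).2,
          Finset.sum_eq_single (b m.succ)]
        · rw [if_pos (show Fin.tail b m = b m.succ from rfl)]
        · intro j _ hj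
          rw [if_neg (show ¬ Fin.tail b m = j from Ne.symm hj), map_zero]
        · intro h
          exact (h (Finset.mem_filter.2 ⟨hbR _, hb _⟩)).elim
    have e2 : ∑ i ∈ R with right i, unitOp χ c i (b 0)
        (unitOp χ c (a 0) i (lower χ c l (Fin.tail a) (Fin.tail b) w)) =
        ∑ i ∈ R with right i, lower χ c (l + 1) (Function.update a 0 i) b (unitOp χ c (a 0) i w) +
          ∑ m : Fin l, lower χ c (l + 1) (a ∘ Equiv.swap 0 m.succ) b w := by
      rw [Finset.sum_congr rfl fun i _ => by
        rw [unitOp_right_lowerProd ha0 (b := Fin.tail b) _ fun k => hb k.succ, map_add,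
          map_sum]]
      rw [Finset.sum_add_distrib, Finset.sum_comm]
      congr 1
      · refine Finset.sum_congr rfl fun m _ => ?_
        rw [lower_succ, (comp_swap_zero_succ a m).1, (comp_swap_zero_succ a m).2,
          Finset.sum_eq_single (a m.succ)]
        · rw [if_pos (show a m.succ = Fin.tail a m from rfl)]
        · intro j _ hj
          rw [if_neg (show ¬ j = Fin.tail a m from hj), map_zero]
        · intro h
          exact (h (Finset.mem_filter.2 ⟨haR _, ha _⟩)).elim
    have hite : ∀ (P : Prop) [Decidable P] (v : Ind χ c),
        unitOp χ c (a 0) (b 0) (if P then v else 0) = if P then unitOp χ c (a 0) (b 0) v else 0 :=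
      fun P _ v => by split_ifs <;> simp
    rw [e1, e2, sum_sum_ite_lt_succ, sum_sum_ite_lt_succ, Fin.sum_univ_succ (n := l)
      (f := fun k => ∑ i ∈ R with right i, _), Fin.sum_univ_succ (n := l)
      (f := fun k => ∑ i ∈ R with left i, _)]
    simp only [map_sub, map_add, map_sum, hite, map_smul, lower_succ, comp_swap_succ_succ,
      tail_update_succ, Function.update_of_ne (Fin.succ_ne_zero _).symm]
    rw [Nat.cast_succ, add_mul, one_mul, add_smul]
    change _ = _ - (_ + (_ + ∑ k : Fin l, ∑ i ∈ R with right i, unitOp χ c (a 0) (b 0)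
      (lower χ c l (Function.update (Fin.tail a) k i) (Fin.tail b)
        (unitOp χ c (Fin.tail a k) i w)))) - (_ - (_ + ∑ k : Fin l, ∑ j ∈ R with left j,
          unitOp χ c (a 0) (b 0) (lower χ c l (Fin.tail a) (Function.update (Fin.tail b) k j)
            (unitOp χ c j (Fin.tail b k) w))))
    abel

end Operators

/-! ### Sums of transpositions -/

section Transpositions

/-- The group algebra of the permutations of the tensor factors acting on a tensor power. -/
def permuteAlg (κ : Type*) : MonoidAlgebra ℂ (Equiv.Perm κ) →ₐ[ℂ] Module.End ℂ (Tens κ) :=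
  MonoidAlgebra.lift ℂ _ _
    -- Precomposition reverses products, so the inverse is needed for multiplicativity.
    { toFun := fun σ => permute σ⁻¹
      map_one' := tens_ext fun g => by rw [permute_single]; rfl
      map_mul' := fun σ τ => tens_ext fun g => by
        rw [Module.End.mul_apply, permute_single, permute_single, permute_single, mul_inv_rev]
        rfl }

theorem permute_mem_range {κ : Type*} (σ : Equiv.Perm κ) : permute σ ∈ (permuteAlg κ).range := by
  refine ⟨MonoidAlgebra.single σ⁻¹ 1, ?_⟩
  change MonoidAlgebra.lift ℂ _ _ _ _ = _
  rw [MonoidAlgebra.lift_single, one_smul]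
  exact congrArg permute (inv_inv σ)

/-- The sum of all transpositions of tensor factors of which at least one is among the
first `l`. -/
def transpositions (l : ℕ) (κ : Type*) [DecidableEq κ] [Fintype κ] :
    Module.End ℂ (Tens (Fin l ⊕ κ)) :=
  (∑ k : Fin l, ∑ m : Fin l, if k < m then permute (Equiv.swap (Sum.inl k) (Sum.inl m)) else 0) +
    ∑ k : Fin l, ∑ m : κ, permute (Equiv.swap (Sum.inl k) (Sum.inr m))

variable {κ κ' : Type*} [DecidableEq κ] [Fintype κ] [DecidableEq κ'] [Fintype κ']

theorem transpositions_mem_range (l : ℕ) : transpositions l κ ∈ (permuteAlg (Fin l ⊕ κ)).range := by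
  refine add_mem (sum_mem fun k _ => sum_mem fun m _ => ?_)
    (sum_mem fun k _ => sum_mem fun m _ => permute_mem_range _)
  split_ifs
  · exact permute_mem_range _
  · exact zero_mem _

/-- Written out in indices, the transpositions give the same terms as the block units in
`casimir_lower`: exchanges of two entries of `a`, and exchanges of an entry of `a` with an index `i`
of `x`, the latter being the action of `E_{a_k i}` on `x`. -/
theorem transpositions_prepend {l : ℕ} (a : Fin l → ℤ) (R : Finset ℤ) {x : Tens κ}
    (hx : x ∈ Finsupp.supported ℂ ℂ {g : κ → ℤ | ∀ m, g m ∈ R}) :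
    transpositions l κ (prepend a x) =
      (∑ k, ∑ m, if k < m then prepend (a ∘ Equiv.swap k m) x else 0) +
        ∑ k, ∑ i ∈ R, prepend (Function.update a k i) (derivation κ (unitEnd (a k) i) x) := by
  rw [transpositions, LinearMap.add_apply, LinearMap.sum_apply, LinearMap.sum_apply]
  congr 1
  · refine Finset.sum_congr rfl fun k _ => ?_
    rw [LinearMap.sum_apply]
    refine Finset.sum_congr rfl fun m _ => ?_
    split_ifs
    · exact permute_swap_inl_inl a k m x
    · rfl
  · refine Finset.sum_congr rfl fun k _ => ?_
    rw [LinearMap.sum_apply]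
    exact sum_permute_swap_inl_inr a k R hx

/-- The sum of the transpositions on both factors of a tensor product of tensor powers. -/
def transpositions₂ (l : ℕ) (κ κ' : Type*) [DecidableEq κ] [Fintype κ] [DecidableEq κ']
    [Fintype κ'] : Module.End ℂ (Tens (Fin l ⊕ κ) ⊗[ℂ] Tens (Fin l ⊕ κ')) :=
  LinearMap.rTensor _ (transpositions l κ) + LinearMap.lTensor _ (transpositions l κ')

/-- The operator is the image of an element of a tensor product of two group algebras of finite
groups; this algebra is finite-dimensional, so the element is integral over `ℂ`. The polynomial does
not depend on `c`. -/
theorem exists_monic_aeval_transpositions₂ (l : ℕ) :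
    ∃ p : Polynomial ℂ, p.Monic ∧ Polynomial.aeval (transpositions₂ l κ κ') p = 0 := by
  obtain ⟨x, hx⟩ := transpositions_mem_range (κ := κ) l
  obtain ⟨y, hy⟩ := transpositions_mem_range (κ := κ') l
  let F : MonoidAlgebra ℂ (Equiv.Perm (Fin l ⊕ κ)) ⊗[ℂ] MonoidAlgebra ℂ (Equiv.Perm (Fin l ⊕ κ'))
      →ₐ[ℂ] Module.End ℂ (Tens (Fin l ⊕ κ) ⊗[ℂ] Tens (Fin l ⊕ κ')) :=
    (Module.endTensorEndAlgHom (R := ℂ) (S := ℂ) (A := ℂ) (M := Tens (Fin l ⊕ κ))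
      (N := Tens (Fin l ⊕ κ'))).comp
      (Algebra.TensorProduct.map (permuteAlg _) (permuteAlg _))
  obtain ⟨p, hp, hp0⟩ := Algebra.IsIntegral.isIntegral (R := ℂ) (x ⊗ₜ[ℂ] 1 + 1 ⊗ₜ[ℂ] y :
    MonoidAlgebra ℂ (Equiv.Perm (Fin l ⊕ κ)) ⊗[ℂ] MonoidAlgebra ℂ (Equiv.Perm (Fin l ⊕ κ')))
  refine ⟨p, hp, ?_⟩
  have hF : F (x ⊗ₜ[ℂ] 1 + 1 ⊗ₜ[ℂ] y) = transpositions₂ l κ κ' := by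
    rw [map_add]
    have h1 : F (x ⊗ₜ[ℂ] 1) = LinearMap.rTensor _ (transpositions l κ) := by
      change Module.endTensorEndAlgHom (R := ℂ) (S := ℂ) (A := ℂ) (permuteAlg _ x ⊗ₜ[ℂ] permuteAlg _ 1) = _
      rw [Module.endTensorEndAlgHom_apply, map_one]
      exact congrArg (fun f => TensorProduct.map f LinearMap.id) hx
    have h2 : F (1 ⊗ₜ[ℂ] y) = LinearMap.lTensor _ (transpositions l κ') := by
      change Module.endTensorEndAlgHom (R := ℂ) (S := ℂ) (A := ℂ) (permuteAlg _ 1 ⊗ₜ[ℂ] permuteAlg _ y) = _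
      rw [Module.endTensorEndAlgHom_apply, map_one]
      exact congrArg (fun f => TensorProduct.map LinearMap.id f) hy
    rw [h1, h2]
    rfl
  rw [← hF, Polynomial.aeval_algHom_apply]
  have : Polynomial.aeval (x ⊗ₜ[ℂ] 1 + 1 ⊗ₜ[ℂ] y) p = 0 := hp0
  rw [this, map_zero]

end Transpositions

/-! ### Realization of the levels in tensor powers -/

section Realize

variable {χ : ℤ →₀ ℂ} {c : ℂ}

theorem compress_unitMat_eq_zero {p : ℤ → Prop} [DecidablePred p] {i j : ℤ} (h : ¬ (p i ∧ p j)) :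
    compress p (unitMat i j) = 0 := by
  refine Subtype.ext (mat_ext fun k l => ?_)
  rw [entry_compress, entry_unitMat]
  by_cases h1 : k = i ∧ l = j
  · rw [h1.1, h1.2, if_neg h]
    rfl
  · rw [if_neg h1, ite_self]
    rfl

theorem leviRep_unitHat {i j : ℤ} (h : unitHat i j ∈ parabolic)
    (v : Irr left χ ⊗[ℂ] Irr right χ) : leviRep χ c ⟨unitHat i j, h⟩ v =
      LinearMap.rTensor (Irr right χ) (act _ _ (compress left (unitMat i j))) v +
        LinearMap.lTensor (Irr left χ) (act _ _ (compress right (unitMat i j))) v := by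
  change _ + _ + (c * cen (unitHat i j)) • v = _
  have : cen (unitHat i j) = 0 := rfl
  rw [this, mul_zero, zero_smul, add_zero]
  rfl

theorem unitHat_mem_parabolic {i j : ℤ} (h : left i ∨ right j) : unitHat i j ∈ parabolic := by
  intro k l hk hl
  change entry (unitMat i j).1 k l = 0
  rw [entry_unitMat, if_neg]
  rintro ⟨rfl, rfl⟩
  rcases h with h | h <;> omega

theorem unitOp_base {i j : ℤ} (h : left i ∨ right j) (v : Irr left χ ⊗[ℂ] Irr right χ) :
    unitOp χ c i j (Ind.baseLin χ c v) = Ind.baseLin χ c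
      (LinearMap.rTensor (Irr right χ) (act _ _ (compress left (unitMat i j))) v +
        LinearMap.lTensor (Irr left χ) (act _ _ (compress right (unitMat i j))) v) := by
  rw [← leviRep_unitHat (unitHat_mem_parabolic h)]
  exact Ind.parabolic_smul_base ⟨_, unitHat_mem_parabolic h⟩ v

theorem unitOp_upper_base {i j : ℤ} (hi : right i) (hj : left j)
    (v : Irr left χ ⊗[ℂ] Irr right χ) : unitOp χ c j i (Ind.baseLin χ c v) = 0 := by
  rw [unitOp_base (Or.inl hj), compress_unitMat_eq_zero (by omega),
    compress_unitMat_eq_zero (by omega), map_zero, map_zero]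
  simp

theorem natural_unitMat {i i' : ℤ} (hi : right i) (hi' : right i') :
    natural right (compress right (unitMat i i')) = unitEnd i i' := end_ext fun k l => by
  change entry (compress right (unitMat i i')).1.1 k l = _
  rw [entry_compress, entry_unitMat, entry_unitEnd]
  by_cases hkl : k = i ∧ l = i'
  · rw [hkl.1, hkl.2, if_pos ⟨hi, hi'⟩]
  · rw [if_neg hkl, ite_self]

/-- This sign turns the difference in the last line of `casimir_lower` into a sum, so that both
blocks contribute transpositions with the same sign. -/
theorem derivation_conatural_unitMat {κ : Type*} [DecidableEq κ] [Fintype κ] {j j' : ℤ}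
    (hj : left j) (hj' : left j') (x : Tens κ) :
    derivation κ (conatural left (compress left (unitMat j j'))) x =
      -derivation κ (unitEnd j' j) x := by
  have h' : conatural left (compress left (unitMat j j')) = -unitEnd j' j := end_ext fun k l => by
    rw [entry_conatural, entry_compress, entry_unitMat]
    change _ = -entry (unitEnd j' j) k l
    rw [entry_unitEnd]
    by_cases hkl : l = j ∧ k = j'
    · rw [hkl.1, hkl.2, if_pos ⟨hj, hj'⟩]
      simp
    · rw [if_neg hkl, ite_self, if_neg fun h => hkl ⟨h.2, h.1⟩]
  rw [h']
  exact LinearMap.congr_fun (map_neg (derivation κ).toLinearMap _) x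

variable (D₁ : Model left χ (conatural left)) (D₂ : Model right χ (natural right))

theorem unitOp_right_base {i i' : ℤ} (hi : right i) (hi' : right i') (u : Irr left χ)
    {x : Tens D₂.κ} (hx : x ∈ D₂.S) :
    unitOp χ c i i' (Ind.baseLin χ c (u ⊗ₜ D₂.π x)) =
      Ind.baseLin χ c (u ⊗ₜ D₂.π (derivation D₂.κ (unitEnd i i') x)) := by
  rw [unitOp_base (Or.inr hi'), compress_unitMat_eq_zero (p := left) (by omega), map_zero,
    LinearMap.rTensor_zero, LinearMap.zero_apply, zero_add, LinearMap.lTensor_tmul]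
  have h := D₂.equivariant (compress right (unitMat i i')) x hx
  rw [natural_unitMat hi hi'] at h
  rw [h]
  rfl

theorem unitOp_left_base {j j' : ℤ} (hj : left j) (hj' : left j') (u : Irr right χ)
    {x : Tens D₁.κ} (hx : x ∈ D₁.S) :
    unitOp χ c j j' (Ind.baseLin χ c (D₁.π x ⊗ₜ u)) =
      -Ind.baseLin χ c (D₁.π (derivation D₁.κ (unitEnd j' j) x) ⊗ₜ u) := by
  rw [unitOp_base (Or.inl hj), compress_unitMat_eq_zero (p := right) (by omega), map_zero,
    LinearMap.lTensor_zero, LinearMap.zero_apply, add_zero, LinearMap.rTensor_tmul]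
  have h := D₁.equivariant (compress left (unitMat j j')) x hx
  rw [derivation_conatural_unitMat hj hj', map_neg] at h
  rw [← map_neg, ← TensorProduct.neg_tmul, h]
  rfl

theorem natural_stable {i i' : ℤ} (hi : right i) (hi' : right i') {x : Tens D₂.κ}
    (hx : x ∈ D₂.S) : derivation D₂.κ (unitEnd i i') x ∈ D₂.S := by
  rw [← natural_unitMat hi hi']
  exact D₂.stable _ x hx

theorem conatural_stable {j j' : ℤ} (hj : left j) (hj' : left j') {x : Tens D₁.κ}
    (hx : x ∈ D₁.S) : derivation D₁.κ (unitEnd j' j) x ∈ D₁.S := by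
  have h := D₁.stable (compress left (unitMat j j')) x hx
  rw [derivation_conatural_unitMat hj hj'] at h
  exact neg_mem_iff.1 h

variable (c) in
/-- The map from tensors to the level `l` of the induced module. -/
def realize (l : ℕ) : Tens (Fin l ⊕ D₂.κ) ⊗[ℂ] Tens (Fin l ⊕ D₁.κ) →ₗ[ℂ] Ind χ c :=
  TensorProduct.lift (Finsupp.linearCombination ℂ fun α : Fin l ⊕ D₂.κ → ℤ =>
    Finsupp.linearCombination ℂ fun β : Fin l ⊕ D₁.κ → ℤ =>
      lower χ c l (α ∘ Sum.inl) (β ∘ Sum.inl) (Ind.baseLin χ c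
        (D₁.π (Finsupp.single (β ∘ Sum.inr) 1) ⊗ₜ D₂.π (Finsupp.single (α ∘ Sum.inr) 1))))

theorem realize_tmul {l : ℕ} (a b : Fin l → ℤ) (x : Tens D₂.κ) (y : Tens D₁.κ) :
    realize c D₁ D₂ l (prepend a x ⊗ₜ prepend b y) =
      lower χ c l a b (Ind.baseLin χ c (D₁.π y ⊗ₜ D₂.π x)) := by
  have h : (realize c D₁ D₂ l).comp (TensorProduct.map (prepend a) (prepend b)) =
      (lower χ c l a b ∘ₗ Ind.baseLin χ c) ∘ₗ
        (TensorProduct.map D₁.π D₂.π ∘ₗ (TensorProduct.comm ℂ _ _).toLinearMap) := by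
    refine TensorProduct.ext (tens_ext fun g => tens_ext fun f => ?_)
    change realize c D₁ D₂ l (prepend a _ ⊗ₜ prepend b _) =
      lower χ c l a b (Ind.baseLin χ c (D₁.π _ ⊗ₜ D₂.π _))
    rw [prepend_single, prepend_single, realize, TensorProduct.lift.tmul,
      Finsupp.linearCombination_single, one_smul, Finsupp.linearCombination_single, one_smul]
    rfl
  exact LinearMap.congr_fun h (x ⊗ₜ y)

/-- The space of tensors which represent elements of the level `l`. -/
def tensLevel (l : ℕ) : Submodule ℂ (Tens (Fin l ⊕ D₂.κ) ⊗[ℂ] Tens (Fin l ⊕ D₁.κ)) :=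
  Submodule.span ℂ {t | ∃ (a b : Fin l → ℤ) (x : Tens D₂.κ) (y : Tens D₁.κ),
    (∀ k, right (a k)) ∧ (∀ k, left (b k)) ∧ x ∈ D₂.S ∧ y ∈ D₁.S ∧
      t = prepend a x ⊗ₜ prepend b y}

theorem exists_finset_supported {κ : Type*} [Fintype κ] (x : Tens κ) :
    ∃ R : Finset ℤ, ∀ g ∈ x.support, ∀ m, g m ∈ R := by
  classical
  exact ⟨x.support.biUnion fun g => Finset.univ.image g, fun g hg m => Finset.mem_biUnion.2
    ⟨g, hg, Finset.mem_image_of_mem g (Finset.mem_univ m)⟩⟩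

variable {D₁ D₂}

theorem prepend_tmul_mem_tensLevel {l : ℕ} {a b : Fin l → ℤ} {x : Tens D₂.κ} {y : Tens D₁.κ}
    (ha : ∀ k, right (a k)) (hb : ∀ k, left (b k)) (hx : x ∈ D₂.S) (hy : y ∈ D₁.S) :
    prepend a x ⊗ₜ prepend b y ∈ tensLevel D₁ D₂ l :=
  Submodule.subset_span ⟨a, b, x, y, ha, hb, hx, hy, rfl⟩

theorem update_mem {l : ℕ} {p : ℤ → Prop} {a : Fin l → ℤ} (ha : ∀ k, p (a k)) (k : Fin l) {i : ℤ}
    (hi : p i) : ∀ k', p (Function.update a k i k') := fun k' => by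
  by_cases h : k' = k
  · subst h
    rwa [Function.update_self]
  · rw [Function.update_of_ne h]
    exact ha k'

theorem mem_supported_filter {κ : Type*} {p : ℤ → Prop} [DecidablePred p] {x : Tens κ}
    {R : Finset ℤ} (hR : ∀ g ∈ x.support, ∀ m, g m ∈ R)
    (hp : x ∈ Finsupp.supported ℂ ℂ {g : κ → ℤ | ∀ m, g m ∈ {i | p i}}) :
    x ∈ Finsupp.supported ℂ ℂ {g : κ → ℤ | ∀ m, g m ∈ R.filter p} :=
  fun g hg m => Finset.mem_filter.2 ⟨hR g hg m, hp hg m⟩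

/-- The support of `x` (resp. `y`) involves only indices of its own block, so only units inside that
block act; these preserve the subrepresentations of the two models. -/
theorem transpositions₂_mem_tensLevel {l : ℕ}
    {t : Tens (Fin l ⊕ D₂.κ) ⊗[ℂ] Tens (Fin l ⊕ D₁.κ)} (ht : t ∈ tensLevel D₁ D₂ l) :
    transpositions₂ l D₂.κ D₁.κ t ∈ tensLevel D₁ D₂ l := by
  induction ht using Submodule.span_induction with
  | zero => rw [map_zero]; exact zero_mem _
  | add s t _ _ hs ht => rw [map_add]; exact add_mem hs ht
  | smul r t _ ht => rw [map_smul]; exact Submodule.smul_mem _ r ht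
  | mem t ht =>
    obtain ⟨a, b, x, y, ha, hb, hx, hy, rfl⟩ := ht
    obtain ⟨R, hR⟩ := exists_finset_supported x
    obtain ⟨T, hT⟩ := exists_finset_supported y
    rw [transpositions₂, LinearMap.add_apply, LinearMap.rTensor_tmul, LinearMap.lTensor_tmul,
      transpositions_prepend a _ (mem_supported_filter hR (D₂.supported hx)),
      transpositions_prepend b _ (mem_supported_filter hT (D₁.supported hy))]
    simp only [TensorProduct.add_tmul, TensorProduct.tmul_add, TensorProduct.sum_tmul,
      TensorProduct.tmul_sum]
    refine add_mem (add_mem ?_ ?_) (add_mem ?_ ?_)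
    · refine sum_mem fun k _ => sum_mem fun m _ => ?_
      split_ifs
      · exact prepend_tmul_mem_tensLevel (fun k => ha _) hb hx hy
      · rw [TensorProduct.zero_tmul]; exact zero_mem _
    · refine sum_mem fun k _ => sum_mem fun i hi => ?_
      have hi := (Finset.mem_filter.1 hi).2
      exact prepend_tmul_mem_tensLevel (update_mem ha k hi) hb (natural_stable D₂ (ha k) hi hx) hy
    · refine sum_mem fun k _ => sum_mem fun m _ => ?_
      split_ifs
      · exact prepend_tmul_mem_tensLevel ha (fun k => hb _) hx hy
      · rw [TensorProduct.tmul_zero]; exact zero_mem _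
    · refine sum_mem fun k _ => sum_mem fun j hj => ?_
      have hj := (Finset.mem_filter.1 hj).2
      exact prepend_tmul_mem_tensLevel ha (update_mem hb k hj) hx
        (conatural_stable D₁ hj (hb k) hy)

/-- Once `R` contains all indices occurring in `t`, enlarging it adds nothing, and `casimir_lower`
matches `transpositions_prepend` term by term. -/
theorem casimir_realize {l : ℕ} {t : Tens (Fin l ⊕ D₂.κ) ⊗[ℂ] Tens (Fin l ⊕ D₁.κ)}
    (ht : t ∈ tensLevel D₁ D₂ l) : ∃ R₀ : Finset ℤ, ∀ R, R₀ ⊆ R →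
      casimir χ c R (realize c D₁ D₂ l t) = ((l : ℂ) * c) • realize c D₁ D₂ l t -
        realize c D₁ D₂ l (transpositions₂ l D₂.κ D₁.κ t) := by
  classical
  induction ht using Submodule.span_induction with
  | zero => exact ⟨∅, fun R _ => by simp⟩
  | add s t _ _ hs ht =>
    obtain ⟨R, hR⟩ := hs
    obtain ⟨T, hT⟩ := ht
    refine ⟨R ∪ T, fun U hU => ?_⟩
    simp only [map_add, hR U (Finset.union_subset_left hU), hT U (Finset.union_subset_right hU),
      smul_add]
    abel
  | smul r t _ ht =>
    obtain ⟨R, hR⟩ := ht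
    refine ⟨R, fun U hU => ?_⟩
    simp only [map_smul, hR U hU, smul_sub]
    rw [smul_comm]
  | mem t ht =>
    obtain ⟨a, b, x, y, ha, hb, hx, hy, rfl⟩ := ht
    obtain ⟨T₁, hT₁⟩ := exists_finset_supported x
    obtain ⟨T₂, hT₂⟩ := exists_finset_supported y
    refine ⟨(T₁ ∪ T₂) ∪ (Finset.univ.image a ∪ Finset.univ.image b), fun R hR => ?_⟩
    have haR : ∀ k, a k ∈ R := fun k => hR (Finset.mem_union_right _ (Finset.mem_union_left _
      (Finset.mem_image_of_mem a (Finset.mem_univ k))))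
    have hbR : ∀ k, b k ∈ R := fun k => hR (Finset.mem_union_right _ (Finset.mem_union_right _
      (Finset.mem_image_of_mem b (Finset.mem_univ k))))
    have hxR : ∀ g ∈ x.support, ∀ m, g m ∈ R := fun g hg m =>
      hR (Finset.mem_union_left _ (Finset.mem_union_left _ (hT₁ g hg m)))
    have hyR : ∀ g ∈ y.support, ∀ m, g m ∈ R := fun g hg m =>
      hR (Finset.mem_union_left _ (Finset.mem_union_right _ (hT₂ g hg m)))
    have hite : ∀ (P : Prop) [Decidable P] (s : Tens (Fin l ⊕ D₂.κ)) (s' : Tens (Fin l ⊕ D₁.κ)),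
        realize c D₁ D₂ l ((if P then s else 0) ⊗ₜ s') =
          if P then realize c D₁ D₂ l (s ⊗ₜ s') else 0 := fun P _ s s' => by
      split_ifs
      · rfl
      · rw [TensorProduct.zero_tmul, map_zero]
    have hite' : ∀ (P : Prop) [Decidable P] (s : Tens (Fin l ⊕ D₂.κ)) (s' : Tens (Fin l ⊕ D₁.κ)),
        realize c D₁ D₂ l (s ⊗ₜ (if P then s' else 0)) =
          if P then realize c D₁ D₂ l (s ⊗ₜ s') else 0 := fun P _ s s' => by
      split_ifs
      · rfl
      · rw [TensorProduct.tmul_zero, map_zero]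
    rw [transpositions₂, LinearMap.add_apply, LinearMap.rTensor_tmul, LinearMap.lTensor_tmul,
      transpositions_prepend a _ (mem_supported_filter hxR (D₂.supported hx)),
      transpositions_prepend b _ (mem_supported_filter hyR (D₁.supported hy)), realize_tmul,
      casimir_lower ha hb haR hbR fun i j hi hj => unitOp_upper_base hi hj _]
    simp only [TensorProduct.add_tmul, TensorProduct.tmul_add, TensorProduct.sum_tmul,
      TensorProduct.tmul_sum, map_add, map_sum, hite, hite', realize_tmul]
    have e1 : ∀ k, ∀ i ∈ R.filter right, lower χ c l (Function.update a k i) b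
        (unitOp χ c (a k) i (Ind.baseLin χ c (D₁.π y ⊗ₜ D₂.π x))) =
        lower χ c l (Function.update a k i) b (Ind.baseLin χ c
          (D₁.π y ⊗ₜ D₂.π (derivation D₂.κ (unitEnd (a k) i) x))) := fun k i hi => by
      rw [unitOp_right_base D₂ (ha k) (Finset.mem_filter.1 hi).2 _ hx]
    have e2 : ∀ k, ∀ j ∈ R.filter left, lower χ c l a (Function.update b k j)
        (unitOp χ c j (b k) (Ind.baseLin χ c (D₁.π y ⊗ₜ D₂.π x))) =
        -lower χ c l a (Function.update b k j) (Ind.baseLin χ c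
          (D₁.π (derivation D₁.κ (unitEnd (b k) j) y) ⊗ₜ D₂.π x)) := fun k j hj => by
      rw [unitOp_left_base D₁ (Finset.mem_filter.1 hj).2 (hb k) _ hy, map_neg]
    rw [Finset.sum_congr rfl fun k _ => Finset.sum_congr rfl (e1 k),
      Finset.sum_congr rfl fun k _ => Finset.sum_congr rfl (e2 k)]
    simp only [Finset.sum_neg_distrib]
    abel

/-- A vector of level `l` in the image of the tensors which is annihilated by all `E_{ji}` with
`i > 0 ≥ j` vanishes unless `l c` is a root of a certain polynomial. -/
theorem realize_eq_zero {l : ℕ} {p : Polynomial ℂ}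
    (hp : Polynomial.aeval (transpositions₂ l D₂.κ D₁.κ) p = 0) (hc : p.eval ((l : ℂ) * c) ≠ 0)
    {t : Tens (Fin l ⊕ D₂.κ) ⊗[ℂ] Tens (Fin l ⊕ D₁.κ)} (ht : t ∈ tensLevel D₁ D₂ l)
    (hinv : ∀ i j, right i → left j → unitOp χ c j i (realize c D₁ D₂ l t) = 0) :
    realize c D₁ D₂ l t = 0 := by
  let S : Submodule ℂ (Tens (Fin l ⊕ D₂.κ) ⊗[ℂ] Tens (Fin l ⊕ D₁.κ)) :=
    tensLevel D₁ D₂ l ⊓ ⨅ (i : {i // right i}) (j : {j // left j}),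
      LinearMap.ker (unitOp χ c j i ∘ₗ realize c D₁ D₂ l)
  have hS : ∀ t, t ∈ S ↔ t ∈ tensLevel D₁ D₂ l ∧
      ∀ i j, right i → left j → unitOp χ c j i (realize c D₁ D₂ l t) = 0 := by
    intro t
    simp only [S, Submodule.mem_inf, Submodule.mem_iInf, Subtype.forall, LinearMap.mem_ker,
      LinearMap.comp_apply]
    exact and_congr_right fun _ => ⟨fun h i j hi hj => h i hi j hj, fun h i hi j hj => h i j hi hj⟩
  -- The Casimir-type operator kills the image of `t`, so the transpositions must act on that image
  -- by `l c`.
  have heig : ∀ t ∈ S, realize c D₁ D₂ l (transpositions₂ l D₂.κ D₁.κ t) =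
      ((l : ℂ) * c) • realize c D₁ D₂ l t := by
    intro t ht
    obtain ⟨ht, hinv⟩ := (hS t).1 ht
    obtain ⟨R, hR⟩ := casimir_realize (c := c) ht
    have h := hR R subset_rfl
    rw [casimir_apply, Finset.sum_eq_zero fun i hi => Finset.sum_eq_zero fun j hj => by
      rw [hinv i j (Finset.mem_filter.1 hi).2 (Finset.mem_filter.1 hj).2, map_zero]] at h
    exact (sub_eq_zero.1 h.symm).symm
  -- By `heig` the subspace `S` is stable under the transpositions, so `p` can be applied on both
  -- sides: `0 = p(l c)` times the image of `t`.
  have h := (aeval_intertwine (S := S) (π := realize c D₁ D₂ l)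
    (H := transpositions₂ l D₂.κ D₁.κ) (h := ((l : ℂ) * c) • 1) (fun t (ht : t ∈ S) => by
      refine (hS _).2 ⟨transpositions₂_mem_tensLevel ((hS t).1 ht).1, fun i j hi hj => ?_⟩
      rw [heig t ht, map_smul, ((hS t).1 ht).2 i j hi hj, smul_zero]) heig p
      ((hS t).2 ⟨ht, hinv⟩)).2
  rw [hp, LinearMap.zero_apply, map_zero, aeval_apply_of_eigen (c := (l : ℂ) * c) rfl] at h
  exact (smul_eq_zero.1 h.symm).resolve_left hc

end Realize

/-! ### Vectors annihilated by `a₊` -/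

section Levels

variable {χ : ℤ →₀ ℂ} {c : ℂ}

/-- With finitely many nonzero diagonals, `i > 0 ≥ j` and `i - j ≤ K` leave only finitely many
places, so elements of `a₋` are finite combinations of matrix units. -/
theorem lower_eq_sum {y : GlHat} (hy : y ∈ aMinus) : ∃ R : Finset ℤ,
    y = ∑ i ∈ R with right i, ∑ j ∈ R with left j, entry (mat y).1 i j • unitHat i j := by
  obtain ⟨h0, hy⟩ := hy
  obtain ⟨K, hK⟩ := (mat y).2
  refine ⟨Finset.Icc (-K) K, ?_⟩
  let matLin : GlHat →ₗ[ℂ] Mat := ⟨⟨mat, mat_add⟩, mat_smul⟩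
  let cenLin : GlHat →ₗ[ℂ] ℂ := ⟨⟨cen, cen_add⟩, cen_smul⟩
  have hcen : ∀ i j, cenLin (unitHat i j) = 0 := fun _ _ => rfl
  refine glHat_ext (mat_ext fun k l => ?_) ?_
  · let entryLin : GlHat →ₗ[ℂ] ℂ :=
      ⟨⟨fun X => entry (mat X).1 k l, fun _ _ => rfl⟩, fun _ _ => rfl⟩
    have hent : ∀ i j, entryLin (unitHat i j) = if k = i ∧ l = j then 1 else 0 :=
      fun i j => entry_unitMat i j k l
    change _ = entryLin (∑ i ∈ Finset.Icc (-K) K with right i,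
      ∑ j ∈ Finset.Icc (-K) K with left j, entry (mat y).1 i j • unitHat i j)
    simp only [map_sum, map_smul, hent, smul_eq_mul, mul_ite, mul_one, mul_zero, ite_and]
    by_cases hkl : entry (mat y).1 k l = 0
    · rw [hkl]
      symm
      refine Finset.sum_eq_zero fun i _ => Finset.sum_eq_zero fun j _ => ?_
      split_ifs with h1 h2
      · rw [← h1, ← h2, hkl]
      · rfl
      · rfl
    · obtain ⟨hk, hl⟩ := hy k l hkl
      have h1 : |k - l| ≤ K := not_lt.1 fun h => hkl (hK k l h)
      rw [abs_le] at h1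
      rw [Finset.sum_eq_single k, Finset.sum_eq_single l]
      · simp
      · intro j _ hj
        rw [if_pos rfl, if_neg hj.symm]
      · intro h
        exact (h (Finset.mem_filter.2 ⟨Finset.mem_Icc.2 ⟨by omega, by omega⟩, hl⟩)).elim
      · intro i _ hi
        exact Finset.sum_eq_zero fun j _ => if_neg hi.symm
      · intro h
        exact (h (Finset.mem_filter.2 ⟨Finset.mem_Icc.2 ⟨by omega, by omega⟩, hk⟩)).elim
  · change _ = cenLin _
    simp only [map_sum, map_smul, hcen, smul_zero, Finset.sum_const_zero]
    exact h0

theorem level_le_map_realize (D₁ : Model left χ (conatural left))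
    (D₂ : Model right χ (natural right)) (l : ℕ) :
    level χ c l ≤ (tensLevel D₁ D₂ l).map (realize c D₁ D₂ l) := by
  induction l with
  | zero =>
    refine Submodule.span_le.2 ?_
    rintro _ ⟨v, rfl⟩
    change Ind.baseLin χ c v ∈ _
    induction v using TensorProduct.induction_on with
    | zero => rw [map_zero]; exact zero_mem _
    | add v w hv hw => rw [map_add]; exact add_mem hv hw
    | tmul u v =>
      obtain ⟨y, hy, rfl⟩ := D₁.surjective u
      obtain ⟨x, hx, rfl⟩ := D₂.surjective v
      refine ⟨prepend Fin.elim0 x ⊗ₜ prepend Fin.elim0 y,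
        prepend_tmul_mem_tensLevel (fun k => k.elim0) (fun k => k.elim0) hx hy, ?_⟩
      rw [realize_tmul]
      rfl
  | succ l ih =>
    refine Submodule.span_le.2 ?_
    rintro _ ⟨y, hy, w, hw, rfl⟩
    obtain ⟨t, ht, rfl⟩ := ih hw
    have key : ∀ i j, right i → left j → unitOp χ c i j (realize c D₁ D₂ l t) ∈
        (tensLevel D₁ D₂ (l + 1)).map (realize c D₁ D₂ (l + 1)) := by
      intro i j hi hj
      clear hw
      induction ht using Submodule.span_induction with
      | zero => rw [map_zero, map_zero]; exact zero_mem _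
      | add s t _ _ hs ht => rw [map_add, map_add]; exact add_mem hs ht
      | smul r t _ ht => rw [map_smul, map_smul]; exact Submodule.smul_mem _ r ht
      | mem t ht =>
        obtain ⟨a, b, x, y, ha, hb, hx, hy, rfl⟩ := ht
        refine ⟨prepend (Fin.cons i a) x ⊗ₜ prepend (Fin.cons j b) y,
          prepend_tmul_mem_tensLevel ?_ ?_ hx hy, ?_⟩
        · exact Fin.cases hi ha
        · exact Fin.cases hj hb
        · rw [realize_tmul, realize_tmul]
          rfl
    obtain ⟨R, hR⟩ := lower_eq_sum hy
    change act GlHat (Ind χ c) y _ ∈ _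
    rw [hR]
    have hsum : act GlHat (Ind χ c) (∑ i ∈ R with right i, ∑ j ∈ R with left j,
        entry (mat y).1 i j • unitHat i j) (realize c D₁ D₂ l t) =
        ∑ i ∈ R with right i, ∑ j ∈ R with left j,
          entry (mat y).1 i j • unitOp χ c i j (realize c D₁ D₂ l t) := by
      have : ∀ X, act GlHat (Ind χ c) X (realize c D₁ D₂ l t) =
        (LinearMap.applyₗ (realize c D₁ D₂ l t) ∘ₗ (act GlHat (Ind χ c)).toLinearMap) X :=
        fun _ => rfl
      rw [this]
      simp only [map_sum, map_smul]
      rfl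
    rw [hsum]
    exact sum_mem fun i hi => sum_mem fun j hj => Submodule.smul_mem _ _
      (key i j (Finset.mem_filter.1 hi).2 (Finset.mem_filter.1 hj).2)

variable (χ) in
/-- No nonzero vector of level `l` of `Ind_{χ,-N}` is annihilated by `a₊`. -/
def NoInvariants (N l : ℕ) : Prop :=
  ∀ w ∈ level χ (-(N : ℂ)) l,
    (∀ i j, right i → left j → unitOp χ (-(N : ℂ)) j i w = 0) → w = 0

/-- The polynomial is fixed before `N` is chosen, and `N ↦ -l N` is injective because `l > 0`, so
only finitely many `N` hit a root. -/
theorem eventually_noInvariants (hχ : IsSemidominant χ) {l : ℕ} (hl : 0 < l) :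
    ∀ᶠ N : ℕ in atTop, NoInvariants χ N l := by
  obtain ⟨D₁⟩ := nonempty_model_left hχ
  obtain ⟨D₂⟩ := nonempty_model_right hχ
  obtain ⟨p, hp, hp0⟩ := exists_monic_aeval_transpositions₂ (κ := D₂.κ) (κ' := D₁.κ) l
  have hinj : Function.Injective fun N : ℕ => (l : ℂ) * -(N : ℂ) := by
    intro N N' h
    have h1 : -(N : ℂ) = -(N' : ℂ) := mul_left_cancel₀ (Nat.cast_ne_zero.2 hl.ne') h
    exact_mod_cast neg_injective h1
  have hfin : {N : ℕ | p.eval ((l : ℂ) * -(N : ℂ)) = 0}.Finite := by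
    refine (Set.Finite.preimage hinj.injOn (Polynomial.finite_setOfPred_isRoot hp.ne_zero)).subset ?_
    exact fun N hN => hN
  have hev : ∀ᶠ N : ℕ in atTop, N ∉ {N : ℕ | p.eval ((l : ℂ) * -(N : ℂ)) = 0} := by
    rw [← Nat.cofinite_eq_atTop]
    exact hfin.compl_mem_cofinite
  filter_upwards [hev] with N hN w hw hinv
  obtain ⟨t, ht, rfl⟩ := level_le_map_realize D₁ D₂ l hw
  exact realize_eq_zero hp0 hN ht hinv

/-! ### The grading of the induced module by levels -/

/-- The matrix `J` in `GlHat`. -/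
def jHat : GlHat := ofMat J

theorem dJ_J : dJ J = 0 := sub_self _

theorem jHat_lie {X : GlHat} (z : ℂ) (h : dJ (mat X) = z • mat X) (hX : cen X = 0) :
    ⁅jHat, X⁆ = z • X := by
  refine glHat_ext h ?_
  rw [cen_lie, cen_smul, hX, mul_zero]
  change tr (dJ J * mat X) = 0
  rw [dJ_J, zero_mul]
  exact finsum_eq_zero_of_forall_eq_zero fun i => entry_zero i i

theorem jHat_lie_aMinus {y : GlHat} (hy : y ∈ aMinus) : ⁅jHat, y⁆ = (-1 : ℂ) • y := by
  refine jHat_lie _ (mat_ext fun i j => ?_) hy.1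
  change _ = (-1 : ℂ) * entry (mat y).1 i j
  rw [entry_dJ]
  by_cases h : entry (mat y).1 i j = 0
  · simp [h]
  · obtain ⟨hi, hj⟩ := hy.2 i j h
    rw [if_neg (not_le.2 hi), if_pos hj]
    ring

theorem jHat_lie_upper {i j : ℤ} (hi : right i) (hj : left j) :
    ⁅jHat, unitHat j i⁆ = (1 : ℂ) • unitHat j i := by
  refine jHat_lie _ ?_ rfl
  change dJ (unitMat j i) = (1 : ℂ) • unitMat j i
  rw [dJ_unitMat, if_pos hj, if_neg (not_le.2 hi), sub_zero]

variable (χ c) in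
/-- The action of `J` on the induced module. -/
def jOp : Module.End ℂ (Ind χ c) := act GlHat (Ind χ c) jHat

theorem jOp_smul_eigen {X : GlHat} {z μ : ℂ} (hX : ⁅jHat, X⁆ = z • X) {w : Ind χ c}
    (hw : jOp χ c w = μ • w) : jOp χ c (UniversalEnvelopingAlgebra.ι ℂ X • w) =
      (μ + z) • UniversalEnvelopingAlgebra.ι ℂ X • w := by
  refine (Ind.smul_sub_smul jHat X w).trans ?_
  have hw' : UniversalEnvelopingAlgebra.ι ℂ jHat • w = μ • w := hw
  rw [hX, hw', map_smul, smul_assoc, smul_comm _ μ w, add_smul]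

/-- Within the first block `J` is the identity matrix, hence central, so it acts everywhere by its
value on the highest weight vector. That value is finite because `χ` has finite support. -/
theorem identity_smul_irr (u : Irr left χ) :
    UniversalEnvelopingAlgebra.ι ℂ (compress left J) • u = weight χ (compress left J).1 • u := by
  have hcomm : ∀ u : UniversalEnvelopingAlgebra ℂ (block left),
      u * UniversalEnvelopingAlgebra.ι ℂ (compress left J) =
        UniversalEnvelopingAlgebra.ι ℂ (compress left J) * u := by
    have : Subalgebra.centralizer ℂ
        {UniversalEnvelopingAlgebra.ι ℂ (compress left J)} = ⊤ := by
      refine enveloping_eq_top _ fun A => ?_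
      rw [Subalgebra.mem_centralizer_iff]
      rintro _ rfl
      have hJ : (compress left J).1 = J := mat_ext fun i j => by
        rw [entry_compress]
        change _ = entry (idem (· ≤ 0)).1 i j
        by_cases h : left i ∧ left j
        · rw [if_pos h]; rfl
        · rw [if_neg h, entry_idem, if_neg]
          rintro ⟨rfl, h'⟩
          exact h ⟨h', h'⟩
      have h0 : ⁅compress left J, A⁆ = 0 := by
        refine Subtype.ext ?_
        change (compress left J).1 * A.1 - A.1 * (compress left J).1 = 0
        rw [hJ]
        refine mat_ext fun i j => ?_
        change entry (dJ A.1).1 i j = 0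
        rw [entry_dJ]
        by_cases h : entry A.1.1 i j = 0
        · simp [h]
        · obtain ⟨hi, hj⟩ := A.2 i j h
          rw [if_pos hi, if_pos hj, sub_self]
      have h1 := LieHom.map_lie (UniversalEnvelopingAlgebra.ι ℂ) (compress left J) A
      rw [h0, map_zero, LieRing.of_associative_ring_bracket] at h1
      exact sub_eq_zero.1 h1.symm
    intro u
    have hu : u ∈ Subalgebra.centralizer ℂ {UniversalEnvelopingAlgebra.ι ℂ (compress left J)} :=
      this ▸ Algebra.mem_top
    exact ((Subalgebra.mem_centralizer_iff ℂ).1 hu _ rfl).symm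
  obtain ⟨a, rfl⟩ := Irr.proj_surjective left χ u
  have hmem : UniversalEnvelopingAlgebra.ι ℂ (compress left J) -
      algebraMap ℂ _ (weight χ (compress left J).1) ∈ vermaIdeal left χ :=
    Submodule.subset_span (Or.inr ⟨compress left J, fun i j hij => by
      rw [entry_compress]
      change (if _ then entry (idem (· ≤ 0)).1 i j else 0) = 0
      rw [entry_idem, if_neg (show ¬ (i = j ∧ i ≤ 0) from fun h => hij h.1), ite_self], rfl⟩)
  have h2 : Irr.proj left χ (UniversalEnvelopingAlgebra.ι ℂ (compress left J)) =
      Irr.proj left χ (algebraMap ℂ _ (weight χ (compress left J).1)) := by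
    rw [← sub_eq_zero, ← map_sub]
    have h3 : (vermaIdeal left χ).mkQ (UniversalEnvelopingAlgebra.ι ℂ (compress left J) -
        algebraMap ℂ _ (weight χ (compress left J).1)) = 0 :=
      (Submodule.Quotient.mk_eq_zero _).2 hmem
    exact (congrArg (maxSub (UniversalEnvelopingAlgebra ℂ (block left)) (Verma left χ)).mkQ h3).trans
      (map_zero _)
  rw [← map_smul, smul_eq_mul, ← hcomm, ← smul_eq_mul, map_smul, h2, ← map_smul, smul_eq_mul,
    ← Algebra.commutes, ← Algebra.smul_def]
  exact ((Irr.proj left χ).restrictScalars ℂ).map_smul _ a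

variable (χ) in
/-- The eigenvalue of `J` on level `l`. -/
def jEigenvalue (l : ℕ) : ℂ := weight χ (compress left J).1 - l

theorem jEigenvalue_injective : Function.Injective (jEigenvalue χ) := fun l l' h => by
  have : (l : ℂ) = l' := sub_right_injective h
  exact_mod_cast this

theorem compress_of_block {p : ℤ → Prop} [DecidablePred p] (A : block p) : compress p A.1 = A := by
  refine Subtype.ext (mat_ext fun i j => ?_)
  rw [entry_compress]
  split_ifs with h
  · rfl
  · by_contra h0
    exact h (A.2 i j (Ne.symm h0))

theorem compress_eq_zero {p : ℤ → Prop} [DecidablePred p] {A : Mat}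
    (h : ∀ i j, p i → p j → entry A.1 i j = 0) : compress p A = 0 := by
  refine Subtype.ext (mat_ext fun i j => ?_)
  rw [entry_compress]
  split_ifs with h'
  · exact h i j h'.1 h'.2
  · rfl

theorem ofMat_smul_base {A : Mat} (hA : ∀ i j, right i → left j → entry A.1 i j = 0)
    (v : Irr left χ ⊗[ℂ] Irr right χ) :
    UniversalEnvelopingAlgebra.ι ℂ (ofMat A) • Ind.baseLin χ c v = Ind.baseLin χ c
      (LinearMap.rTensor (Irr right χ) (act _ _ (compress left A)) v +
        LinearMap.lTensor (Irr left χ) (act _ _ (compress right A)) v) := by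
  refine (Ind.parabolic_smul_base ⟨ofMat A, hA⟩ v).trans (congrArg _ ?_)
  change _ + _ + (c * cen (ofMat A)) • v = _
  rw [cen_ofMat, mul_zero, zero_smul, add_zero]
  rfl

theorem jOp_base (v : Irr left χ ⊗[ℂ] Irr right χ) :
    jOp χ c (Ind.baseLin χ c v) = jEigenvalue χ 0 • Ind.baseLin χ c v := by
  have hent : ∀ i j, entry J.1 i j = if i = j ∧ i ≤ 0 then 1 else 0 := entry_idem (· ≤ 0)
  refine (ofMat_smul_base (fun i j hi hj => ?_) v).trans ?_
  · rw [hent, if_neg fun h => by omega]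
  · rw [compress_eq_zero (p := right) fun i j hi _ => by rw [hent, if_neg fun h => by omega],
      map_zero, LinearMap.lTensor_zero, LinearMap.zero_apply, add_zero, ← map_smul]
    congr 1
    have : act _ (Irr left χ) (compress left J) = weight χ (compress left J).1 • LinearMap.id :=
      LinearMap.ext identity_smul_irr
    rw [this, LinearMap.rTensor_smul, LinearMap.rTensor_id, jEigenvalue, Nat.cast_zero, sub_zero]
    rfl

theorem level_zero : level χ c 0 = LinearMap.range (Ind.baseLin χ c) :=
  Submodule.span_eq (LinearMap.range (Ind.baseLin χ c))

theorem level_le_eigenspace (l : ℕ) :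
    level χ c l ≤ (jOp χ c).eigenspace (jEigenvalue χ l) := by
  induction l with
  | zero =>
    rw [level_zero]
    rintro _ ⟨v, rfl⟩
    exact Module.End.mem_eigenspace_iff.2 (jOp_base v)
  | succ l ih =>
    refine Submodule.span_le.2 ?_
    rintro _ ⟨y, hy, w, hw, rfl⟩
    have h := jOp_smul_eigen (jHat_lie_aMinus hy) (Module.End.mem_eigenspace_iff.1 (ih hw))
    refine Module.End.mem_eigenspace_iff.2 (h.trans ?_)
    congr 1
    rw [jEigenvalue, jEigenvalue, Nat.cast_succ]
    ring

theorem aMinus_smul_mem_level {y : GlHat} (hy : y ∈ aMinus) {l : ℕ} {w : Ind χ c}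
    (hw : w ∈ level χ c l) : UniversalEnvelopingAlgebra.ι ℂ y • w ∈ level χ c (l + 1) :=
  Submodule.subset_span ⟨y, hy, w, hw, rfl⟩

theorem exists_parabolic_add_aMinus (X : GlHat) :
    ∃ x : parabolic, ∃ y ∈ aMinus, X = x.1 + y := by
  let y : GlHat := ofMat (idem right * mat X * idem left)
  have hy : ∀ i j, entry (mat y).1 i j =
      if left j then if right i then entry (mat X).1 i j else 0 else 0 := fun i j => by
    change entry (idem right * mat X * idem left : Mat).1 i j = _
    rw [entry_mul_idem, entry_idem_mul]
  refine ⟨⟨X - y, fun i j hi hj => ?_⟩, y, ⟨rfl, fun i j h => ?_⟩, (sub_add_cancel X y).symm⟩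
  · change entry (mat X).1 i j - entry (mat y).1 i j = 0
    rw [hy, if_pos hj, if_pos hi, sub_self]
  · rw [hy] at h
    by_cases hj : left j
    · by_cases hi : right i
      · exact ⟨hi, hj⟩
      · rw [if_pos hj, if_neg hi] at h
        exact (h rfl).elim
    · rw [if_neg hj] at h
      exact (h rfl).elim

/-- The sum of the levels is stable under every `X`, by induction on the level for all `X` at once:
`X y w = y X w + [X, y] w`, where `w` lies one level lower. It contains the generators. -/
theorem iSup_level : ⨆ l, level χ c l = ⊤ := by
  have hy : ∀ y ∈ aMinus, ∀ w ∈ ⨆ l, level χ c l,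
      UniversalEnvelopingAlgebra.ι ℂ y • w ∈ ⨆ l, level χ c l := by
    intro y hy w hw
    induction hw using Submodule.iSup_induction' with
    | mem l w hw => exact Submodule.mem_iSup_of_mem (l + 1) (aMinus_smul_mem_level hy hw)
    | zero => rw [smul_zero]; exact zero_mem _
    | add v w _ _ hv hw => rw [smul_add]; exact add_mem hv hw
  have hstable : ∀ l, ∀ w ∈ level χ c l, ∀ X : GlHat,
      UniversalEnvelopingAlgebra.ι ℂ X • w ∈ ⨆ l, level χ c l := by
    intro l
    induction l with
    | zero =>
      intro w hw X
      obtain ⟨x, y, hy', rfl⟩ := exists_parabolic_add_aMinus X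
      rw [map_add, add_smul]
      refine add_mem ?_ (hy y hy' w (Submodule.mem_iSup_of_mem 0 hw))
      rw [level_zero] at hw
      obtain ⟨v, rfl⟩ := hw
      rw [Ind.parabolic_smul_base]
      refine Submodule.mem_iSup_of_mem 0 ?_
      rw [level_zero]
      exact ⟨_, rfl⟩
    | succ l ih =>
      intro w hw X
      induction hw using Submodule.span_induction with
      | zero => rw [smul_zero]; exact zero_mem _
      | add v w _ _ hv hw => rw [smul_add]; exact add_mem hv hw
      | smul r w _ hw => rw [smul_comm]; exact Submodule.smul_mem _ r hw
      | mem w hw =>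
        obtain ⟨y, hy', w, hw, rfl⟩ := hw
        rw [Ind.smul_sub_smul]
        exact add_mem (hy y hy' _ (ih w hw X)) (ih w hw _)
  have hX : ∀ X : GlHat, ∀ w ∈ ⨆ l, level χ c l,
      UniversalEnvelopingAlgebra.ι ℂ X • w ∈ ⨆ l, level χ c l := by
    intro X w hw
    induction hw using Submodule.iSup_induction' with
    | mem l w hw => exact hstable l w hw X
    | zero => rw [smul_zero]; exact zero_mem _
    | add v w _ _ hv hw => rw [smul_add]; exact add_mem hv hw
  let P : Submodule (UniversalEnvelopingAlgebra ℂ GlHat) (Ind χ c) :=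
    { carrier := (⨆ l, level χ c l : Submodule ℂ (Ind χ c))
      add_mem' := fun ha hb => add_mem ha hb
      zero_mem' := zero_mem _
      smul_mem' := fun u w hw => enveloping_smul_mem (g := GlHat) _ hX u hw }
  have hP : P = ⊤ := Ind.eq_top_of_base_mem fun v => by
    change _ ∈ ⨆ l, level χ c l
    refine Submodule.mem_iSup_of_mem 0 ?_
    rw [level_zero]
    exact ⟨v, rfl⟩
  refine Submodule.eq_top_iff'.2 fun w => ?_
  have hw : w ∈ P := hP ▸ Submodule.mem_top
  exact hw

theorem iSup_level_ne_le (l : ℕ) : ⨆ k, ⨆ (_ : k ≠ l), level χ c k ≤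
    ⨆ μ, ⨆ (_ : μ ≠ jEigenvalue χ l), (jOp χ c).eigenspace μ :=
  iSup₂_le fun k hk => (level_le_eigenspace k).trans
    (le_iSup₂_of_le (jEigenvalue χ k) (fun h => hk (jEigenvalue_injective h)) le_rfl)

/-- The levels span everything and lie in eigenspaces of `J` for distinct eigenvalues, so each fills
its eigenspace, by the modular law. Membership in a level can thus be read off from the
`J`-eigenvalue. -/
theorem eigenspace_eq_level (l : ℕ) : (jOp χ c).eigenspace (jEigenvalue χ l) = level χ c l := by
  have hdisj := ((jOp χ c).eigenspaces_iSupIndep (jEigenvalue χ l)).mono_right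
    (iSup_level_ne_le (χ := χ) (c := c) l)
  refine le_antisymm ?_ (level_le_eigenspace l)
  have htop : level χ c l ⊔ ⨆ k, ⨆ (_ : k ≠ l), level χ c k = ⊤ := by
    rw [eq_top_iff, ← iSup_level]
    refine iSup_le fun k => ?_
    by_cases hk : k = l
    · subst hk
      exact le_sup_left
    · exact (le_iSup₂_of_le (f := fun k (_ : k ≠ l) => level χ c k) k hk le_rfl).trans le_sup_right
  have := sup_inf_assoc_of_le (⨆ k, ⨆ (_ : k ≠ l), level χ c k) (level_le_eigenspace (c := c) l)
  rw [htop, top_inf_eq, inf_comm, hdisj.eq_bot, sup_bot_eq] at this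
  exact this.le

/-- The components of a vector of a stable subspace with respect to distinct eigenvalues lie
in that subspace. -/
theorem eigen_component_mem {M ι : Type*} [AddCommGroup M] [Module ℂ M] (f : Module.End ℂ M)
    (P : Submodule ℂ M) (hP : ∀ w ∈ P, f w ∈ P) {μ : ι → ℂ} (hμ : Function.Injective μ)
    (s : Finset ι) (w : ι → M) (hw : ∀ k ∈ s, f (w k) = μ k • w k) (hs : ∑ k ∈ s, w k ∈ P) :
    ∀ k ∈ s, w k ∈ P := by
  classical
  induction s using Finset.induction_on generalizing w with
  | empty => simp
  | insert a s ha ih =>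
    have hws : ∀ k ∈ s, f (w k) = μ k • w k := fun k hk => hw k (Finset.mem_insert_of_mem hk)
    -- Applying `f - μ a` removes the component at `a` and rescales the others by nonzero factors.
    have h1 : ∑ k ∈ s, (μ k - μ a) • w k ∈ P := by
      have h2 := P.sub_mem (hP _ hs) (P.smul_mem (μ a) hs)
      rw [Finset.sum_insert ha, map_add, map_sum, Finset.sum_congr rfl hws,
        hw a (Finset.mem_insert_self a s), smul_add, Finset.smul_sum, add_sub_add_left_eq_sub,
        ← Finset.sum_sub_distrib] at h2
      simpa only [sub_smul] using h2
    have h3 := ih (fun k => (μ k - μ a) • w k)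
      (fun k hk => by rw [map_smul, hws k hk, smul_comm]) h1
    have h4 : ∀ k ∈ s, w k ∈ P := fun k hk => by
      have hne : μ k - μ a ≠ 0 := sub_ne_zero.2 fun h => ha (hμ h ▸ hk)
      have := P.smul_mem (μ k - μ a)⁻¹ (h3 k hk)
      rwa [inv_smul_smul₀ hne] at this
    intro k hk
    rcases Finset.mem_insert.1 hk with rfl | hk
    · rw [Finset.sum_insert ha] at hs
      exact (P.add_mem_iff_left (P.sum_mem h4)).1 hs
    · exact h4 k hk

/-! ### The maximal submodule -/

/-- The `v` with `1 ⊗ v ∈ P` form a subspace stable under both blocks. If it were nonzero it would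
be everything, and `P` would contain the generators. -/
theorem level_zero_inf_eq_bot (hχ : IsSemidominant χ)
    {P : Submodule (UniversalEnvelopingAlgebra ℂ GlHat) (Ind χ c)} (hP : P ≠ ⊤) {w : Ind χ c}
    (hw : w ∈ P) (hw0 : w ∈ level χ c 0) : w = 0 := by
  rw [level_zero] at hw0
  obtain ⟨v, rfl⟩ := hw0
  by_contra hne
  let Q : Submodule ℂ (Irr left χ ⊗[ℂ] Irr right χ) :=
    (P.restrictScalars ℂ).comap (Ind.baseLin χ c)
  have hQ : Q = ⊤ := by
    refine irr_tensor_eq_top_of_ne_bot hχ Q ?_ ?_ ?_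
    · intro A v hv
      have h := P.smul_mem (UniversalEnvelopingAlgebra.ι ℂ (ofMat A.1)) hv
      rw [ofMat_smul_base fun i j hi _ => by
          by_contra h0
          have := (A.2 i j h0).1
          omega,
        compress_of_block, compress_eq_zero (p := right) fun i j hi _ => by
          by_contra h0
          have := (A.2 i j h0).1
          omega,
        map_zero, LinearMap.lTensor_zero, LinearMap.zero_apply, add_zero] at h
      exact h
    · intro A v hv
      have h := P.smul_mem (UniversalEnvelopingAlgebra.ι ℂ (ofMat A.1)) hv
      rw [ofMat_smul_base fun i j _ hj => by
          by_contra h0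
          have := (A.2 i j h0).2
          omega,
        compress_of_block, compress_eq_zero (p := left) fun i j hi _ => by
          by_contra h0
          have := (A.2 i j h0).1
          omega,
        map_zero, LinearMap.rTensor_zero, LinearMap.zero_apply, zero_add] at h
      exact h
    · intro h0
      have hv : v ∈ Q := hw
      rw [h0, Submodule.mem_bot] at hv
      exact hne (by rw [hv, map_zero])
  refine hP (Ind.eq_top_of_base_mem fun v => ?_)
  have hv : v ∈ Q := hQ ▸ Submodule.mem_top
  exact hv

/-- A sum of proper submodules could a priori meet level 0. But each of them is stable under `J`, so
contains the level components of its elements, and its level 0 components vanish; all of them lie in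
the sum of the positive levels. -/
theorem maxSubmodule_inf_level_zero (hχ : IsSemidominant χ) :
    maxSubmodule χ c ⊓ level χ c 0 = ⊥ := by
  have hle : ∀ w ∈ maxSub (UniversalEnvelopingAlgebra ℂ GlHat) (Ind χ c),
      w ∈ ⨆ k, ⨆ (_ : k ≠ 0), level χ c k := by
    intro w hw
    rw [maxSub, sSup_eq_iSup'] at hw
    induction hw using Submodule.iSup_induction' with
    | zero => exact zero_mem _
    | add v w _ _ hv hw => exact add_mem hv hw
    | mem P w hw =>
      have hwt : w ∈ ⨆ l, level χ c l := by rw [iSup_level]; exact Submodule.mem_top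
      obtain ⟨f, hf, rfl⟩ := (Submodule.mem_iSup_iff_exists_finsupp _ _).1 hwt
      have hcomp := eigen_component_mem (jOp χ c) (P.1.restrictScalars ℂ)
        (fun w hw => P.1.smul_mem _ hw) (jEigenvalue_injective (χ := χ)) f.support f
        (fun k _ => Module.End.mem_eigenspace_iff.1 (level_le_eigenspace k (hf k))) hw
      refine sum_mem fun k hk => ?_
      by_cases h0 : k = 0
      · subst h0
        beta_reduce
        rw [level_zero_inf_eq_bot hχ P.2 (hcomp 0 hk) (hf 0)]
        exact zero_mem _
      · exact Submodule.mem_iSup_of_mem k (Submodule.mem_iSup_of_mem h0 (hf k))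
  have hdisj := (((jOp χ c).eigenspaces_iSupIndep (jEigenvalue χ 0)).mono_right
    (iSup_level_ne_le (χ := χ) (c := c) 0)).mono_left (level_le_eigenspace 0)
  refine eq_bot_iff.2 fun w hw => ?_
  exact (Submodule.disjoint_def.1 hdisj w hw.2 (hle w hw.1)).symm ▸ zero_mem _

theorem unitOp_mem_level {i j : ℤ} (hi : right i) (hj : left j) {l : ℕ} {w : Ind χ c}
    (hw : w ∈ level χ c (l + 1)) : unitOp χ c j i w ∈ level χ c l := by
  rw [← eigenspace_eq_level]
  have h := jOp_smul_eigen (jHat_lie_upper hi hj)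
    (Module.End.mem_eigenspace_iff.1 (level_le_eigenspace (l + 1) hw))
  refine Module.End.mem_eigenspace_iff.2 (h.trans ?_)
  have : jEigenvalue χ (l + 1) + 1 = jEigenvalue χ l := by
    rw [jEigenvalue, jEigenvalue, Nat.cast_succ]
    ring
  rw [this]
  rfl

/-- An element on level `l + 1` is sent by `a₊` into the intersection on level `l`, which is zero by
induction, so it is `a₊`-invariant. -/
theorem maxSubmodule_inf_level (hχ : IsSemidominant χ) {N d : ℕ}
    (hN : ∀ l, 0 < l → l < d → NoInvariants χ N l) (l : ℕ) (hl : l < d) :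
    maxSubmodule χ (-(N : ℂ)) ⊓ level χ (-(N : ℂ)) l = ⊥ := by
  induction l with
  | zero => exact maxSubmodule_inf_level_zero hχ
  | succ l ih =>
    refine eq_bot_iff.2 fun w hw => ?_
    refine hN (l + 1) l.succ_pos hl w hw.2 fun i j hi hj => ?_
    have h : unitOp χ (-(N : ℂ)) j i w ∈ maxSubmodule χ (-(N : ℂ)) ⊓ level χ (-(N : ℂ)) l :=
      ⟨Submodule.smul_mem (maxSub (UniversalEnvelopingAlgebra ℂ GlHat) (Ind χ (-(N : ℂ))))
        (UniversalEnvelopingAlgebra.ι ℂ (unitHat j i)) hw.1, unitOp_mem_level hi hj hw.2⟩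
    rw [ih (Nat.lt_of_succ_lt hl)] at h
    exact h

theorem not_isSingular {N l : ℕ} (hN : NoInvariants χ N l) {w : Ind χ (-(N : ℂ))}
    (hw : w ∈ level χ (-(N : ℂ)) l) : ¬ IsSingular w := by
  rintro ⟨hne, hsing⟩
  refine hne (hN w hw fun i j hi hj => hsing (unitHat j i) ⟨rfl, fun k m hmk => ?_⟩)
  change entry (unitMat j i).1 k m = 0
  rw [entry_unitMat, if_neg]
  rintro ⟨rfl, rfl⟩
  omega

end Levels

end GlInfty

end

/-! ### The choice of `δ`. -/

theorem theorem2p1p1 (χ : ℤ →₀ ℂ) (hχ : GlInfty.IsSemidominant χ) :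
    ∃ δ : ℕ → ℕ, Tendsto δ atTop atTop ∧ ∀ N : ℕ,
      (∀ l : ℕ, 0 < l → l < δ N →
        ∀ w ∈ GlInfty.level χ (-(N : ℂ)) l, ¬ GlInfty.IsSingular w) ∧
      (∀ l : ℕ, l < δ N →
        GlInfty.maxSubmodule χ (-(N : ℂ)) ⊓ GlInfty.level χ (-(N : ℂ)) l = ⊥) := by
  classical
  let good : ℕ → ℕ → Prop := fun N d => ∀ l, 0 < l → l < d → GlInfty.NoInvariants χ N l
  have hgood0 : ∀ N, good N 0 := fun N l _ hl => (Nat.not_lt_zero l hl).elim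
  -- The bound `N` guarantees that a greatest `d` exists; `d = 0` is vacuously good. For fixed `d`
  -- only finitely many levels are involved, so all large `N ≥ d` are good for `d` and `δ N ≥ d`.
  refine ⟨fun N => Nat.findGreatest (good N) N, tendsto_atTop.2 fun d => ?_, fun N => ?_⟩
  · have hev : ∀ᶠ N : ℕ in atTop, ∀ l ∈ Finset.Ioo 0 d, GlInfty.NoInvariants χ N l :=
      (Finset.eventually_all _).2 fun l hl =>
        GlInfty.eventually_noInvariants hχ (Finset.mem_Ioo.1 hl).1
    filter_upwards [hev, eventually_ge_atTop d] with N hN hd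
    exact Nat.le_findGreatest hd fun l h0 h1 => hN l (Finset.mem_Ioo.2 ⟨h0, h1⟩)
  · have hN : good N (Nat.findGreatest (good N) N) :=
      Nat.findGreatest_spec (Nat.zero_le N) (hgood0 N)
    exact ⟨fun l h0 h1 w hw => GlInfty.not_isSingular (hN l h0 h1) hw,
      GlInfty.maxSubmodule_inf_level hχ hN⟩
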